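/- An instance of the Fault-Tolerant Path problem (FTP) consists of a finite directed graph $D=(V,A)$ (parallel arcs allowed) with nonnegative rational arc weights $w$, two nodes $s,t\in V$, a set $M\subseteq A$ of vulnerable arcs, and an integer $k\ge 1$. A set $S\subseteq A$ is feasible if $S\setminus F$ contains a directed $s$-$t$ path for every $F\subseteq M$ with $|F|\le k$; its cost is $w(S)=\sum_{e\in S}w_e$. There is a polynomial-time $k$-approximation algorithm for FTP. That is, there is a single deterministic algorithm (a program for a random access machine with integer variables and arrays and unit-cost addition, subtraction, halving and comparison, but no multiplication) which, given any instance $(D,w,s,t,M,k)$, halts after a number of steps that is at most a fixed polynomial in $|V|$ plus the length of the binary encoding of $(D,w,s,t,M,k)$, and either outputs a feasible set $S\subseteq A$ with $w(S)\le k\cdot w(T)$ for every feasible set $T\subseteq A$, or correctly reports that no feasible set exists. -/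

import Mathlib

/-! ### Random access machines

Programs with integer variables and integer arrays of unbounded length. The elementary operations
are addition, subtraction, halving, array access, assignment and comparison. There is no
multiplication, so an elementary operation produces numbers that are at most one bit longer than
those already present, and counting every elementary operation as one step is polynomially
equivalent to the running time of a Turing machine on the binary encoding of the input. -/

namespace RAM

/-- The memory: variable number `x` holds `var x`, and cell `i` of array number `a` holds
`arr a i`. -/
structure State where
  var : ℕ → ℤ
  arr : ℕ → ℤ → ℤ

/-- Integer expressions. -/
inductive Expr where
  | const (c : ℤ)
  | var (x : ℕ)
  | get (a : ℕ) (i : Expr)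
  | add (e f : Expr)
  | sub (e f : Expr)
  | half (e : Expr)

/-- The value of an expression; `half` rounds down. -/
def Expr.eval (σ : State) : Expr → ℤ
  | .const c => c
  | .var x => σ.var x
  | .get a i => σ.arr a (i.eval σ)
  | .add e f => e.eval σ + f.eval σ
  | .sub e f => e.eval σ - f.eval σ
  | .half e => e.eval σ / 2

/-- The number of elementary operations needed to evaluate an expression. -/
def Expr.time : Expr → ℕ
  | .const _ => 1
  | .var _ => 1
  | .get _ i => i.time + 1
  | .add e f => e.time + f.time + 1
  | .sub e f => e.time + f.time + 1
  | .half e => e.time + 1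

/-- Programs: `assign x e` is `x := e`, `store a i e` is `a[i] := e`, `ite e f P Q` is
`if e ≤ f then P else Q`, and `loop e f P` is `while e < f do P`. -/
inductive Prog where
  | skip
  | assign (x : ℕ) (e : Expr)
  | store (a : ℕ) (i e : Expr)
  | seq (P Q : Prog)
  | ite (e f : Expr) (P Q : Prog)
  | loop (e f : Expr) (P : Prog)

/-- The state after `x := v`. -/
def State.setVar (σ : State) (x : ℕ) (v : ℤ) : State :=
  { σ with var := Function.update σ.var x v }

/-- The state after `a[i] := v`. -/
def State.setArr (σ : State) (a : ℕ) (i v : ℤ) : State :=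
  { σ with arr := Function.update σ.arr a (Function.update (σ.arr a) i v) }

/-- `Exec P σ n τ`: started in state `σ`, the program `P` halts in state `τ` after exactly
`n` steps. -/
inductive Exec : Prog → State → ℕ → State → Prop where
  | skip (σ : State) : Exec .skip σ 1 σ
  | assign (x : ℕ) (e : Expr) (σ : State) :
      Exec (.assign x e) σ (e.time + 1) (σ.setVar x (e.eval σ))
  | store (a : ℕ) (i e : Expr) (σ : State) :
      Exec (.store a i e) σ (i.time + e.time + 1) (σ.setArr a (i.eval σ) (e.eval σ))
  | seq {P Q : Prog} {σ τ υ : State} {m n : ℕ} :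
      Exec P σ m τ → Exec Q τ n υ → Exec (.seq P Q) σ (m + n) υ
  | ite_true {e f : Expr} {P Q : Prog} {σ τ : State} {n : ℕ} :
      e.eval σ ≤ f.eval σ → Exec P σ n τ →
        Exec (.ite e f P Q) σ (e.time + f.time + 1 + n) τ
  | ite_false {e f : Expr} {P Q : Prog} {σ τ : State} {n : ℕ} :
      ¬ e.eval σ ≤ f.eval σ → Exec Q σ n τ →
        Exec (.ite e f P Q) σ (e.time + f.time + 1 + n) τ
  | loop_true {e f : Expr} {P : Prog} {σ τ υ : State} {m n : ℕ} :
      e.eval σ < f.eval σ → Exec P σ m τ → Exec (.loop e f P) τ n υ →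
        Exec (.loop e f P) σ (e.time + f.time + 1 + m + n) υ
  | loop_false {e f : Expr} {P : Prog} {σ : State} :
      ¬ e.eval σ < f.eval σ → Exec (.loop e f P) σ (e.time + f.time + 1) σ

/-- The initial state on a finite sequence of integers: the sequence is stored in cells
`0, 1, 2, …` of array `0`, its length is stored in variable `0`, all the rest is zero. -/
def initial (input : List ℤ) : State where
  var x := if x = 0 then input.length else 0
  arr a i := if a = 0 ∧ 0 ≤ i then input.getD i.toNat 0 else 0

/-- In state `σ`, the output is the given sequence: it is stored in cells `0, 1, 2, …` of
array `1`, and its length in variable `1`. -/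
def State.HasOutput (σ : State) (output : List ℤ) : Prop :=
  σ.var 1 = output.length ∧ ∀ i : Fin output.length, σ.arr 1 (i.val : ℤ) = output.get i

/-- On the given input, `P` halts after exactly `n` steps with the given output. -/
def Prog.Computes (P : Prog) (input : List ℤ) (n : ℕ) (output : List ℤ) : Prop :=
  ∃ σ : State, Exec P (initial input) n σ ∧ σ.HasOutput output

/-- The total length of a sequence of integers in binary (with one extra bit for each sign). -/
def bitLength (l : List ℤ) : ℕ :=
  (l.map fun x => Nat.size x.natAbs + 1).sum

end RAM

/-! ### The Fault-Tolerant Path problem -/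

/-- An instance of the Fault-Tolerant Path problem: a finite directed multigraph with vertices
`Fin numVerts` and arcs `Fin numArcs`, nonnegative rational arc weights, two nodes `s` and `t`,
a set `M` of vulnerable arcs, and the number `k` of arcs that may fail. -/
structure FTPInstance where
  numVerts : ℕ
  numArcs : ℕ
  tail : Fin numArcs → Fin numVerts
  head : Fin numArcs → Fin numVerts
  weight : Fin numArcs → ℚ≥0
  s : Fin numVerts
  t : Fin numVerts
  M : Finset (Fin numArcs)
  k : ℕ

namespace FTPInstance

/-- The list of arcs `p` is a directed walk from `u` to `v`. -/
def IsWalk (I : FTPInstance) : Fin I.numVerts → List (Fin I.numArcs) → Fin I.numVerts → Prop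
  | u, [], v => u = v
  | u, e :: p, v => I.tail e = u ∧ I.IsWalk (I.head e) p v

/-- The list of arcs `p` is a directed path from `u` to `v`: a walk that repeats no vertex. -/
def IsPath (I : FTPInstance) (u : Fin I.numVerts) (p : List (Fin I.numArcs))
    (v : Fin I.numVerts) : Prop :=
  I.IsWalk u p v ∧ (u :: p.map I.head).Nodup

/-- `S` is a solution: `S \ F` contains an `s`-`t` path for all `F ⊆ M` with `|F| ≤ k`. -/
def Feasible (I : FTPInstance) (S : Finset (Fin I.numArcs)) : Prop :=
  ∀ F : Finset (Fin I.numArcs), F ⊆ I.M → F.card ≤ I.k →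
    ∃ p : List (Fin I.numArcs), I.IsPath I.s p I.t ∧ ∀ e ∈ p, e ∈ S \ F

/-- The cost of a set of arcs. -/
def cost (I : FTPInstance) (S : Finset (Fin I.numArcs)) : ℚ≥0 :=
  ∑ e ∈ S, I.weight e

/-- `S` is a solution whose cost is at most `ρ` times the minimum cost of a solution. -/
def IsApproxSolution (I : FTPInstance) (ρ : ℚ≥0) (S : Finset (Fin I.numArcs)) : Prop :=
  I.Feasible S ∧ ∀ T : Finset (Fin I.numArcs), I.Feasible T → I.cost S ≤ ρ * I.cost T

/-- The instance as a sequence of integers: the numbers of vertices and of arcs, `s`, `t`, `k`,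
and then, for every arc, its tail, its head, the numerator and the denominator of its weight, and
`1` or `0` according to whether it is vulnerable or not. -/
def encode (I : FTPInstance) : List ℤ :=
  [(I.numVerts : ℤ), (I.numArcs : ℤ), (I.s.val : ℤ), (I.t.val : ℤ), (I.k : ℤ)] ++
    (List.finRange I.numArcs).flatMap fun e =>
      [((I.tail e).val : ℤ), ((I.head e).val : ℤ), ((I.weight e).num : ℤ),
        ((I.weight e).den : ℤ), if e ∈ I.M then 1 else 0]

/-- The size of the instance: the number of vertices plus the length in binary of the rest. -/
def size (I : FTPInstance) : ℕ :=
  I.numVerts + RAM.bitLength I.encode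

/-- An answer as a sequence of integers: `none` (there is no solution) is the sequence `0`, and a
set `S` of arcs is `1` followed by the incidence vector of `S`. -/
def encodeAnswer (I : FTPInstance) : Option (Finset (Fin I.numArcs)) → List ℤ
  | none => [0]
  | some S => 1 :: (List.finRange I.numArcs).map fun e => if e ∈ S then 1 else 0

end FTPInstance

/-! ### Robust connections in networks -/

set_option linter.unusedSectionVars false
set_option linter.unusedSimpArgs false

/-! Call a set robust between two vertices if each cut separating them contains a safe arc or more
than `k` arcs. By the usual cut argument, feasible sets are exactly the sets robust from `s` to `t`
(`robust_of_feasible`, `feasible_of_robust`). Robustness composes along intermediate vertices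
(`Robust.trans`), so a solution may be assembled from pieces.

Give vulnerable arcs capacity 1 and safe arcs capacity `k`. A cut of a robust set with capacity at
most `k` must be a single safe arc (`exists_cut_eq_singleton`). Such an arc splits the set into
disjoint robust parts before and after it. Repeating this turns a feasible `T` into a chain of safe
arcs and of "wide" pieces, in which every relevant cut has capacity at least `k + 1`
(`Chain.append_robust`). By weak duality a cheapest integral flow of value `k + 1` costs at most the
capacity-weighted cost of a wide piece (`Tight.cost_le`), hence at most `k` times its cost.
Conversely the support of any such flow is robust (`Tight.robust_support`), and it costs no more
than the flow. A safe arc is paid for once, which is also within the factor `k`.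

It therefore suffices to find a cheapest chain of hops, where a hop is a safe arc or the support of
a cheapest flow between two vertices. This is a Bellman–Ford computation with at most `2 * |A| + 1`
rounds (`rounds_spec`). The flows come from successive cheapest augmentation with node potentials
(`Search.grow`, `augment_spec`, `flow_spec`). A failed augmentation exhibits a cut of capacity at
most `k`, so no wide set joins that pair.

For the machine, `k` is truncated to the number of arcs plus one, which bounds the number of
augmentations. Weights become integers after scaling by the product of all denominators, computed by
doubling and adding. Except for one loop that measures the denominators, the program uses counting
loops whose bounds are never modified, so its running time is a polynomial in a bound on these loop
bounds (`exists_exec`, `exists_cost_eq`). -/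

/-- A network for a fixed number `k` of failures: a directed multigraph with vulnerable arcs and
integer arc costs. -/
structure Network (V A : Type*) where
  tail : A → V
  head : A → V
  vul : Finset A
  k : ℕ
  c : A → ℤ

namespace Network

variable {V A : Type*} [Fintype V] [DecidableEq V] [Fintype A] [DecidableEq A]
variable {N : Network V A}

/-- Vulnerable arcs have capacity one, safe arcs have capacity `k`. -/
def cap (N : Network V A) (e : A) : ℤ := if e ∈ N.vul then 1 else N.k

/-- The arcs of `T` that leave `X`. -/
def cut (N : Network V A) (T : Finset A) (X : Finset V) : Finset A :=
  T.filter fun e => N.tail e ∈ X ∧ N.head e ∉ X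

theorem mem_cut {T : Finset A} {X : Finset V} {e : A} :
    e ∈ N.cut T X ↔ e ∈ T ∧ N.tail e ∈ X ∧ N.head e ∉ X := by
  simp [cut]

theorem cut_mono {S T : Finset A} (h : S ⊆ T) (X : Finset V) : N.cut S X ⊆ N.cut T X :=
  Finset.filter_subset_filter _ h

/-- Every cut of `T` between `u` and `v` contains a safe arc or more than `k` arcs. -/
def Robust (N : Network V A) (T : Finset A) (u v : V) : Prop :=
  ∀ X : Finset V, u ∈ X → v ∉ X →
    (∃ e ∈ N.cut T X, e ∉ N.vul) ∨ N.k < (N.cut T X).card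

/-- Every cut of `T` between `u` and `v` has capacity more than `k`. -/
def Wide (N : Network V A) (T : Finset A) (u v : V) : Prop :=
  ∀ X : Finset V, u ∈ X → v ∉ X → (N.k : ℤ) + 1 ≤ ∑ e ∈ N.cut T X, N.cap e

theorem robust_self (T : Finset A) (u : V) : N.Robust T u u := fun _ h h' => absurd h h'

theorem Robust.mono {S T : Finset A} {u v : V} (h : N.Robust S u v) (hST : S ⊆ T) :
    N.Robust T u v := by
  intro X hu hv
  rcases h X hu hv with ⟨e, he, hs⟩ | h
  · exact Or.inl ⟨e, cut_mono hST X he, hs⟩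
  · exact Or.inr (h.trans_le (Finset.card_le_card (cut_mono hST X)))

theorem Robust.trans {T : Finset A} {u v x : V} (h₁ : N.Robust T u v) (h₂ : N.Robust T v x) :
    N.Robust T u x := by
  intro X hu hx
  by_cases hv : v ∈ X
  · exact h₂ X hv hx
  · exact h₁ X hu hv

theorem robust_of_safe {T : Finset A} {e : A} (he : e ∈ T) (hs : e ∉ N.vul) :
    N.Robust T (N.tail e) (N.head e) :=
  fun _ hu hv => Or.inl ⟨e, mem_cut.2 ⟨he, hu, hv⟩, hs⟩

/-! #### Decomposition of robust sets into hops -/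

/-- A hop from `u` to `v` of cost `C`: a safe arc, or a wide set with its arcs weighted by their
capacities. -/
def Hop (N : Network V A) (u v : V) (C : ℤ) : Prop :=
  (∃ T : Finset A, N.Wide T u v ∧ ∑ e ∈ T, N.c e * N.cap e ≤ C) ∨
    ∃ e, e ∉ N.vul ∧ N.tail e = u ∧ N.head e = v ∧ N.c e ≤ C

/-- `Chain s r v C`: at most `r` hops of total cost `C` lead from `s` to `v`. -/
inductive Chain (N : Network V A) (s : V) : ℕ → V → ℤ → Prop
  | nil : Chain N s 0 s 0
  | hop {r : ℕ} {u v : V} {C C' : ℤ} :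
      Chain N s r u C → N.Hop u v C' → Chain N s (r + 1) v (C + C')
  | stay {r : ℕ} {u : V} {C : ℤ} : Chain N s r u C → Chain N s (r + 1) u C

theorem Chain.mono {s v : V} {r r' : ℕ} {C : ℤ} (h : N.Chain s r v C) (hr : r ≤ r') :
    N.Chain s r' v C := by
  induction hr with
  | refl => exact h
  | step _ ih => exact ih.stay

theorem cap_pos (hk : 1 ≤ N.k) (e : A) : 1 ≤ N.cap e := by
  unfold cap; split_ifs <;> omega

theorem cap_le (hk : 1 ≤ N.k) (e : A) : N.cap e ≤ N.k := by
  unfold cap; split_ifs <;> omega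

/-- A cut of small capacity of a robust set consists of a single safe arc. -/
theorem exists_cut_eq_singleton (hk : 1 ≤ N.k) {T : Finset A} {u v : V} (hT : N.Robust T u v)
    {X : Finset V} (hu : u ∈ X) (hv : v ∉ X) (hX : ∑ e ∈ N.cut T X, N.cap e < (N.k : ℤ) + 1) :
    ∃ e, e ∉ N.vul ∧ N.cut T X = {e} := by
  have hcard : ∀ S : Finset A, (S.card : ℤ) ≤ ∑ e ∈ S, N.cap e := fun S => by
    simpa using Finset.card_nsmul_le_sum S N.cap 1 fun e _ => cap_pos hk e
  rcases hT X hu hv with ⟨e, he, hs⟩ | h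
  · refine ⟨e, hs, ?_⟩
    -- The safe arc alone uses capacity `k`, and every further arc would add at least one.
    have h1 := Finset.add_sum_erase _ N.cap he
    have h2 := hcard ((N.cut T X).erase e)
    have h3 : N.cap e = N.k := by simp [cap, hs]
    have h4 : ((N.cut T X).erase e).card = 0 := by omega
    rw [Finset.card_eq_zero, Finset.erase_eq_empty_iff] at h4
    rcases h4 with h4 | h4
    · simp [h4] at he
    · exact h4
  · have := hcard (N.cut T X)
    omega

/-- If `T` is wide, it is a single hop of cost at most `k` times its own cost, because capacities
are at most `k`. Otherwise a single safe arc forms a narrow cut, and induction applies to the parts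
on its two sides. The parts and the arc are disjoint, so the costs add up. The hop count works out
because `(2a + 1) + 1 + (2b + 1) ≤ 2|T| + 1` whenever `a + b + 1 ≤ |T|`. -/
theorem Chain.append_robust (hk : 1 ≤ N.k) (hc : ∀ e, 0 ≤ N.c e) {s : V} (m : ℕ) :
    ∀ {T : Finset A} {u v : V} {r : ℕ} {C : ℤ}, T.card ≤ m → N.Robust T u v →
      N.Chain s r u C → N.Chain s (r + (2 * T.card + 1)) v (C + N.k * ∑ e ∈ T, N.c e) := by
  induction m with
  | zero =>
    intro T u v r C hm hT hch
    refine (hch.hop (v := v) (C' := N.k * ∑ e ∈ T, N.c e) (Or.inl ⟨T, ?_, ?_⟩)).mono (by omega)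
    -- A narrow cut would supply an arc of `T`, which is empty here.
    · by_contra hW
      simp only [Wide, not_forall, not_le] at hW
      obtain ⟨X, hu, hv, hX⟩ := hW
      obtain ⟨e, -, he⟩ := exists_cut_eq_singleton hk hT hu hv hX
      have : e ∈ T := (mem_cut.1 (he ▸ Finset.mem_singleton_self e)).1
      have := Finset.card_pos.2 ⟨e, this⟩
      omega
    · rw [Finset.mul_sum]
      exact Finset.sum_le_sum fun e _ => by nlinarith [hc e, cap_le hk e]
  | succ m ih =>
    intro T u v r C hm hT hch
    by_cases hW : N.Wide T u v
    · refine (hch.hop (v := v) (C' := N.k * ∑ e ∈ T, N.c e) (Or.inl ⟨T, hW, ?_⟩)).mono (by omega)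
      rw [Finset.mul_sum]
      exact Finset.sum_le_sum fun e _ => by nlinarith [hc e, cap_le hk e]
    simp only [Wide, not_forall, not_le] at hW
    obtain ⟨X, hu, hv, hX⟩ := hW
    obtain ⟨a, ha, hcut⟩ := exists_cut_eq_singleton hk hT hu hv hX
    obtain ⟨haT, hat, hah⟩ := mem_cut.1 (hcut ▸ Finset.mem_singleton_self a)
    have huniq : ∀ e ∈ T, N.tail e ∈ X → N.head e ∉ X → e = a := fun e h1 h2 h3 =>
      Finset.mem_singleton.1 (hcut ▸ mem_cut.2 ⟨h1, h2, h3⟩)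
    -- `T₁` lies inside `X` and `T₂` outside it. The only arc leaving `X` is `a`, and arcs entering
    -- `X` are discarded.
    set T₁ := T.filter fun e => N.tail e ∈ X ∧ N.head e ∈ X with hT₁
    set T₂ := T.filter fun e => N.tail e ∉ X ∧ N.head e ∉ X with hT₂
    have hdisj : Disjoint T₁ T₂ := by
      rw [Finset.disjoint_left]
      intro e h1 h2
      exact (Finset.mem_filter.1 h2).2.1 (Finset.mem_filter.1 h1).2.1
    have ha1 : a ∉ T₁ ∪ T₂ := by
      simp [hT₁, hT₂, hat, hah]
    have hsub : insert a (T₁ ∪ T₂) ⊆ T := by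
      intro e he
      simp only [Finset.mem_insert, Finset.mem_union, hT₁, hT₂, Finset.mem_filter] at he
      rcases he with rfl | h | h
      · exact haT
      · exact h.1
      · exact h.1
    have hcard : T₁.card + T₂.card + 1 ≤ T.card := by
      have := Finset.card_le_card hsub
      rwa [Finset.card_insert_of_notMem ha1, Finset.card_union_of_disjoint hdisj] at this
    have hsum : ∑ e ∈ T₁, N.c e + ∑ e ∈ T₂, N.c e + N.c a ≤ ∑ e ∈ T, N.c e := by
      have := Finset.sum_le_sum_of_subset_of_nonneg hsub fun e _ _ => hc e
      rw [Finset.sum_insert ha1, Finset.sum_union hdisj] at this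
      linarith
    have key : ∀ {S : Finset A} {Y Z : Finset V}, N.cut T Y ⊆ N.cut S Z →
        ((∃ e ∈ N.cut T Y, e ∉ N.vul) ∨ N.k < (N.cut T Y).card) →
        ((∃ e ∈ N.cut S Z, e ∉ N.vul) ∨ N.k < (N.cut S Z).card) := by
      rintro S Y Z h (⟨e, he, hs⟩ | h')
      · exact Or.inl ⟨e, h he, hs⟩
      · exact Or.inr (h'.trans_le (Finset.card_le_card h))
    -- A cut `Z` of `T₁` is compared with the cut `Z ∩ X` of `T`: an arc leaving `Z ∩ X` and also
    -- `X` would be `a`, but the tail of `a` is not in `Z`.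
    have hR₁ : N.Robust T₁ u (N.tail a) := by
      intro Z huZ haZ
      refine key ?_ (hT (Z ∩ X) (by simp [huZ, hu]) (by simp [hv]))
      intro e he
      obtain ⟨h1, h2, h3⟩ := mem_cut.1 he
      simp only [Finset.mem_inter, not_and] at h2 h3
      have hhead : N.head e ∈ X := by
        by_contra h
        exact haZ (huniq e h1 h2.2 h ▸ h2.1)
      exact mem_cut.2 ⟨Finset.mem_filter.2 ⟨h1, h2.2, hhead⟩, h2.1, fun h => h3 h hhead⟩
    -- Dually, `Z` is compared with `X ∪ Z`, which already contains the head of `a`.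
    have hR₂ : N.Robust T₂ (N.head a) v := by
      intro Z haZ hvZ
      refine key ?_ (hT (X ∪ Z) (by simp [hu]) (by simp [hv, hvZ]))
      intro e he
      obtain ⟨h1, h2, h3⟩ := mem_cut.1 he
      simp only [Finset.mem_union, not_or] at h2 h3
      have htail : N.tail e ∉ X := fun h => h3.2 (huniq e h1 h h3.1 ▸ haZ)
      exact mem_cut.2 ⟨Finset.mem_filter.2 ⟨h1, htail, h3.1⟩, h2.resolve_left htail, h3.2⟩
    have h1 := ih (by omega) hR₁ hch
    -- The hop along `a` is charged everything in `k * c(T)` not charged to `T₁` and `T₂`, so that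
    -- the total is exact; this is at least `c a`.
    have h2 := ih (by omega) hR₂ (h1.hop (C' := N.k * (∑ e ∈ T, N.c e - ∑ e ∈ T₁, N.c e
      - ∑ e ∈ T₂, N.c e)) (Or.inr ⟨a, ha, rfl, rfl, ?_⟩))
    · have h3 := h2.mono (r' := r + (2 * T.card + 1)) (by omega)
      convert h3 using 1
      ring
    · have : (1 : ℤ) ≤ N.k := by exact_mod_cast hk
      nlinarith [hc a]

/-! #### Flows -/

/-- The net amount of `f` that leaves the vertex `x`. -/
def excess (N : Network V A) (f : A → ℤ) (x : V) : ℤ :=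
  ∑ e, ((if N.tail e = x then f e else 0) - if N.head e = x then f e else 0)

/-- Summation by parts: it moves the potential from vertices to potential differences along arcs. -/
theorem sum_mul_excess (f : A → ℤ) (p : V → ℤ) :
    ∑ x, p x * N.excess f x = ∑ e, f e * (p (N.tail e) - p (N.head e)) := by
  simp only [excess, Finset.mul_sum]
  rw [Finset.sum_comm]
  refine Finset.sum_congr rfl fun e _ => ?_
  simp only [mul_sub, Finset.sum_sub_distrib, mul_ite, mul_zero, Finset.sum_ite_eq,
    Finset.mem_univ, if_true]
  ring

/-- `f` obeys the capacities and is complementary to the potential `p`. -/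
structure Tight (N : Network V A) (f : A → ℤ) (p : V → ℤ) : Prop where
  nonneg : ∀ e, 0 ≤ f e
  le_cap : ∀ e, f e ≤ N.cap e
  forward : ∀ e, f e < N.cap e → p (N.head e) ≤ p (N.tail e) + N.c e
  backward : ∀ e, 0 < f e → p (N.tail e) + N.c e ≤ p (N.head e)

/-- A vertex as a unit vector. -/
def unit (u x : V) : ℤ := if x = u then 1 else 0

theorem sum_mul_unit (p : V → ℤ) (u : V) : ∑ x, p x * unit u x = p u := by
  simp [unit]

/-- The sum of `K` over all thresholds between two potentials is at most the total potential
difference of the arcs of a set all of whose cuts have capacity at least `K`. -/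
theorem potential_diff_le {T : Finset A} {u v : V} {K : ℤ} (hcap : ∀ e, 0 ≤ N.cap e)
    (hT : ∀ X : Finset V, u ∈ X → v ∉ X → K ≤ ∑ e ∈ N.cut T X, N.cap e) (p : V → ℤ)
    (hK : 0 ≤ K) :
    K * (p v - p u) ≤ ∑ e ∈ T, N.cap e * max 0 (p (N.head e) - p (N.tail e)) := by
  by_cases huv : p u ≤ p v
  swap
  · exact (by nlinarith : K * (p v - p u) ≤ 0).trans
      (Finset.sum_nonneg fun e _ => mul_nonneg (hcap e) (le_max_left _ _))
  -- For each integer threshold `θ` from `p u` up to but excluding `p v`, the sublevel set of `p` at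
  -- `θ` separates `u` from `v`. Summing over `θ` counts an arc only for thresholds between the
  -- potentials of its ends.
  have h1 : ∀ θ ∈ Finset.Ico (p u) (p v),
      K ≤ ∑ e ∈ T, if p (N.tail e) ≤ θ ∧ θ < p (N.head e) then N.cap e else 0 := by
    intro θ hθ
    rw [Finset.mem_Ico] at hθ
    have := hT (Finset.univ.filter fun x => p x ≤ θ) (by simp [hθ.1]) (by simp [hθ.2])
    simpa [cut, Finset.sum_filter] using this
  have h2 := Finset.card_nsmul_le_sum _ _ _ h1
  rw [Int.card_Ico, Finset.sum_comm, nsmul_eq_mul, Int.toNat_of_nonneg (by omega), mul_comm] at h2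
  refine h2.trans (Finset.sum_le_sum fun e _ => ?_)
  rw [← Finset.sum_filter, Finset.sum_const, nsmul_eq_mul, mul_comm]
  refine mul_le_mul_of_nonneg_left ?_ (hcap e)
  have : (Finset.Ico (p u) (p v)).filter (fun θ => p (N.tail e) ≤ θ ∧ θ < p (N.head e)) ⊆
      Finset.Ico (p (N.tail e)) (p (N.head e)) := fun θ hθ => by
    simpa using (Finset.mem_filter.1 hθ).2
  have := Finset.card_le_card this
  rw [Int.card_Ico] at this
  omega

/-- Weak duality: a flow of value `K` complementary to a potential costs at most as much as any
set of arcs, weighted by their capacities, all of whose cuts have capacity at least `K`. -/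
theorem Tight.cost_le {f : A → ℤ} {p : V → ℤ} (h : N.Tight f p) (hc : ∀ e, 0 ≤ N.c e)
    {u v : V} {K : ℤ} (hK : 0 ≤ K) (hf : ∀ x, N.excess f x = K * (unit u x - unit v x))
    {T : Finset A} (hT : ∀ X : Finset V, u ∈ X → v ∉ X → K ≤ ∑ e ∈ N.cut T X, N.cap e) :
    ∑ e, N.c e * f e ≤ ∑ e ∈ T, N.c e * N.cap e := by
  have hcap : ∀ e, 0 ≤ N.cap e := fun e => (h.nonneg e).trans (h.le_cap e)
  have h1 := potential_diff_le hcap hT p hK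
  have h2 := sum_mul_excess (N := N) f p
  have h3 : ∑ x, p x * N.excess f x = K * (p u - p v) := by
    rw [← sum_mul_unit p u, ← sum_mul_unit p v, ← Finset.sum_sub_distrib, Finset.mul_sum]
    exact Finset.sum_congr rfl fun x _ => by rw [hf]; ring
  -- Complementary slackness: the reduced cost is paid only when it is negative, and then the arc is
  -- saturated. When the reduced cost is nonnegative the left side vanishes and the right side is
  -- nonnegative, as the potential difference is at most `c e` and `c e ≥ 0`.
  have h4 : ∀ e, N.c e * f e + f e * (p (N.tail e) - p (N.head e)) ≤
      if e ∈ T then N.c e * N.cap e - N.cap e * max 0 (p (N.head e) - p (N.tail e)) else 0 := by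
    intro e
    have e1 := h.nonneg e
    have e2 := h.le_cap e
    have e3 := h.forward e
    have e4 := h.backward e
    have e5 := hc e
    have e6 := hcap e
    have e7 : 0 < p (N.tail e) + N.c e - p (N.head e) → f e = 0 := fun _ => by
      by_contra hne
      have := e4 (by omega)
      omega
    have e8 : p (N.tail e) + N.c e - p (N.head e) < 0 → f e = N.cap e := fun _ => by
      by_contra hne
      have := e3 (by omega)
      omega
    have e9 : N.c e * f e + f e * (p (N.tail e) - p (N.head e)) =
        f e * (p (N.tail e) + N.c e - p (N.head e)) := by ring
    have e10 : max 0 (p (N.head e) - p (N.tail e)) ≤ N.c e ∨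
        p (N.tail e) + N.c e - p (N.head e) < 0 := by
      rw [max_le_iff]; omega
    rw [e9]
    rcases lt_trichotomy (p (N.tail e) + N.c e - p (N.head e)) 0 with hr | hr | hr
    · rw [e8 hr]
      split_ifs
      · rw [max_eq_right (by omega)]
        exact le_of_eq (by ring)
      · exact mul_nonpos_of_nonneg_of_nonpos e6 hr.le
    all_goals
      first | rw [hr, mul_zero] | rw [e7 hr, zero_mul]
      split_ifs
      · have := e10.resolve_right (by omega)
        nlinarith
      · exact le_rfl
  have h5 := Finset.sum_le_sum fun e (_ : e ∈ Finset.univ) => h4 e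
  rw [Finset.sum_add_distrib, ← h2, h3, Finset.sum_ite_mem, Finset.univ_inter,
    Finset.sum_sub_distrib] at h5
  linarith [mul_sub K (p v) (p u), mul_sub K (p u) (p v)]

/-- The excess of a flow sums to its net amount over the boundary of a set. -/
theorem sum_excess (f : A → ℤ) (X : Finset V) :
    ∑ x ∈ X, N.excess f x =
      ∑ e ∈ N.cut Finset.univ X, f e - ∑ e ∈ N.cut Finset.univ Xᶜ, f e := by
  have h := sum_mul_excess (N := N) f fun x => if x ∈ X then 1 else 0
  simp only [ite_mul, one_mul, zero_mul, Finset.sum_ite_mem, Finset.univ_inter] at h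
  rw [h, cut, cut, Finset.sum_filter, Finset.sum_filter, ← Finset.sum_sub_distrib]
  refine Finset.sum_congr rfl fun e _ => ?_
  by_cases h1 : N.tail e ∈ X <;> by_cases h2 : N.head e ∈ X <;> simp [h1, h2]

theorem sum_unit (u : V) (X : Finset V) : ∑ x ∈ X, unit u x = if u ∈ X then 1 else 0 := by
  simp [unit]

/-- The support of a flow of value `k + 1` is robust. -/
theorem Tight.robust_support {f : A → ℤ} {p : V → ℤ} (h : N.Tight f p) {u v : V}
    (hf : ∀ x, N.excess f x = (N.k + 1) * (unit u x - unit v x)) :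
    N.Robust (Finset.univ.filter fun e => 0 < f e) u v := by
  intro X hu hv
  by_contra hcon
  simp only [not_or, not_exists, not_and, not_not, not_lt] at hcon
  obtain ⟨h1, h2⟩ := hcon
  have h3 := sum_excess (N := N) f X
  simp only [hf, ← Finset.mul_sum, Finset.sum_sub_distrib, sum_unit, hu, hv, if_true,
    if_false] at h3
  have h4 : 0 ≤ ∑ e ∈ N.cut Finset.univ Xᶜ, f e := Finset.sum_nonneg fun e _ => h.nonneg e
  have h5 : ∑ e ∈ N.cut Finset.univ X, f e =
      ∑ e ∈ N.cut (Finset.univ.filter fun e => 0 < f e) X, f e := by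
    symm
    refine Finset.sum_subset (cut_mono (Finset.subset_univ _) X) fun e he he' => ?_
    have := h.nonneg e
    by_contra hne
    refine he' (mem_cut.2 ⟨by simp; omega, (mem_cut.1 he).2⟩)
  -- All arcs of this cut are vulnerable, hence carry at most one unit, so at most `k` units leave
  -- `X`, while `k + 1` are required.
  have h6 : ∑ e ∈ N.cut (Finset.univ.filter fun e => 0 < f e) X, f e ≤
      ∑ e ∈ N.cut (Finset.univ.filter fun e => 0 < f e) X, 1 := by
    refine Finset.sum_le_sum fun e he => (h.le_cap e).trans ?_
    simp [cap, h1 e he]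
  simp only [Finset.sum_const, nsmul_eq_mul, mul_one] at h6
  have : ((N.cut (Finset.univ.filter fun e => 0 < f e) X).card : ℤ) ≤ N.k := by exact_mod_cast h2
  linarith

/-! #### Growing a search tree of tight residual arcs -/

/-- Towards a flow of value `a + 1` from `u` to `t`: the vertices of `R` have been reached from
`u`, and for every `v ∈ R` there is a flow `g v` that arises from the flow `g u` of value `a` by
sending one unit from `u` to `v` within `R`. All these flows are complementary to the
potential `p`. -/
structure Search (N : Network V A) (u t : V) (a : ℤ) (R : Finset V) (g : V → A → ℤ)
    (p : V → ℤ) : Prop where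
  root : u ∈ R
  tight : ∀ v ∈ R, N.Tight (g v) p
  excess_eq : ∀ v ∈ R, ∀ x, N.excess (g v) x = a * (unit u x - unit t x) + (unit u x - unit v x)
  agree : ∀ v ∈ R, ∀ e, ¬ (N.tail e ∈ R ∧ N.head e ∈ R) → g v e = g u e

/-- In the residual network of `f`, the arc `e` leads from `x` to `y`, forward if `d = 1` and
backward if `d = -1`. -/
def Residual (N : Network V A) (f : A → ℤ) (e : A) (d : ℤ) (x y : V) : Prop :=
  (d = 1 ∧ N.tail e = x ∧ N.head e = y ∧ f e < N.cap e) ∨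
    (d = -1 ∧ N.head e = x ∧ N.tail e = y ∧ 0 < f e)

/-- The reduced cost of `e` in direction `d`. -/
def slack (N : Network V A) (p : V → ℤ) (e : A) (d : ℤ) : ℤ :=
  d * (p (N.tail e) + N.c e - p (N.head e))

theorem Search.start {u t : V} {a : ℤ} {f : A → ℤ} {p : V → ℤ} {g : V → A → ℤ} (hg : g u = f)
    (h : N.Tight f p) (hf : ∀ x, N.excess f x = a * (unit u x - unit t x)) :
    N.Search u t a {u} g p where
  root := Finset.mem_singleton_self u
  tight v hv := by rwa [Finset.mem_singleton.1 hv, hg]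
  excess_eq v hv x := by rw [Finset.mem_singleton.1 hv, hg, hf]; ring
  agree v hv e _ := by rw [Finset.mem_singleton.1 hv]

theorem excess_update (f : A → ℤ) (e : A) (d : ℤ) (x : V) :
    N.excess (Function.update f e (f e + d)) x =
      N.excess f x + d * (unit (N.tail e) x - unit (N.head e) x) := by
  have : Function.update f e (f e + d) = fun e' => f e' + if e' = e then d else 0 := by
    ext e'
    by_cases h : e' = e
    · subst h; simp
    · simp [h]
  rw [this, excess, excess, ← sub_eq_iff_eq_add', ← Finset.sum_sub_distrib,
    Finset.sum_eq_single e]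
  · simp only [unit, if_true, @eq_comm _ x]
    split_ifs <;> ring
  · intro e' _ h
    simp [h]
  · simp

/-- A Dijkstra step of the primal-dual method. Raising all potentials outside `R` by the least slack
of a residual arc leaving `R` keeps complementarity and makes that arc tight. One more unit can then
be sent along it, extending the flow of `x` to a flow of `y`. -/
theorem Search.grow {u t : V} {a : ℤ} {R : Finset V} {g : V → A → ℤ} {p : V → ℤ}
    (h : N.Search u t a R g p) {e : A} {d : ℤ} {x y : V} (hx : x ∈ R) (hy : y ∉ R)
    (hres : N.Residual (g u) e d x y)
    (hmin : ∀ e' d' x' y', x' ∈ R → y' ∉ R → N.Residual (g u) e' d' x' y' →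
      N.slack p e d ≤ N.slack p e' d') :
    N.Search u t a (insert y R)
      (Function.update g y (Function.update (g x) e (g x e + d)))
      (fun z => if z ∈ R then p z else p z + N.slack p e d) := by
  have hslack : 0 ≤ N.slack p e d := by
    have ht := h.tight u h.root
    rcases hres with ⟨rfl, -, -, h1⟩ | ⟨rfl, -, -, h1⟩
    · have := ht.forward e h1
      simp only [slack]; omega
    · have := ht.backward e h1
      simp only [slack]; omega
  have htight : ∀ v ∈ R, N.Tight (g v) fun z => if z ∈ R then p z else p z + N.slack p e d := by
    intro v hv
    have ht := h.tight v hv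
    refine ⟨ht.nonneg, ht.le_cap, fun e' he' => ?_, fun e' he' => ?_⟩
    · have h1 := ht.forward e' he'
      by_cases h2 : N.tail e' ∈ R <;> by_cases h3 : N.head e' ∈ R
      · simpa [h2, h3] using h1
      -- Minimality is known for residual arcs of `g u` only; it transfers to `g v` because the two
      -- flows agree on arcs not inside `R`.
      · rw [h.agree v hv e' (by tauto)] at he'
        have := hmin e' 1 _ _ h2 h3 (Or.inl ⟨rfl, rfl, rfl, he'⟩)
        conv at this => rhs; rw [slack]
        simp only [h2, h3, if_true, if_false]
        omega
      · simp only [h2, h3, if_true, if_false]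
        omega
      · simp only [h2, h3, if_false]
        omega
    · have h1 := ht.backward e' he'
      by_cases h2 : N.tail e' ∈ R <;> by_cases h3 : N.head e' ∈ R
      · simpa [h2, h3] using h1
      · simp only [h2, h3, if_true, if_false]
        omega
      · rw [h.agree v hv e' (by tauto)] at he'
        have := hmin e' (-1) _ _ h3 h2 (Or.inr ⟨rfl, rfl, rfl, he'⟩)
        conv at this => rhs; rw [slack]
        simp only [h2, h3, if_true, if_false]
        omega
      · simp only [h2, h3, if_false]
        omega
  have hends : ¬ (N.tail e ∈ R ∧ N.head e ∈ R) ∧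
      (N.tail e ∈ insert y R ∧ N.head e ∈ insert y R) := by
    rcases hres with ⟨-, rfl, rfl, -⟩ | ⟨-, rfl, rfl, -⟩ <;> simp [hx, hy]
  have hge : g x e = g u e := h.agree x hx e hends.1
  have hu : u ≠ y := fun hh => hy (hh ▸ h.root)
  refine ⟨Finset.mem_insert_of_mem h.root, fun v hv => ?_, fun v hv z => ?_, fun v hv e' he' => ?_⟩
  · by_cases hvy : v = y
    · subst hvy
      have ht := htight x hx
      rw [Function.update_self]
      have hb : 0 ≤ g x e + d ∧ g x e + d ≤ N.cap e := by
        have h1 := ht.nonneg e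
        have h2 := ht.le_cap e
        rcases hres with ⟨rfl, -, -, h3⟩ | ⟨rfl, -, -, h3⟩ <;> rw [← hge] at h3 <;> omega
      refine ⟨fun e' => ?_, fun e' => ?_, fun e' he' => ?_, fun e' he' => ?_⟩
      · by_cases hee : e' = e
        · subst hee; simpa using hb.1
        · simpa [hee] using ht.nonneg e'
      · by_cases hee : e' = e
        · subst hee; simpa using hb.2
        · simpa [hee] using ht.le_cap e'
      · by_cases hee : e' = e
        · subst hee
          rcases hres with ⟨rfl, rfl, rfl, -⟩ | ⟨rfl, rfl, rfl, -⟩ <;>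
            simp only [hx, hy, if_true, if_false, slack] <;> omega
        · exact ht.forward e' (by simpa [hee] using he')
      · by_cases hee : e' = e
        · subst hee
          rcases hres with ⟨rfl, rfl, rfl, -⟩ | ⟨rfl, rfl, rfl, -⟩ <;>
            simp only [hx, hy, if_true, if_false, slack] <;> omega
        · exact ht.backward e' (by simpa [hee] using he')
    · rw [Function.update_of_ne hvy]
      exact htight v (Finset.mem_of_mem_insert_of_ne hv hvy)
  · by_cases hvy : v = y
    · subst hvy
      rw [Function.update_self, excess_update, h.excess_eq x hx]
      rcases hres with ⟨rfl, rfl, rfl, -⟩ | ⟨rfl, rfl, rfl, -⟩ <;> ring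
    · rw [Function.update_of_ne hvy]
      exact h.excess_eq v (Finset.mem_of_mem_insert_of_ne hv hvy) z
  · have he'' : ¬ (N.tail e' ∈ R ∧ N.head e' ∈ R) := fun hh =>
      he' ⟨Finset.mem_insert_of_mem hh.1, Finset.mem_insert_of_mem hh.2⟩
    rw [Function.update_of_ne hu]
    by_cases hvy : v = y
    · subst hvy
      have hee : e' ≠ e := fun hh => he' (hh ▸ hends.2)
      rw [Function.update_self, Function.update_of_ne hee, h.agree x hx e' he'']
    · rw [Function.update_of_ne hvy]
      exact h.agree v (Finset.mem_of_mem_insert_of_ne hv hvy) e' he''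

/-- No residual arc leaves `R`. -/
def Closed (N : Network V A) (f : A → ℤ) (R : Finset V) : Prop :=
  ∀ e d x y, x ∈ R → y ∉ R → ¬ N.Residual f e d x y

/-- If the search gets stuck before it reaches `t`, the current value is that of a cut. -/
theorem Search.cut_eq {u t : V} {a : ℤ} {R : Finset V} {g : V → A → ℤ} {p : V → ℤ}
    (h : N.Search u t a R g p) (hR : N.Closed (g u) R) (ht : t ∉ R) :
    ∑ e ∈ N.cut Finset.univ R, N.cap e = a := by
  have h1 := sum_excess (N := N) (g u) R
  have h2 := h.tight u h.root
  have h3 : ∀ x, N.excess (g u) x = a * (unit u x - unit t x) := fun x => by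
    rw [h.excess_eq u h.root]; ring
  simp only [h3, ← Finset.mul_sum, Finset.sum_sub_distrib, sum_unit, h.root, ht, if_true,
    if_false] at h1
  -- With no residual arc leaving `R`, arcs entering `R` are empty and arcs leaving it are
  -- saturated.
  have h4 : ∑ e ∈ N.cut Finset.univ Rᶜ, g u e = 0 := Finset.sum_eq_zero fun e he => by
    have h5 := (mem_cut.1 he).2
    simp only [Finset.mem_compl, not_not] at h5
    have h6 := hR e (-1) _ _ h5.2 h5.1
    have h7 := h2.nonneg e
    by_contra hne
    exact h6 (Or.inr ⟨rfl, rfl, rfl, by omega⟩)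
  have h5 : ∑ e ∈ N.cut Finset.univ R, N.cap e = ∑ e ∈ N.cut Finset.univ R, g u e :=
    Finset.sum_congr rfl fun e he => by
      have h5 := (mem_cut.1 he).2
      have h6 := hR e 1 _ _ h5.1 h5.2
      have h7 := h2.le_cap e
      by_contra hne
      exact h6 (Or.inl ⟨rfl, rfl, rfl, by omega⟩)
  rw [h5]
  linarith

end Network

/-! ### Programs with counting loops -/

namespace RAM

/-- Programs whose only loops are `rep x N P`: `for x = 0, …, N - 1 do P`. -/
inductive LProg where
  | skip
  | assign (x : ℕ) (e : Expr)
  | store (a : ℕ) (i e : Expr)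
  | seq (P Q : LProg)
  | ite (e f : Expr) (P Q : LProg)
  | rep (x N : ℕ) (P : LProg)

namespace LProg

/-- The compiled loop rereads its bound at every test, whereas `run` fixes the number of iterations
at the start. The two agree for programs satisfying `ok`. -/
def compile : LProg → Prog
  | skip => .skip
  | assign x e => .assign x e
  | store a i e => .store a i e
  | seq P Q => .seq P.compile Q.compile
  | ite e f P Q => .ite e f P.compile Q.compile
  | rep x N P => .seq (.assign x (.const 0))
      (.loop (.var x) (.var N) (.seq P.compile (.assign x (.add (.var x) (.const 1)))))

/-- The final state. -/
def run : LProg → State → State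
  | skip, σ => σ
  | assign x e, σ => σ.setVar x (e.eval σ)
  | store a i e, σ => σ.setArr a (i.eval σ) (e.eval σ)
  | seq P Q, σ => Q.run (P.run σ)
  | ite e f P Q, σ => if e.eval σ ≤ f.eval σ then P.run σ else Q.run σ
  | rep x N P, σ =>
      (fun τ => (P.run τ).setVar x ((P.run τ).var x + 1))^[(σ.var N).toNat] (σ.setVar x 0)

@[simp] theorem run_skip (σ : State) : skip.run σ = σ := rfl
@[simp] theorem run_assign (x : ℕ) (e : Expr) (σ : State) :
    (assign x e).run σ = σ.setVar x (e.eval σ) := rfl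
@[simp] theorem run_store (a : ℕ) (i e : Expr) (σ : State) :
    (store a i e).run σ = σ.setArr a (i.eval σ) (e.eval σ) := rfl
@[simp] theorem run_seq (P Q : LProg) (σ : State) : (seq P Q).run σ = Q.run (P.run σ) := rfl
@[simp] theorem run_ite (e f : Expr) (P Q : LProg) (σ : State) :
    (ite e f P Q).run σ = if e.eval σ ≤ f.eval σ then P.run σ else Q.run σ := rfl

/-- A bound for the number of steps if all loop bounds are at most `B`. -/
def cost (B : ℕ) : LProg → ℕ
  | skip => 1
  | assign _ e => e.time + 1
  | store _ i e => i.time + e.time + 1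
  | seq P Q => P.cost B + Q.cost B
  | ite e f P Q => e.time + f.time + 1 + (P.cost B + Q.cost B)
  | rep _ _ P => 2 + (3 + B * (P.cost B + 7))

/-- The loop bounds are among the variables `ps` and enclosing counters, and neither these variables
nor the enclosing counters are modified. -/
def ok : List ℕ → LProg → Bool
  | _, skip => true
  | ps, assign x _ => x ∉ ps
  | _, store _ _ _ => true
  | ps, seq P Q => P.ok ps && Q.ok ps
  | ps, ite _ _ P Q => P.ok ps && Q.ok ps
  | ps, rep x N P => x ∉ ps && N ∈ ps && P.ok (x :: ps)

def writesVar (y : ℕ) : LProg → Bool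
  | skip => false
  | assign x _ => x == y
  | store _ _ _ => false
  | seq P Q => P.writesVar y || Q.writesVar y
  | ite _ _ P Q => P.writesVar y || Q.writesVar y
  | rep x _ P => x == y || P.writesVar y

def writesArr (b : ℕ) : LProg → Bool
  | skip => false
  | assign _ _ => false
  | store a _ _ => a == b
  | seq P Q => P.writesArr b || Q.writesArr b
  | ite _ _ P Q => P.writesArr b || Q.writesArr b
  | rep _ _ P => P.writesArr b

/-! ### Frame properties and running time of counting programs -/

theorem run_var (y : ℕ) (P : LProg) (h : P.writesVar y = false) (σ : State) :
    (P.run σ).var y = σ.var y := by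
  induction P generalizing σ with
  | skip => rfl
  | assign x e =>
    simp only [writesVar, beq_eq_false_iff_ne] at h
    simp [run, State.setVar, Function.update_of_ne h.symm]
  | store a i e => rfl
  | seq P Q ihP ihQ =>
    simp only [writesVar, Bool.or_eq_false_iff] at h
    rw [run, ihQ h.2, ihP h.1]
  | ite e f P Q ihP ihQ =>
    simp only [writesVar, Bool.or_eq_false_iff] at h
    rw [run]
    split_ifs
    · exact ihP h.1 σ
    · exact ihQ h.2 σ
  | rep x N P ih =>
    simp only [writesVar, Bool.or_eq_false_iff, beq_eq_false_iff_ne] at h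
    rw [run]
    generalize (σ.var N).toNat = j
    have h1 : ∀ (τ : State) (z : ℤ), (τ.setVar x z).var y = τ.var y := fun τ z => by
      simp [State.setVar, Function.update_of_ne (Ne.symm h.1)]
    rw [← h1 σ 0]
    generalize σ.setVar x 0 = τ
    induction j generalizing τ with
    | zero => rfl
    | succ j ihj => rw [Function.iterate_succ_apply, ihj, h1, ih h.2]

theorem run_arr (b : ℕ) (P : LProg) (h : P.writesArr b = false) (σ : State) :
    (P.run σ).arr b = σ.arr b := by
  induction P generalizing σ with
  | skip => rfl
  | assign x e => rfl
  | store a i e =>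
    simp only [writesArr, beq_eq_false_iff_ne] at h
    simp [run, State.setArr, Function.update_of_ne h.symm]
  | seq P Q ihP ihQ =>
    simp only [writesArr, Bool.or_eq_false_iff] at h
    rw [run, ihQ h.2, ihP h.1]
  | ite e f P Q ihP ihQ =>
    simp only [writesArr, Bool.or_eq_false_iff] at h
    rw [run]
    split_ifs
    · exact ihP h.1 σ
    · exact ihQ h.2 σ
  | rep x N P ih =>
    simp only [writesArr] at h
    rw [run]
    generalize (σ.var N).toNat = j
    have h1 : ∀ (τ : State) (z : ℤ), (τ.setVar x z).arr b = τ.arr b := fun τ z => rfl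
    rw [← h1 σ 0]
    generalize σ.setVar x 0 = τ
    induction j generalizing τ with
    | zero => rfl
    | succ j ihj => rw [Function.iterate_succ_apply, ihj, h1, ih h]

theorem writesVar_of_ok {ps : List ℕ} {P : LProg} (h : P.ok ps) {y : ℕ} (hy : y ∈ ps) :
    P.writesVar y = false := by
  induction P generalizing ps with
  | skip => rfl
  | assign x e =>
    simp only [ok, decide_eq_true_eq] at h
    simp only [writesVar, beq_eq_false_iff_ne]
    exact fun hh => h (hh ▸ hy)
  | store a i e => rfl
  | seq P Q ihP ihQ =>
    simp only [ok, Bool.and_eq_true] at h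
    simp [writesVar, ihP h.1 hy, ihQ h.2 hy]
  | ite e f P Q ihP ihQ =>
    simp only [ok, Bool.and_eq_true] at h
    simp [writesVar, ihP h.1 hy, ihQ h.2 hy]
  | rep x N P ih =>
    simp only [ok, Bool.and_eq_true, decide_eq_true_eq] at h
    simp only [writesVar, Bool.or_eq_false_iff, beq_eq_false_iff_ne]
    exact ⟨fun hh => h.1.1 (hh ▸ hy), ih h.2 (List.mem_cons_of_mem _ hy)⟩

/-- Counting programs halt in their final state within the time bound. -/
theorem exists_exec {P : LProg} {ps : List ℕ} (h : P.ok ps) {B : ℕ} {σ : State}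
    (hB : ∀ y ∈ ps, σ.var y ≤ B) : ∃ n ≤ P.cost B, Exec P.compile σ n (P.run σ) := by
  induction P generalizing ps σ with
  | skip => exact ⟨1, le_rfl, .skip σ⟩
  | assign x e => exact ⟨_, le_rfl, .assign x e σ⟩
  | store a i e => exact ⟨_, le_rfl, .store a i e σ⟩
  | seq P Q ihP ihQ =>
    simp only [ok, Bool.and_eq_true] at h
    obtain ⟨n, hn, h1⟩ := ihP h.1 hB
    obtain ⟨n', hn', h2⟩ := ihQ (σ := P.run σ) h.2 fun y hy => by
      rw [run_var y P (writesVar_of_ok h.1 hy)]; exact hB y hy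
    exact ⟨n + n', Nat.add_le_add hn hn', h1.seq h2⟩
  | ite e f P Q ihP ihQ =>
    simp only [ok, Bool.and_eq_true] at h
    rw [run, cost]
    split_ifs with hef
    · obtain ⟨n, hn, h1⟩ := ihP h.1 hB
      exact ⟨_, by omega, .ite_true hef h1⟩
    · obtain ⟨n, hn, h1⟩ := ihQ h.2 hB
      exact ⟨_, by omega, .ite_false hef h1⟩
  | rep x N P ih =>
    simp only [ok, Bool.and_eq_true, decide_eq_true_eq] at h
    obtain ⟨⟨hx, hN⟩, hP⟩ := h
    have hw : ∀ y, y = x ∨ y ∈ ps → P.writesVar y = false := fun y hy =>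
      writesVar_of_ok hP (List.mem_cons.2 hy)
    -- Induction on the number of remaining iterations. Each one costs the body plus 7: the test
    -- takes 3 steps and the increment 4. The final failing test takes 3.
    have key : ∀ (j : ℕ) (τ : State), (∀ y ∈ ps, τ.var y ≤ B) → 0 ≤ τ.var x →
        (τ.var N - τ.var x).toNat = j →
        ∃ n ≤ 3 + j * (P.cost B + 7), Exec
          (.loop (.var x) (.var N) (.seq P.compile (.assign x (.add (.var x) (.const 1))))) τ n
          ((fun τ => (P.run τ).setVar x ((P.run τ).var x + 1))^[j] τ) := by
      intro j
      induction j with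
      | zero =>
        intro τ _ _ hj
        refine ⟨_, ?_, .loop_false ?_⟩
        · simp [Expr.time]
        · simp only [Expr.eval]; omega
      | succ j ihj =>
        intro τ hτ hτx hj
        have hlt : τ.var x < τ.var N := by omega
        obtain ⟨n, hn, h1⟩ := ih (σ := τ) hP fun y hy => by
          rcases List.mem_cons.1 hy with rfl | hy
          · exact hlt.le.trans (hτ N hN)
          · exact hτ y hy
        set υ := (P.run τ).setVar x ((P.run τ).var x + 1) with hυ
        have hυx : υ.var x = τ.var x + 1 := by
          simp [hυ, State.setVar, run_var x P (hw x (Or.inl rfl))]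
        have hυy : ∀ y ∈ ps, υ.var y = τ.var y := fun y hy => by
          have : y ≠ x := fun hh => hx (hh ▸ hy)
          simp [hυ, State.setVar, Function.update_of_ne this, run_var y P (hw y (Or.inr hy))]
        obtain ⟨n', hn', h2⟩ := ihj υ (fun y hy => by rw [hυy y hy]; exact hτ y hy)
          (by omega) (by rw [hυy N hN, hυx]; omega)
        refine ⟨_, ?_, .loop_true (by exact hlt) (h1.seq (.assign x _ _)) h2⟩
        simp only [Expr.time]
        linarith [Nat.add_mul j 1 (P.cost B + 7)]
    have hσ : ∀ y ∈ ps, (σ.setVar x 0).var y = σ.var y := fun y hy => by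
      have : y ≠ x := fun hh => hx (hh ▸ hy)
      simp [State.setVar, Function.update_of_ne this]
    have hσx : (σ.setVar x 0).var x = 0 := by simp [State.setVar]
    obtain ⟨n, hn, h1⟩ := key _ (σ.setVar x 0) (fun y hy => by rw [hσ y hy]; exact hB y hy)
      hσx.ge rfl
    have hb := hB N hN
    rw [hσ N hN, hσx, sub_zero] at hn h1
    refine ⟨_, ?_, Exec.seq (.assign x _ σ) h1⟩
    simp only [Expr.time, cost]
    have : (σ.var N).toNat ≤ B := by omega
    have := Nat.mul_le_mul_right (P.cost B + 7) this
    omega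

/-- The time bound is polynomial. -/
theorem exists_cost_eq (P : LProg) : ∃ p : Polynomial ℕ, ∀ B, P.cost B = p.eval B := by
  induction P with
  | skip => exact ⟨1, fun B => by simp [cost]⟩
  | assign x e => exact ⟨.C (e.time + 1), fun B => by simp [cost]⟩
  | store a i e => exact ⟨.C (i.time + e.time + 1), fun B => by simp [cost]⟩
  | seq P Q ihP ihQ =>
    obtain ⟨p, hp⟩ := ihP
    obtain ⟨q, hq⟩ := ihQ
    exact ⟨p + q, fun B => by simp [cost, hp, hq]⟩
  | ite e f P Q ihP ihQ =>
    obtain ⟨p, hp⟩ := ihP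
    obtain ⟨q, hq⟩ := ihQ
    exact ⟨.C (e.time + f.time + 1) + (p + q), fun B => by
      simp only [cost, hp, hq, Polynomial.eval_add, Polynomial.eval_C]⟩
  | rep x N P ih =>
    obtain ⟨p, hp⟩ := ih
    exact ⟨.C 2 + (.C 3 + .X * (p + .C 7)), fun B => by
      simp only [cost, hp, Polynomial.eval_add, Polynomial.eval_C, Polynomial.eval_mul,
        Polynomial.eval_X]⟩

/-- `τ` differs from `σ` only where `P` writes. -/
structure Frame (P : LProg) (σ τ : State) : Prop where
  var : ∀ y, P.writesVar y = false → τ.var y = σ.var y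
  arr : ∀ b, P.writesArr b = false → τ.arr b = σ.arr b

theorem frame_run (P : LProg) (σ : State) : Frame P σ (P.run σ) :=
  ⟨fun y h => run_var y P h σ, fun b h => run_arr b P h σ⟩

/-- The invariant rule for counting loops. -/
theorem rep_induction {x N n : ℕ} {P : LProg} {σ : State} (hN : σ.var N = n)
    (hx : P.writesVar x = false) (Inv : ℕ → State → Prop) (zero : Inv 0 (σ.setVar x 0))
    (succ : ∀ (i : ℕ) (τ : State), i < n → τ.var x = i → Frame (rep x N P) σ τ → Inv i τ →
      Inv (i + 1) ((P.run τ).setVar x (i + 1))) :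
    Inv n ((rep x N P).run σ) := by
  rw [run, hN, Int.toNat_natCast]
  have key : ∀ i ≤ n, ∀ τ,
      (fun τ => (P.run τ).setVar x ((P.run τ).var x + 1))^[i] (σ.setVar x 0) = τ →
      τ.var x = i ∧ Frame (rep x N P) σ τ ∧ Inv i τ := by
    intro i
    induction i with
    | zero =>
      rintro _ τ rfl
      refine ⟨by simp [State.setVar], ⟨fun y hy => ?_, fun b _ => rfl⟩, zero⟩
      simp only [writesVar, Bool.or_eq_false_iff, beq_eq_false_iff_ne] at hy
      simp [State.setVar, Function.update_of_ne (Ne.symm hy.1)]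
    | succ i ih =>
      rintro hi τ rfl
      obtain ⟨h1, h2, h3⟩ := ih (by omega) _ rfl
      rw [Function.iterate_succ_apply']
      set τ := (fun τ => (P.run τ).setVar x ((P.run τ).var x + 1))^[i] (σ.setVar x 0)
      have h4 := succ i τ (by omega) h1 h2 h3
      rw [run_var x P hx, h1]
      refine ⟨by simp [State.setVar], ⟨fun y hy => ?_, fun b hb => ?_⟩, h4⟩
      · rw [← h2.var y hy]
        simp only [writesVar, Bool.or_eq_false_iff, beq_eq_false_iff_ne] at hy
        simp [State.setVar, Function.update_of_ne (Ne.symm hy.1), run_var y P hy.2]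
      · rw [← h2.arr b hb]
        exact run_arr b P hb _
  exact (key n le_rfl _ rfl).2.2

/-- A loop that fills the cells `b, …, b + n - 1` of an array. -/
theorem rep_fill {x N n : ℕ} {P : LProg} {σ : State} (hN : σ.var N = n)
    (hx : P.writesVar x = false) (a : ℕ) (b : ℤ) (w : ℕ → ℤ)
    (body : ∀ (i : ℕ) (τ : State), i < n → τ.var = Function.update σ.var x i →
      (∀ c, c ≠ a → τ.arr c = σ.arr c) →
      (∀ j, ¬ (b ≤ j ∧ j < b + i) → τ.arr a j = σ.arr a j) →
      P.run τ = τ.setArr a (b + i) (w i)) :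
    (rep x N P).run σ =
      ⟨Function.update σ.var x n, Function.update σ.arr a fun j =>
        if b ≤ j ∧ j < b + n then w (j - b).toNat else σ.arr a j⟩ := by
  refine rep_induction hN hx (fun i τ => τ = ⟨Function.update σ.var x i,
    Function.update σ.arr a fun j =>
      if b ≤ j ∧ j < b + i then w (j - b).toNat else σ.arr a j⟩) ?_ ?_
  · have : (fun j => if b ≤ j ∧ j < b + ((0 : ℕ) : ℤ) then w (j - b).toNat else σ.arr a j) =
        σ.arr a := funext fun j => if_neg (by simp)
    rw [this, Function.update_eq_self]
    rfl
  · rintro i τ hi - - rfl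
    rw [body i _ hi rfl (fun c hc => by simp [hc]) fun j hj => by simp [hj]]
    simp only [State.setArr, State.setVar, Function.update_idem, Function.update_self, State.mk.injEq,
      Nat.cast_add, Nat.cast_one, true_and]
    congr 1
    ext j
    by_cases hj : j = b + i
    · subst hj
      rw [Function.update_self, if_pos (by omega)]
      simp
    · rw [Function.update_of_ne hj]
      by_cases h1 : b ≤ j ∧ j < b + i
      · rw [if_pos h1, if_pos (by omega)]
      · rw [if_neg h1, if_neg (by omega)]

end LProg

instance : Add Expr := ⟨.add⟩
instance : Sub Expr := ⟨.sub⟩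

@[simp] theorem Expr.eval_add' (σ : State) (e f : Expr) : (e + f).eval σ = e.eval σ + f.eval σ := rfl
@[simp] theorem Expr.eval_sub' (σ : State) (e f : Expr) : (e - f).eval σ = e.eval σ - f.eval σ := rfl

end RAM

/-! ### The program -/

namespace RAM

@[simp] theorem State.setVar_var (σ : State) (x : ℕ) (v : ℤ) (y : ℕ) :
    (σ.setVar x v).var y = if y = x then v else σ.var y := by
  simp [State.setVar, Function.update_apply]

@[simp] theorem State.setVar_arr (σ : State) (x : ℕ) (v : ℤ) : (σ.setVar x v).arr = σ.arr := rfl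

@[simp] theorem State.setArr_var (σ : State) (a : ℕ) (i v : ℤ) : (σ.setArr a i v).var = σ.var := rfl

@[simp] theorem State.setArr_arr (σ : State) (a : ℕ) (i v : ℤ) (b : ℕ) :
    (σ.setArr a i v).arr b = if b = a then Function.update (σ.arr a) i v else σ.arr b := by
  by_cases h : b = a
  · subst h; simp [State.setArr]
  · simp [State.setArr, h]

attribute [simp] Expr.eval

end RAM

namespace FaultTolerant

open RAM RAM.LProg

local notation "vN" => (2 : ℕ)
local notation "vM" => (3 : ℕ)
local notation "vS" => (4 : ℕ)
local notation "vT" => (5 : ℕ)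
local notation "vCap" => (6 : ℕ)
local notation "vVal" => (7 : ℕ)
local notation "vBits" => (8 : ℕ)
local notation "vRounds" => (9 : ℕ)
local notation "cRound" => (10 : ℕ)
local notation "cU" => (11 : ℕ)
local notation "cV" => (12 : ℕ)
local notation "cAug" => (13 : ℕ)
local notation "cGrow" => (14 : ℕ)
local notation "cX" => (15 : ℕ)
local notation "cE" => (16 : ℕ)
local notation "cJ" => (17 : ℕ)
local notation "vFail" => (18 : ℕ)
local notation "vFound" => (19 : ℕ)
local notation "vSlack" => (20 : ℕ)
local notation "vArc" => (21 : ℕ)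
local notation "vDir" => (22 : ℕ)
local notation "vFrom" => (23 : ℕ)
local notation "vTo" => (24 : ℕ)
local notation "vCand" => (25 : ℕ)
local notation "vP" => (26 : ℕ)
local notation "vQ" => (27 : ℕ)
local notation "vC" => (28 : ℕ)
local notation "vPtr" => (29 : ℕ)
local notation "vAcc" => (30 : ℕ)
local notation "vB" => (31 : ℕ)
local notation "vR" => (32 : ℕ)
local notation "vH" => (33 : ℕ)
local notation "aTail" => (2 : ℕ)
local notation "aHead" => (3 : ℕ)
local notation "aCost" => (4 : ℕ)
local notation "aVul" => (5 : ℕ)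
local notation "aCap" => (6 : ℕ)
local notation "aOff" => (7 : ℕ)
local notation "aFlow" => (8 : ℕ)
local notation "aPot" => (9 : ℕ)
local notation "aIn" => (10 : ℕ)
local notation "aDist" => (11 : ℕ)
local notation "aSol" => (12 : ℕ)
local notation "aSet" => (13 : ℕ)

local notation "aNum" => (14 : ℕ)
local notation "aDen" => (15 : ℕ)

local notation "rd" => Expr.var
local notation "lit" => Expr.const
local infix:80 " ⟦⟧ " => Expr.get

/-- Cell `e` of the row of the vertex `x` in the array `a`. -/
def cell (a : ℕ) (x e : Expr) : Expr := a ⟦⟧ (aOff ⟦⟧ x + e)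

/-- Record the current arc in direction `d` from `x` to `y` if its slack is the smallest so far. -/
def record (x y : Expr) (d : ℤ) : LProg :=
  .seq (.assign vFound (lit 1)) <| .seq (.assign vSlack (rd vCand)) <|
    .seq (.assign vArc (rd cE)) <| .seq (.assign vDir (lit d)) <|
      .seq (.assign vFrom x) (.assign vTo y)

/-- Consider the current arc in direction `d` from `x` to `y` if `lo ≤ hi`. -/
def consider (x y lo hi slack : Expr) (d : ℤ) : LProg :=
  .ite (lit 1) (aIn ⟦⟧ x)
    (.ite (aIn ⟦⟧ y) (lit 0)
      (.ite lo hi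
        (.seq (.assign vCand slack)
          (.ite (rd vFound) (lit 0) (record x y d)
            (.ite (rd vSlack) (rd vCand) .skip (record x y d))))
        .skip)
      .skip)
    .skip

/-- The residual condition `f e < cap e` is tested over the integers as `f e + 1 ≤ cap e`. -/
def considerForward : LProg :=
  consider (aTail ⟦⟧ rd cE) (aHead ⟦⟧ rd cE) (cell aFlow (rd cU) (rd cE) + lit 1) (aCap ⟦⟧ rd cE)
    (aPot ⟦⟧ (aTail ⟦⟧ rd cE) + aCost ⟦⟧ rd cE - aPot ⟦⟧ (aHead ⟦⟧ rd cE)) 1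

def considerBackward : LProg :=
  consider (aHead ⟦⟧ rd cE) (aTail ⟦⟧ rd cE) (lit 1) (cell aFlow (rd cU) (rd cE))
    (aPot ⟦⟧ (aHead ⟦⟧ rd cE) - aCost ⟦⟧ rd cE - aPot ⟦⟧ (aTail ⟦⟧ rd cE)) (-1)

/-- Find a residual arc of minimum slack that leaves the set of reached vertices. -/
def scan : LProg :=
  .seq (.assign vFound (lit 0)) (.rep cE vM (.seq considerForward considerBackward))

def raisePot : LProg :=
  .rep cX vN (.ite (lit 1) (aIn ⟦⟧ rd cX) .skip
    (.store aPot (rd cX) (aPot ⟦⟧ rd cX + rd vSlack)))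

/-- Copy the row of `y` to the row of `x`. -/
def copyRow (a : ℕ) (x y : Expr) : LProg :=
  .rep cE vM (.store a (aOff ⟦⟧ x + rd cE) (cell a y (rd cE)))

/-- Implements `Search.grow`; the row of each reached vertex of `aFlow` holds the flow belonging to
that vertex. -/
def grow : LProg :=
  .seq scan <| .ite (lit 1) (rd vFound)
    (.seq raisePot <| .seq (copyRow aFlow (rd vTo) (rd vFrom)) <|
      .seq (.store aFlow (aOff ⟦⟧ rd vTo + rd vArc) (cell aFlow (rd vTo) (rd vArc) + rd vDir))
        (.store aIn (rd vTo) (lit 1)))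
    .skip

/-- The row of `cU` is the current flow. If the search reaches `cV`, the row of `cV` is a flow of
value one larger and becomes current. Potentials are kept between augmentations. -/
def augment : LProg :=
  .seq (.rep cX vN (.store aIn (rd cX) (lit 0))) <| .seq (.store aIn (rd cU) (lit 1)) <|
    .seq (.rep cGrow vN grow) <|
      .ite (lit 1) (aIn ⟦⟧ rd cV) (copyRow aFlow (rd cU) (rd cV)) (.assign vFail (lit 1))

/-- Compute a cheapest flow of value `vVal` from `cU` to `cV`. -/
def flow : LProg :=
  .seq (.rep cX vN (.store aPot (rd cX) (lit 0))) <|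
    .seq (.rep cE vM (.store aFlow (aOff ⟦⟧ rd cU + rd cE) (lit 0))) <|
      .seq (.assign vFail (lit 0)) (.rep cAug vVal augment)

/-- Replace the solution of `vQ` by that of `vP` together with `aSet`. -/
def improve : LProg :=
  .seq (.rep cE vM (.ite (lit 1) (cell aSol (rd vP) (rd cE))
      (.store aSol (aOff ⟦⟧ rd vQ + rd cE) (lit 1))
      (.store aSol (aOff ⟦⟧ rd vQ + rd cE) (aSet ⟦⟧ rd cE)))) <|
    .store aDist (rd vQ) (aDist ⟦⟧ rd vP + rd vC)

/-- Use the set `aSet` to get from `vP` to `vQ` if this is an improvement. -/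
def relax : LProg :=
  .seq (.assign vC (lit 0)) <|
    .seq (.rep cE vM (.ite (lit 1) (aSet ⟦⟧ rd cE) (.assign vC (rd vC + aCost ⟦⟧ rd cE)) .skip)) <|
      -- A cell of `aDist` holds a cost plus one, and zero marks an unreached vertex. The innermost
      -- test is therefore strict improvement.
      .ite (lit 1) (aDist ⟦⟧ rd vP)
        (.ite (aDist ⟦⟧ rd vQ) (lit 0) improve
          (.ite (aDist ⟦⟧ rd vP + rd vC + lit 1) (aDist ⟦⟧ rd vQ) improve .skip))
        .skip

def relaxPair : LProg :=
  .seq flow <| .ite (rd vFail) (lit 0)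
    (.seq (.rep cE vM (.ite (lit 1) (cell aFlow (rd cU) (rd cE))
        (.store aSet (rd cE) (lit 1)) (.store aSet (rd cE) (lit 0)))) <|
      .seq (.assign vP (rd cU)) <| .seq (.assign vQ (rd cV)) relax)
    .skip

def relaxArc : LProg :=
  .ite (aVul ⟦⟧ rd cJ) (lit 0)
    (.seq (.rep cE vM (.store aSet (rd cE) (lit 0))) <| .seq (.store aSet (rd cJ) (lit 1)) <|
      .seq (.assign vP (aTail ⟦⟧ rd cJ)) <| .seq (.assign vQ (aHead ⟦⟧ rd cJ)) relax)
    .skip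

def round : LProg :=
  .seq (.rep cU vN (.rep cV vN relaxPair)) (.rep cJ vM relaxArc)

def rounds : LProg := .rep cRound vRounds round

/-! ### Correctness of the flow computation -/

variable {n m : ℕ}

/-- The memory holds the network. -/
structure Ctx (N : Network (Fin n) (Fin m)) (σ : State) : Prop where
  numVerts : σ.var vN = n
  numArcs : σ.var vM = m
  val : σ.var vVal = N.k + 1
  tail : ∀ e : Fin m, σ.arr aTail (e : ℕ) = (N.tail e : ℕ)
  head : ∀ e : Fin m, σ.arr aHead (e : ℕ) = (N.head e : ℕ)
  cost : ∀ e : Fin m, σ.arr aCost (e : ℕ) = N.c e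
  vul : ∀ e : Fin m, σ.arr aVul (e : ℕ) = if e ∈ N.vul then 1 else 0
  cap : ∀ e : Fin m, σ.arr aCap (e : ℕ) = N.cap e
  off : ∀ x : Fin n, σ.arr aOff (x : ℕ) = (x : ℕ) * (m : ℤ)

/-- Whether none of the given variables and arrays is written. -/
def keeps (P : LProg) (xs as : List ℕ) : Bool :=
  xs.all (fun x => !P.writesVar x) && as.all fun a => !P.writesArr a

theorem Ctx.of_eq {N : Network (Fin n) (Fin m)} {σ τ : State} (h : Ctx N σ)
    (hv : ∀ x ∈ [vN, vM, vVal], τ.var x = σ.var x)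
    (ha : ∀ a ∈ [aTail, aHead, aCost, aVul, aCap, aOff], τ.arr a = σ.arr a) : Ctx N τ := by
  simp only [List.forall_mem_cons] at hv ha
  obtain ⟨h1, h2, h3, -⟩ := hv
  obtain ⟨g1, g2, g3, g4, g5, g6, -⟩ := ha
  exact ⟨h1 ▸ h.numVerts, h2 ▸ h.numArcs, h3 ▸ h.val, g1 ▸ h.tail, g2 ▸ h.head, g3 ▸ h.cost, g4 ▸ h.vul,
    g5 ▸ h.cap, g6 ▸ h.off⟩

theorem Ctx.frame {N : Network (Fin n) (Fin m)} {σ τ : State} (h : Ctx N σ) {P : LProg}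
    (hf : Frame P σ τ) (hP : keeps P [vN, vM, vVal] [aTail, aHead, aCost, aVul, aCap, aOff]) :
    Ctx N τ := by
  simp only [keeps, Bool.and_eq_true, List.all_eq_true, Bool.not_eq_true'] at hP
  exact h.of_eq (fun x hx => hf.var x (hP.1 x hx)) fun a ha => hf.arr a (hP.2 a ha)

/-- The rows of the array `a`. -/
def rows (n m a : ℕ) (σ : State) (x : Fin n) (e : Fin m) : ℤ :=
  σ.arr a ((x : ℕ) * (m : ℤ) + (e : ℕ))

theorem rows_disjoint {x y : Fin n} (hxy : y ≠ x) (e : Fin m) :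
    ¬ (((x : ℕ) : ℤ) * m ≤ (y : ℕ) * (m : ℤ) + (e : ℕ) ∧
      (y : ℕ) * (m : ℤ) + (e : ℕ) < ((x : ℕ) : ℤ) * m + m) := by
  rintro ⟨h1, h2⟩
  have he : ((e : ℕ) : ℤ) < m := by exact_mod_cast e.2
  have hxy' : (y : ℕ) ≠ x := fun h => hxy (Fin.ext h)
  rcases lt_or_gt_of_ne hxy' with h | h
  · have : ((y : ℕ) : ℤ) + 1 ≤ (x : ℕ) := by exact_mod_cast h
    nlinarith
  · have : ((x : ℕ) : ℤ) + 1 ≤ (y : ℕ) := by exact_mod_cast h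
    have : (0 : ℤ) ≤ (e : ℕ) := by positivity
    nlinarith

theorem rows_fill {σ τ : State} {a : ℕ} {x : Fin n} {w : ℕ → ℤ}
    (h : τ.arr a = fun j => if ((x : ℕ) : ℤ) * m ≤ j ∧ j < ((x : ℕ) : ℤ) * m + m then
      w (j - ((x : ℕ) : ℤ) * m).toNat else σ.arr a j) :
    rows n m a τ = Function.update (rows n m a σ) x fun e => w e := by
  ext y e
  by_cases hxy : y = x
  · subst hxy
    simp [rows, h]
  · rw [Function.update_of_ne hxy, rows, h]
    simp only [if_neg (rows_disjoint hxy e), rows]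

/-- The characteristic function of the reached vertices is stored. -/
def Reached (σ : State) (R : Finset (Fin n)) : Prop :=
  ∀ x : Fin n, σ.arr aIn (x : ℕ) = if x ∈ R then 1 else 0

def pot (n : ℕ) (σ : State) (x : Fin n) : ℤ := σ.arr aPot (x : ℕ)

/-- A cheapest residual arc leaving `R` among the arcs and directions in `D` has been recorded. -/
def Recorded (N : Network (Fin n) (Fin m)) (R : Finset (Fin n)) (f : Fin m → ℤ) (p : Fin n → ℤ)
    (D : Fin m → ℤ → Prop) (σ : State) : Prop :=
  (σ.var vFound = 0 ∧ ∀ e d x y, D e d → x ∈ R → y ∉ R → ¬ N.Residual f e d x y) ∨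
    (σ.var vFound = 1 ∧ ∃ e d x y, x ∈ R ∧ y ∉ R ∧ N.Residual f e d x y ∧
      (∀ e' d' x' y', D e' d' → x' ∈ R → y' ∉ R → N.Residual f e' d' x' y' →
        N.slack p e d ≤ N.slack p e' d') ∧
      σ.var vSlack = N.slack p e d ∧ σ.var vArc = (e : ℕ) ∧ σ.var vDir = d ∧
      σ.var vFrom = (x : ℕ) ∧ σ.var vTo = (y : ℕ))

/-- An arc taken in a given direction has only one pair of ends (`huniq`), so a single comparison
decides it. `X` and `Y` must be stable under changes of other variables because `record` evaluates
them after it has overwritten some. -/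
theorem recorded_consider {N : Network (Fin n) (Fin m)} {R : Finset (Fin n)} {f : Fin m → ℤ}
    {p : Fin n → ℤ} {D : Fin m → ℤ → Prop} {σ : State} (h : Recorded N R f p D σ)
    (hR : Reached σ R) {X Y lo hi slack : Expr} {d : ℤ} {e : Fin m} {x y : Fin n}
    (he : σ.var cE = (e : ℕ)) (hX : ∀ τ : State, τ.arr = σ.arr → τ.var cE = σ.var cE →
      X.eval τ = (x : ℕ)) (hY : ∀ τ : State, τ.arr = σ.arr → τ.var cE = σ.var cE →
      Y.eval τ = (y : ℕ)) (hlo : lo.eval σ ≤ hi.eval σ ↔ N.Residual f e d x y)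
    (huniq : ∀ x' y', N.Residual f e d x' y' → x' = x ∧ y' = y)
    (hs : slack.eval σ = N.slack p e d) :
    Recorded N R f p (fun e' d' => D e' d' ∨ e' = e ∧ d' = d)
      ((consider X Y lo hi slack d).run σ) := by
  have hX0 := hX σ rfl rfl
  have hY0 := hY σ rfl rfl
  have hno : (x ∈ R → y ∉ R → ¬ N.Residual f e d x y) →
      Recorded N R f p (fun e' d' => D e' d' ∨ e' = e ∧ d' = d) σ := by
    intro hn
    have hn' : ∀ x' y', x' ∈ R → y' ∉ R → ¬ N.Residual f e d x' y' := fun x' y' h1 h2 h3 => by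
      obtain ⟨rfl, rfl⟩ := huniq x' y' h3
      exact hn h1 h2 h3
    rcases h with ⟨h0, h1⟩ | ⟨h0, e', d', x', y', h1, h2, h3, h4, h5⟩
    · refine Or.inl ⟨h0, ?_⟩
      rintro e' d' x' y' (hD | ⟨rfl, rfl⟩) hx' hy'
      · exact h1 e' d' x' y' hD hx' hy'
      · exact hn' x' y' hx' hy'
    · refine Or.inr ⟨h0, e', d', x', y', h1, h2, h3, ?_, h5⟩
      rintro e'' d'' x'' y'' (hD | ⟨rfl, rfl⟩) hx' hy' hr
      · exact h4 e'' d'' x'' y'' hD hx' hy' hr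
      · exact absurd hr (hn' x'' y'' hx' hy')
  rw [consider]
  simp only [run, Expr.eval, hX0, hY0, hR x, hR y]
  by_cases hx : x ∈ R
  swap
  · simpa [hx] using hno fun h => absurd h hx
  by_cases hy : y ∈ R
  · simpa [hy, hx] using hno fun _ h => absurd hy h
  by_cases hl : lo.eval σ ≤ hi.eval σ
  swap
  · simpa [hx, hy, hl] using hno fun _ _ hr => hl (hlo.2 hr)
  have hres := hlo.1 hl
  simp only [hx, hy, hl, if_true, if_false, le_refl, State.setVar_var, hs]
  have hrec : (∀ e' d' x' y', D e' d' → x' ∈ R → y' ∉ R → N.Residual f e' d' x' y' →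
      N.slack p e d ≤ N.slack p e' d') → Recorded N R f p (fun e' d' => D e' d' ∨ e' = e ∧ d' = d)
        ((record X Y d).run (σ.setVar vCand (N.slack p e d))) := by
    intro hmin
    refine Or.inr ⟨by simp [record, run], e, d, x, y, hx, hy, hres, ?_, by simp [record, run],
      by simp [record, run, he], by simp [record, run], ?_, ?_⟩
    · rintro e'' d'' x'' y'' (hD | ⟨rfl, rfl⟩) hx' hy' hr
      · exact hmin e'' d'' x'' y'' hD hx' hy' hr
      · exact le_rfl
    · simp only [record, run, State.setVar_var]
      exact hX _ rfl (by simp)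
    · simp only [record, run, State.setVar_var]
      exact hY _ rfl (by simp)
  rcases h with ⟨h0, h1⟩ | ⟨h0, e', d', x', y', h1, h2, h3, h4, h5, h6⟩
  · simpa [h0] using hrec fun e' d' x' y' hD hx' hy' hr => absurd hr (h1 e' d' x' y' hD hx' hy')
  · by_cases hle : N.slack p e' d' ≤ N.slack p e d
    · suffices hh : Recorded N R f p (fun e' d' => D e' d' ∨ e' = e ∧ d' = d)
          (σ.setVar vCand (N.slack p e d)) by simpa [h0, h5, hle] using hh
      refine Or.inr ⟨by simp [h0], e', d', x', y', h1, h2, h3, ?_, by simpa [h5] using h6⟩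
      rintro e'' d'' x'' y'' (hD | ⟨rfl, rfl⟩) hx' hy' hr
      · exact h4 e'' d'' x'' y'' hD hx' hy' hr
      · exact hle
    · simpa [h0, h5, hle] using hrec fun e'' d'' x'' y'' hD hx' hy' hr =>
        (not_le.1 hle).le.trans (h4 e'' d'' x'' y'' hD hx' hy' hr)

theorem recorded_scan {N : Network (Fin n) (Fin m)} {R : Finset (Fin n)} {σ : State} {u : Fin n}
    (hσ : Ctx N σ) (hu : σ.var cU = (u : ℕ)) (hR : Reached σ R) :
    Recorded N R (rows n m aFlow σ u) (pot n σ) (fun _ d => d = 1 ∨ d = -1) (scan.run σ) := by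
  rw [scan, run]
  set σ' := (assign vFound (lit 0)).run σ with hσ'
  have hN' : σ'.var vM = m := by simp [hσ', run, hσ.numArcs]
  have := rep_induction (x := cE) (P := .seq considerForward considerBackward) hN' (by decide)
    (fun i τ => Recorded N R (rows n m aFlow σ u) (pot n σ)
      (fun e d => (e : ℕ) < i ∧ (d = 1 ∨ d = -1)) τ) ?_ ?_
  · refine (funext₂ fun e d => ?_ : (fun (e : Fin m) (d : ℤ) => d = 1 ∨ d = -1) = _) ▸ this
    simp
  · exact Or.inl ⟨by simp [hσ', run], fun e d x y h => absurd h.1 (Nat.not_lt_zero _)⟩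
  · intro i τ hi hx hf hinv
    have hτ : Ctx N τ := hσ.of_eq
      (fun x hx => by
        fin_cases hx <;> (rw [hf.var _ (by decide)]; simp [hσ', run]))
      (fun a ha => by
        fin_cases ha <;> (rw [hf.arr _ (by decide)]; simp [hσ', run]))
    have harr : ∀ a ∈ [aFlow, aPot, aIn], τ.arr a = σ.arr a := fun a ha => by
        fin_cases ha <;> (rw [hf.arr _ (by decide)]; simp [hσ', run])
    simp only [List.forall_mem_cons] at harr
    obtain ⟨hfl, hpo, hin, -⟩ := harr
    have hu' : τ.var cU = (u : ℕ) := by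
      rw [hf.var _ (by decide)]; simp [hσ', run, hu]
    let e : Fin m := ⟨i, hi⟩
    have hxe : τ.var cE = (e : ℕ) := hx
    have hRτ : Reached τ R := fun x => by rw [hin]; exact hR x
    have hte : τ.arr aTail (τ.var cE) = (N.tail e : ℕ) := by rw [hxe]; exact hτ.tail e
    have hhe : τ.arr aHead (τ.var cE) = (N.head e : ℕ) := by rw [hxe]; exact hτ.head e
    have hfe : τ.arr aFlow (τ.arr aOff (τ.var cU) + τ.var cE) = rows n m aFlow σ u e := by
      rw [hu', hτ.off, hxe, hfl]; rfl
    have hce : τ.arr aCost (τ.var cE) = N.c e := by rw [hxe]; exact hτ.cost e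
    have hcap : τ.arr aCap (τ.var cE) = N.cap e := by rw [hxe]; exact hτ.cap e
    have hpe : ∀ x : Fin n, τ.arr aPot (x : ℕ) = pot n σ x := fun x => by rw [hpo]; rfl
    have h1 : Recorded N R _ _ _ (considerForward.run τ) := recorded_consider (d := 1) (e := e) (x := N.tail e) (y := N.head e) hinv hRτ
      hxe (fun υ h1 h2 => by simp [h1, h2, hte]) (fun υ h1 h2 => by simp [h1, h2, hhe])
      (by simp [cell, hfe, hcap, Network.Residual])
      (fun x' y' h => by
        rcases h with ⟨-, rfl, rfl, -⟩ | ⟨h, -⟩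
        · exact ⟨rfl, rfl⟩
        · omega)
      (by simp [hte, hhe, hce, hpe, Network.slack])
    have hυ := frame_run considerForward τ
    generalize hυe : considerForward.run τ = υ at h1 hυ
    have k1 := hυ.var cE (by decide)
    have k2 := hυ.var cU (by decide)
    have k3 := hυ.arr aTail (by decide)
    have k4 := hυ.arr aHead (by decide)
    have k5 := hυ.arr aCost (by decide)
    have k6 := hυ.arr aOff (by decide)
    have k7 := hυ.arr aFlow (by decide)
    have k8 := hυ.arr aPot (by decide)
    have h2 : Recorded N R _ _ _ (considerBackward.run υ) :=
      recorded_consider (d := -1) (e := e) (x := N.head e) (y := N.tail e) h1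
      (fun x => by rw [hυ.arr _ (by decide)]; exact hRτ x) (k1.trans hxe)
      (fun υ h1 h2 => by simp [h1, h2, k1, k4, hhe])
      (fun υ h1 h2 => by simp [h1, h2, k1, k3, hte])
      (by simp [cell, k1, k2, k6, k7, hfe, Network.Residual, Order.one_le_iff_pos])
      (fun x' y' h => by
        rcases h with ⟨h, -⟩ | ⟨-, rfl, rfl, -⟩
        · omega
        · exact ⟨rfl, rfl⟩)
      (by
        simp only [Expr.eval_sub', Expr.eval, k1, k3, k4, k5, k8, hte, hhe, hce, hpe,
          Network.slack]
        ring)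
    have h3 : (fun (e' : Fin m) (d' : ℤ) => (((e' : ℕ) < i ∧ (d' = 1 ∨ d' = -1)) ∨ e' = e ∧ d' = 1) ∨
        e' = e ∧ d' = -1) = fun (e' : Fin m) (d' : ℤ) => (e' : ℕ) < i + 1 ∧ (d' = 1 ∨ d' = -1) := by
      ext e' d'
      have : e' = e ↔ (e' : ℕ) = i := Fin.ext_iff
      rw [this]
      omega
    rw [h3] at h2
    rw [run, hυe]
    simpa [Recorded] using h2

theorem rows_store {σ τ : State} {a : ℕ} {x : Fin n} {e : Fin m} {v : ℤ}
    (h : τ.arr a = Function.update (σ.arr a) ((x : ℕ) * (m : ℤ) + (e : ℕ)) v) :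
    rows n m a τ = Function.update (rows n m a σ) x (Function.update (rows n m a σ x) e v) := by
  ext y e'
  by_cases hxy : y = x
  · subst hxy
    rw [Function.update_self, rows, h]
    by_cases he : e' = e
    · subst he; simp
    · have : ((e' : ℕ) : ℤ) ≠ (e : ℕ) := by exact_mod_cast fun hh => he (Fin.ext hh)
      rw [Function.update_of_ne he, Function.update_of_ne (by omega)]
      rfl
  · rw [Function.update_of_ne hxy, rows, h, Function.update_of_ne]
    · rfl
    · intro hh
      refine rows_disjoint hxy e' ?_
      rw [hh]
      have : ((e : ℕ) : ℤ) < m := by exact_mod_cast e.2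
      omega

/-- A loop that fills the row of `x` in the array `a`. -/
theorem rows_rep_fill {N : Network (Fin n) (Fin m)} {σ : State} (hσ : Ctx N σ) {P : LProg}
    (hx : P.writesVar cE = false) (a : ℕ) (x : Fin n) (w : Fin m → ℤ)
    (body : ∀ (e : Fin m) (τ : State), τ.var = Function.update σ.var cE (e : ℕ) →
      (∀ c, c ≠ a → τ.arr c = σ.arr c) → (∀ y, y ≠ x → rows n m a τ y = rows n m a σ y) →
      rows n m a τ x e = rows n m a σ x e →
      P.run τ = τ.setArr a ((x : ℕ) * (m : ℤ) + (e : ℕ)) (w e)) :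
    rows n m a ((rep cE vM P).run σ) = Function.update (rows n m a σ) x w := by
  have h := rep_fill hσ.numArcs hx a ((x : ℕ) * (m : ℤ))
    (fun i => if hi : i < m then w ⟨i, hi⟩ else 0) ?_
  · rw [rows_fill (σ := σ) (x := x) (w := fun i => if hi : i < m then w ⟨i, hi⟩ else 0)
      (by rw [h]; simp)]
    simp
  · intro i τ hi h1 h2 h3
    rw [dif_pos hi]
    refine body ⟨i, hi⟩ τ h1 h2 (fun y hy => funext fun e => h3 _ fun hh => ?_) (h3 _ (by simp))
    refine rows_disjoint hy e ⟨hh.1, ?_⟩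
    omega

theorem rows_copyRow {N : Network (Fin n) (Fin m)} {σ : State} (hσ : Ctx N σ) {a : ℕ}
    (ha : a ≠ aOff) {X Y : Expr} {x y : Fin n}
    (hX : ∀ τ : State, (∀ z, z ≠ cE → τ.var z = σ.var z) → X.eval τ = (x : ℕ))
    (hY : ∀ τ : State, (∀ z, z ≠ cE → τ.var z = σ.var z) → Y.eval τ = (y : ℕ)) :
    rows n m a ((copyRow a X Y).run σ) =
      Function.update (rows n m a σ) x (rows n m a σ y) := by
  refine rows_rep_fill hσ rfl a x _ fun e τ h1 h2 h3 h4 => ?_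
  have hv : ∀ z, z ≠ cE → τ.var z = σ.var z := fun z hz => by rw [h1, Function.update_of_ne hz]
  have he : τ.var cE = (e : ℕ) := by rw [h1, Function.update_self]
  simp only [run_skip, run_assign, run_store, run_seq, run_ite, Expr.eval, cell, hX τ hv, hY τ hv, he, h2 _ ha.symm, hσ.off]
  congr 1
  by_cases hxy : y = x
  · rw [hxy]; exact h4
  · exact congrFun (h3 y hxy) e

theorem pot_raisePot {N : Network (Fin n) (Fin m)} {σ : State} (hσ : Ctx N σ)
    {R : Finset (Fin n)} (hR : Reached σ R) :
    pot n (raisePot.run σ) =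
      fun z => if z ∈ R then pot n σ z else pot n σ z + σ.var vSlack := by
  have h := rep_fill hσ.numVerts (P := .ite (lit 1) (aIn ⟦⟧ rd cX) .skip
    (.store aPot (rd cX) (aPot ⟦⟧ rd cX + rd vSlack))) (x := cX) rfl aPot 0
    (fun i => if 1 ≤ σ.arr aIn i then σ.arr aPot i else σ.arr aPot i + σ.var vSlack) ?_
  · rw [raisePot, h]
    ext z
    have : ((z : ℕ) : ℤ) < n := by exact_mod_cast z.2
    simp only [pot, Function.update_self]
    rw [if_pos (by omega)]
    simp only [sub_zero, Int.toNat_natCast, hR z]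
    by_cases hz : z ∈ R <;> simp [hz]
  · intro i τ hi h1 h2 h3
    have hi' : τ.arr aPot i = σ.arr aPot i := h3 _ (by omega)
    have hx : τ.var cX = i := by rw [h1, Function.update_self]
    have hs : τ.var vSlack = σ.var vSlack := by rw [h1, Function.update_of_ne (by decide)]
    simp only [run_skip, run_assign, run_store, run_seq, run_ite, Expr.eval, hx, hs, h2 aIn (by decide), hi', zero_add]
    split_ifs
    · rw [State.setArr, ← hi', Function.update_eq_self, Function.update_eq_self]
    · rfl

/-- The last clause measures progress. The growing case records that `R` was not closed, so a search
that is already closed stays closed under further iterations. -/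
theorem grow_spec {N : Network (Fin n) (Fin m)} {σ : State} {u t : Fin n} {a : ℤ}
    {R : Finset (Fin n)} (hσ : Ctx N σ) (hu : σ.var cU = (u : ℕ)) (hR : Reached σ R)
    (hS : N.Search u t a R (rows n m aFlow σ) (pot n σ)) :
    ∃ R', Reached (grow.run σ) R' ∧
      N.Search u t a R' (rows n m aFlow (grow.run σ)) (pot n (grow.run σ)) ∧
      (R' = R ∧ N.Closed (rows n m aFlow (grow.run σ) u) R' ∨
        ¬ N.Closed (rows n m aFlow σ u) R ∧ R.card < R'.card) := by
  have h1 := recorded_scan hσ hu hR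
  have hf := frame_run scan σ
  rw [grow, run]
  generalize scan.run σ = σ₁ at h1 hf ⊢
  have hσ₁ : Ctx N σ₁ := hσ.frame hf (by decide)
  have harr : σ₁.arr = σ.arr := funext fun b => hf.arr b rfl
  have hR₁ : Reached σ₁ R := fun x => by rw [harr]; exact hR x
  have hrow : rows n m aFlow σ₁ = rows n m aFlow σ := by ext x e; rw [rows, harr, rows]
  have hpot : pot n σ₁ = pot n σ := by ext x; rw [pot, harr, pot]
  rw [← hrow] at hS h1 ⊢
  rw [← hpot] at hS h1
  rcases h1 with ⟨h0, h1⟩ | ⟨h0, e, d, x, y, hx, hy, hres, hmin, hsl, harc, hdir, hfrom, hto⟩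
  · simp only [run_skip, run_assign, run_store, run_seq, run_ite, Expr.eval, h0]
    refine ⟨R, hR₁, hS, Or.inl ⟨rfl, fun e d x y hx hy hr => h1 e d x y ?_ hx hy hr⟩⟩
    rcases hr with ⟨h, -⟩ | ⟨h, -⟩ <;> simp [h]
  · simp only [run_skip, run_assign, run_store, run_seq, run_ite, Expr.eval, h0, le_refl, if_true]
    have hf₂ := frame_run raisePot σ₁
    have hp₂ := pot_raisePot hσ₁ hR₁
    generalize raisePot.run σ₁ = σ₂ at hf₂ hp₂ ⊢
    have hσ₂ := hσ₁.frame hf₂ (by decide)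
    have hr₂ : rows n m aFlow σ₂ = rows n m aFlow σ₁ := by
      ext x e; rw [rows, hf₂.arr _ (by decide), rows]
    have hf₃ := frame_run (copyRow aFlow (rd vTo) (rd vFrom)) σ₂
    have hr₃ := rows_copyRow (a := aFlow) (X := rd vTo) (Y := rd vFrom) (x := y) (y := x) hσ₂
      (by decide) (fun τ h => by
        rw [Expr.eval, h _ (by decide), hf₂.var _ (by decide), hto])
      (fun τ h => by
        rw [Expr.eval, h _ (by decide), hf₂.var _ (by decide), hfrom])
    generalize (copyRow aFlow (rd vTo) (rd vFrom)).run σ₂ = σ₃ at hf₃ hr₃ ⊢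
    have hσ₃ := hσ₂.frame hf₃ (by decide)
    have hto₃ : σ₃.var vTo = (y : ℕ) := by
      rw [hf₃.var _ (by decide), hf₂.var _ (by decide), hto]
    have harc₃ : σ₃.var vArc = (e : ℕ) := by
      rw [hf₃.var _ (by decide), hf₂.var _ (by decide), harc]
    have hdir₃ : σ₃.var vDir = d := by
      rw [hf₃.var _ (by decide), hf₂.var _ (by decide), hdir]
    have hin₃ : σ₃.arr aIn = σ₁.arr aIn := by
      rw [hf₃.arr _ (by decide), hf₂.arr _ (by decide)]
    have hpo₃ : σ₃.arr aPot = σ₂.arr aPot := hf₃.arr _ (by decide)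
    simp only [Expr.eval, cell, hto₃, harc₃, hdir₃, hσ₃.off, State.setArr_var]
    set σ₄ := (σ₃.setArr aFlow ((y : ℕ) * (m : ℤ) + (e : ℕ))
      (σ₃.arr aFlow ((y : ℕ) * (m : ℤ) + (e : ℕ)) + d)) with hσ₄
    have hr₄ := rows_store (σ := σ₃) (τ := σ₄) (a := aFlow) (x := y) (e := e)
      (v := σ₃.arr aFlow ((y : ℕ) * (m : ℤ) + (e : ℕ)) + d) (by simp [hσ₄])
    have hr₅ : rows n m aFlow (σ₄.setArr aIn (y : ℕ) 1) = Function.update (rows n m aFlow σ₁) y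
        (Function.update (rows n m aFlow σ₁ x) e (rows n m aFlow σ₁ x e + d)) := by
      have h5 : rows n m aFlow (σ₄.setArr aIn (y : ℕ) 1) = rows n m aFlow σ₄ := by
        ext; simp [rows]
      have h6 : σ₃.arr aFlow ((y : ℕ) * (m : ℤ) + (e : ℕ)) = rows n m aFlow σ₃ y e := rfl
      rw [h5, hr₄, h6, hr₃, hr₂]
      simp
    have hp₅ : pot n (σ₄.setArr aIn (y : ℕ) 1) = pot n σ₂ := by
      ext; simp [pot, hσ₄, hpo₃]
    refine ⟨insert y R, ?_, ?_, Or.inr ⟨fun hc => hc e d x y hx hy hres, ?_⟩⟩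
    · intro z
      simp only [State.setArr_arr, if_true, hσ₄, hin₃]
      by_cases hz : z = y
      · subst hz; simp
      · have : ((z : ℕ) : ℤ) ≠ (y : ℕ) := by exact_mod_cast fun hh => hz (Fin.ext hh)
        simp [this, hz, hR₁ z]
    · rw [hr₅, hp₅, hp₂, hsl]
      exact hS.grow hx hy hres fun e' d' x' y' hx' hy' hr => hmin e' d' x' y'
        (by rcases hr with ⟨h, -⟩ | ⟨h, -⟩ <;> simp [h]) hx' hy' hr
    · rw [Finset.card_insert_of_notMem hy]
      omega

/-- Some cut between `u` and `t` has capacity at most `k`. -/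
def Narrow (N : Network (Fin n) (Fin m)) (u t : Fin n) : Prop :=
  ∃ X : Finset (Fin n), u ∈ X ∧ t ∉ X ∧ ∑ e ∈ N.cut Finset.univ X, N.cap e < (N.k : ℤ) + 1

/-- The row of `u` is a cheapest flow of value `a` from `u` to `t`. -/
def FlowOf (N : Network (Fin n) (Fin m)) (u t : Fin n) (a : ℤ) (σ : State) : Prop :=
  ∃ p, N.Tight (rows n m aFlow σ u) p ∧
    ∀ x, N.excess (rows n m aFlow σ u) x = a * (Network.unit u x - Network.unit t x)

theorem augment_spec {N : Network (Fin n) (Fin m)} {σ : State} {u t : Fin n} {a : ℤ}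
    (hσ : Ctx N σ) (hu : σ.var cU = (u : ℕ)) (ht : σ.var cV = (t : ℕ))
    (hT : N.Tight (rows n m aFlow σ u) (pot n σ))
    (hF : ∀ x, N.excess (rows n m aFlow σ u) x = a * (Network.unit u x - Network.unit t x))
    (ha : a < N.k + 1) :
    ((augment.run σ).var vFail = 1 ∧ Narrow N u t) ∨
      ((augment.run σ).var vFail = σ.var vFail ∧
        N.Tight (rows n m aFlow (augment.run σ) u) (pot n (augment.run σ)) ∧
        ∀ x, N.excess (rows n m aFlow (augment.run σ) u) x =
          (a + 1) * (Network.unit u x - Network.unit t x)) := by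
  have hclear := rep_fill hσ.numVerts (P := .store aIn (rd cX) (lit 0)) (x := cX) rfl aIn 0
    (fun _ => 0) (fun i τ _ h1 _ _ => by
      simp only [run_skip, run_assign, run_store, run_seq, run_ite, Expr.eval, h1, Function.update_self, zero_add])
  rw [augment, run, hclear]
  clear hclear
  simp only [run_skip, run_assign, run_store, run_seq, run_ite, Expr.eval, ite_self]
  set σ₁ : State := State.setArr ⟨Function.update σ.var cX n, Function.update σ.arr aIn fun j =>
    if 0 ≤ j ∧ j < 0 + (n : ℤ) then 0 else σ.arr aIn j⟩ aIn (Function.update σ.var cX n cU) 1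
    with hσ₁
  have hv₁ : ∀ z, z ≠ cX → σ₁.var z = σ.var z := fun z hz => by
    simp [hσ₁, hz]
  have ha₁ : ∀ b, b ≠ aIn → σ₁.arr b = σ.arr b := fun b hb => by
    simp [hσ₁, hb]
  have hctx₁ : Ctx N σ₁ := hσ.of_eq (fun z hz => hv₁ z (by fin_cases hz <;> decide))
    fun b hb => ha₁ b (by fin_cases hb <;> decide)
  have hrow₁ : rows n m aFlow σ₁ = rows n m aFlow σ := by
    ext; rw [rows, ha₁ _ (by decide), rows]
  have hpot₁ : pot n σ₁ = pot n σ := by ext; rw [pot, ha₁ _ (by decide), pot]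
  have hR₁ : Reached σ₁ {u} := by
    intro z
    have hz' : ((z : ℕ) : ℤ) < n := by exact_mod_cast z.2
    simp only [hσ₁, State.setArr_arr, if_true, Function.update_self,
      Function.update_of_ne (show cU ≠ cX by decide), hu]
    by_cases hz : z = u
    · subst hz; simp
    · have : ((z : ℕ) : ℤ) ≠ (u : ℕ) := by exact_mod_cast fun hh => hz (Fin.ext hh)
      simp [this, hz]
  -- The search starts with one reached vertex, so `n` growing steps would reach `n + 1` vertices.
  -- Hence it is closed at the end.
  have key := rep_induction (x := cGrow) (P := grow) hctx₁.numVerts (by decide)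
    (fun i τ => ∃ R, Reached τ R ∧ N.Search u t a R (rows n m aFlow τ) (pot n τ) ∧
      (N.Closed (rows n m aFlow τ u) R ∨ i + 1 ≤ R.card)) ?_ ?_
  · have hf := frame_run (rep cGrow vN grow) σ₁
    generalize (rep cGrow vN grow).run σ₁ = σ₂ at key hf
    obtain ⟨R, hR, hS, hc⟩ := key
    have hc : N.Closed (rows n m aFlow σ₂ u) R := hc.resolve_right fun h => by
      have := Finset.card_le_univ R
      rw [Fintype.card_fin] at this
      omega
    have hctx₂ := hctx₁.frame hf (by decide)
    have ht₂ : σ₂.var cV = (t : ℕ) := by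
      rw [hf.var _ (by decide), hv₁ _ (by decide), ht]
    have hu₂ : σ₂.var cU = (u : ℕ) := by
      rw [hf.var _ (by decide), hv₁ _ (by decide), hu]
    simp only [ht₂, hR t]
    by_cases htR : t ∈ R
    · right
      simp only [htR, if_true, le_refl]
      have hf₃ := frame_run (copyRow aFlow (rd cU) (rd cV)) σ₂
      have hr₃ := rows_copyRow (a := aFlow) (X := rd cU) (Y := rd cV) (x := u) (y := t) hctx₂
        (by decide) (fun τ h => by rw [Expr.eval, h _ (by decide), hu₂])
        (fun τ h => by rw [Expr.eval, h _ (by decide), ht₂])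
      generalize (copyRow aFlow (rd cU) (rd cV)).run σ₂ = σ₃ at hf₃ hr₃ ⊢
      have hp₃ : pot n σ₃ = pot n σ₂ := by ext; rw [pot, hf₃.arr _ (by decide), pot]
      rw [hr₃, Function.update_self, hp₃]
      refine ⟨?_, hS.tight t htR, fun x => ?_⟩
      · rw [hf₃.var _ (by decide), hf.var _ (by decide), hv₁ _ (by decide)]
      · rw [hS.excess_eq t htR]; ring
    · left
      simp only [htR, if_false]
      refine ⟨by simp, R, hS.root, htR, ?_⟩
      rw [hS.cut_eq hc htR]
      exact ha
  · refine ⟨{u}, hR₁, ?_, Or.inr (by simp)⟩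
    have h2 : rows n m aFlow (σ₁.setVar cGrow 0) = rows n m aFlow σ := hrow₁
    have h3 : pot n (σ₁.setVar cGrow 0) = pot n σ := hpot₁
    rw [h2, h3]
    exact Network.Search.start rfl hT hF
  · rintro i τ hi - hf ⟨R, hR, hS, hc⟩
    have hctx := hctx₁.frame hf (by decide)
    have huτ : τ.var cU = (u : ℕ) := by
      rw [hf.var _ (by decide), hv₁ _ (by decide), hu]
    obtain ⟨R', hR', hS', h⟩ := grow_spec hctx huτ hR hS
    refine ⟨R', hR', hS', ?_⟩
    rcases h with ⟨-, h⟩ | ⟨hn, h⟩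
    · exact Or.inl h
    · have := hc.resolve_left hn
      exact Or.inr (by omega)

/-- After a failure the remaining augmentations still run, but they never clear the flag. The narrow
cut is a property of the network and is not affected by them. -/
theorem augment_fail {σ : State} (h : σ.var vFail = 1) : (augment.run σ).var vFail = 1 := by
  simp only [augment, run_seq, run_ite]
  split_ifs
  · rw [run_var _ _ (by decide), run_var _ _ (by decide), run_var _ _ (by decide),
      run_var _ _ (by decide), h]
  · simp

/-- The zero flow is complementary to the zero potential because costs are nonnegative. Each of the
`k + 1` augmentations raises the value by one or certifies a cut whose capacity is the current
value, which is at most `k`. -/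
theorem flow_spec {N : Network (Fin n) (Fin m)} {σ : State} {u t : Fin n}
    (hσ : Ctx N σ) (hu : σ.var cU = (u : ℕ)) (ht : σ.var cV = (t : ℕ)) (hc : ∀ e, 0 ≤ N.c e) :
    ((flow.run σ).var vFail = 1 ∧ Narrow N u t) ∨
      ((flow.run σ).var vFail = 0 ∧ FlowOf N u t (N.k + 1) (flow.run σ)) := by
  have hclear := rep_fill hσ.numVerts (P := .store aPot (rd cX) (lit 0)) (x := cX) rfl aPot 0
    (fun _ => 0) (fun i τ _ h1 _ _ => by
      simp only [run_store, Expr.eval, h1, Function.update_self, zero_add])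
  have hf₁ := frame_run (.rep cX vN (.store aPot (rd cX) (lit 0))) σ
  rw [flow, run_seq, run_seq, run_seq]
  have hp₁ : pot n ((LProg.rep cX vN (.store aPot (rd cX) (lit 0))).run σ) = fun _ => 0 := by
    rw [hclear]
    ext z
    have : ((z : ℕ) : ℤ) < n := by exact_mod_cast z.2
    simp only [pot, Function.update_self]
    rw [if_pos (by omega)]
  clear hclear
  generalize (LProg.rep cX vN (.store aPot (rd cX) (lit 0))).run σ = σ₁ at hf₁ hp₁ ⊢
  have hσ₁ := hσ.frame hf₁ (by decide)
  have hr₂ := rows_rep_fill hσ₁ (P := .store aFlow (aOff ⟦⟧ rd cU + rd cE) (lit 0)) rfl aFlow u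
    (fun _ => 0) (fun e τ h1 h2 _ _ => by
      have : τ.var cU = (u : ℕ) := by
        rw [h1, Function.update_of_ne (by decide), hf₁.var _ (by decide), hu]
      simp [this, h1, h2, hσ₁.off])
  have hf₂ := frame_run (.rep cE vM (.store aFlow (aOff ⟦⟧ rd cU + rd cE) (lit 0))) σ₁
  generalize (LProg.rep cE vM (.store aFlow (aOff ⟦⟧ rd cU + rd cE) (lit 0))).run σ₁ = σ₂
    at hf₂ hr₂ ⊢
  have hσ₂ := hσ₁.frame hf₂ (by decide)
  have hf₃ := frame_run (.assign vFail (lit 0)) σ₂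
  have h0 : ((LProg.assign vFail (lit 0)).run σ₂).var vFail = 0 := by simp
  generalize (LProg.assign vFail (lit 0)).run σ₂ = σ₃ at hf₃ h0 ⊢
  have hσ₃ := hσ₂.frame hf₃ (by decide)
  have hr₃ : rows n m aFlow σ₃ u = fun _ => 0 := by
    have : rows n m aFlow σ₃ = rows n m aFlow σ₂ := by ext; rw [rows, hf₃.arr _ rfl, rows]
    rw [this, hr₂, Function.update_self]
  have hp₃ : pot n σ₃ = fun _ => 0 := by
    rw [← hp₁]; ext; rw [pot, hf₃.arr _ rfl, hf₂.arr _ rfl, pot]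
  have hcap : ∀ e, 0 ≤ N.cap e := fun e => by unfold Network.cap; split_ifs <;> omega
  have hu₃ : σ₃.var cU = (u : ℕ) := by
    rw [hf₃.var _ rfl, hf₂.var _ rfl, hf₁.var _ rfl, hu]
  have ht₃ : σ₃.var cV = (t : ℕ) := by
    rw [hf₃.var _ rfl, hf₂.var _ rfl, hf₁.var _ rfl, ht]
  have key := rep_induction (x := cAug) (P := augment) (n := N.k + 1)
    (by rw [hσ₃.val]; push_cast; rfl) (by decide)
    (fun i τ => τ.var vFail = 1 ∧ Narrow N u t ∨ τ.var vFail = 0 ∧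
      N.Tight (rows n m aFlow τ u) (pot n τ) ∧ ∀ x, N.excess (rows n m aFlow τ u) x =
        (i : ℤ) * (Network.unit u x - Network.unit t x)) ?_ ?_
  · rcases key with h | ⟨h1, h2, h3⟩
    · exact Or.inl h
    · exact Or.inr ⟨h1, _, h2, fun x => by rw [h3]; push_cast; rfl⟩
  · right
    have h2 : rows n m aFlow (σ₃.setVar cAug 0) u = fun _ => 0 := hr₃
    have h3 : pot n (σ₃.setVar cAug 0) = fun _ => 0 := hp₃
    rw [h2, h3]
    refine ⟨by simpa using h0, ⟨fun _ => le_rfl, hcap, fun e _ => by simpa using hc e,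
      fun e h => absurd h (lt_irrefl _)⟩, fun x => by simp [Network.excess]⟩
  · rintro i τ hi - hf (⟨h, h'⟩ | ⟨h, hT, hF⟩)
    · exact Or.inl ⟨by simpa using augment_fail h, h'⟩
    · have hτ := hσ₃.frame hf (by decide)
      have huτ : τ.var cU = (u : ℕ) := by rw [hf.var _ (by decide), hu₃]
      have htτ : τ.var cV = (t : ℕ) := by rw [hf.var _ (by decide), ht₃]
      rcases augment_spec hτ huτ htτ hT hF (by omega) with ⟨h1, h2⟩ | ⟨h1, h2, h3⟩
      · exact Or.inl ⟨by simpa using h1, h2⟩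
      · refine Or.inr ⟨by simpa [h] using h1, h2, fun x => ?_⟩
        push_cast
        exact h3 x

/-! ### Shortest chains of hops -/

/-- The set stored in `aSet`. -/
def stored (m : ℕ) (σ : State) : Finset (Fin m) :=
  Finset.univ.filter fun e => 1 ≤ σ.arr aSet (e : ℕ)

/-- The solution stored for the vertex `x`. -/
def solution (n m : ℕ) (σ : State) (x : Fin n) : Finset (Fin m) :=
  Finset.univ.filter fun e => 1 ≤ rows n m aSol σ x e

/-- The stored solutions are robust and their costs are bounded by the stored distances. -/
def Valid (N : Network (Fin n) (Fin m)) (s : Fin n) (σ : State) : Prop :=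
  ∀ x : Fin n, 1 ≤ σ.arr aDist (x : ℕ) →
    N.Robust (solution n m σ x) s x ∧ ∑ e ∈ solution n m σ x, N.c e + 1 ≤ σ.arr aDist (x : ℕ)

/-- The vertex `x` has been reached at cost at most `C`. -/
def Reaches (σ : State) (x : Fin n) (C : ℤ) : Prop :=
  1 ≤ σ.arr aDist (x : ℕ) ∧ σ.arr aDist (x : ℕ) ≤ C + 1

/-- What is valid stays valid, and distances do not increase. -/
structure Progress (N : Network (Fin n) (Fin m)) (s : Fin n) (σ τ : State) : Prop where
  valid : Valid N s σ → Valid N s τ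
  reaches : ∀ (x : Fin n) C, Reaches σ x C → Reaches τ x C

theorem Progress.of_eq {N : Network (Fin n) (Fin m)} {s : Fin n} {σ τ : State}
    (hD : τ.arr aDist = σ.arr aDist) (hS : τ.arr aSol = σ.arr aSol) : Progress N s σ τ := by
  refine ⟨fun h => ?_, fun x C h => ?_⟩
  · have hrow : rows n m aSol τ = rows n m aSol σ := by ext; rw [rows, hS, rows]
    intro x hx
    rw [hD] at hx ⊢
    rw [solution, hrow]
    exact h x hx
  · simpa only [Reaches, hD] using h

theorem Progress.trans {N : Network (Fin n) (Fin m)} {s : Fin n} {σ τ υ : State}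
    (h : Progress N s σ τ) (h' : Progress N s τ υ) : Progress N s σ υ :=
  ⟨fun hh => h'.valid (h.valid hh), fun x C hh => h'.reaches x C (h.reaches x C hh)⟩

theorem sum_lt_succ (g : Fin m → ℤ) {i : ℕ} (hi : i < m) :
    ∑ e : Fin m, (if (e : ℕ) < i + 1 then g e else 0) =
      ∑ e : Fin m, (if (e : ℕ) < i then g e else 0) + g ⟨i, hi⟩ := by
  have : g ⟨i, hi⟩ = ∑ e : Fin m, if e = ⟨i, hi⟩ then g e else 0 := by simp
  rw [this, ← Finset.sum_add_distrib]
  refine Finset.sum_congr rfl fun e _ => ?_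
  simp only [Fin.ext_iff]
  by_cases h1 : (e : ℕ) < i
  · rw [if_pos (by omega), if_pos h1, if_neg (by omega), add_zero]
  · by_cases h2 : (e : ℕ) = i
    · rw [if_pos (by omega), if_neg h1, if_pos h2, zero_add]
    · rw [if_neg (by omega), if_neg h1, if_neg h2, add_zero]

/-- Robustness is transitive, and the cost of a union is at most the sum of the costs, so the new
entry of `q` is valid. By `hdq` it does not worsen the distance of `q`. Overlaps may make the true
cost smaller than the stored distance. -/
theorem improve_spec {N : Network (Fin n) (Fin m)} {s p q : Fin n} {σ : State} (hσ : Ctx N σ)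
    (hc : ∀ e, 0 ≤ N.c e) (hp : σ.var vP = (p : ℕ)) (hq : σ.var vQ = (q : ℕ))
    (hZ : N.Robust (stored m σ) p q) (hC : σ.var vC = ∑ e ∈ stored m σ, N.c e)
    (hdp : 1 ≤ σ.arr aDist (p : ℕ))
    (hdq : σ.arr aDist (q : ℕ) ≤ 0 ∨
      σ.arr aDist (p : ℕ) + σ.var vC + 1 ≤ σ.arr aDist (q : ℕ)) :
    Progress N s σ (improve.run σ) ∧
      ∀ C, Reaches σ p C → Reaches (improve.run σ) q (C + ∑ e ∈ stored m σ, N.c e) := by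
  have hC0 : 0 ≤ ∑ e ∈ stored m σ, N.c e := Finset.sum_nonneg fun e _ => hc e
  rw [improve, run_seq, run_store]
  have hr := rows_rep_fill hσ (P := (.ite (lit 1) (cell aSol (rd vP) (rd cE))
      (.store aSol (aOff ⟦⟧ rd vQ + rd cE) (lit 1))
      (.store aSol (aOff ⟦⟧ rd vQ + rd cE) (aSet ⟦⟧ rd cE)))) rfl aSol q
    (fun e => if 1 ≤ rows n m aSol σ p e then 1 else σ.arr aSet (e : ℕ))
    (fun e τ h1 h2 h3 h4 => by
      have hpτ : τ.var vP = (p : ℕ) := by rw [h1, Function.update_of_ne (by decide), hp]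
      have hqτ : τ.var vQ = (q : ℕ) := by rw [h1, Function.update_of_ne (by decide), hq]
      have hrow : τ.arr aSol ((p : ℕ) * (m : ℤ) + (e : ℕ)) = rows n m aSol σ p e := by
        -- If `p = q`, the row is overwritten while being read, but cell `e` is still unchanged when
        -- its turn comes.
        by_cases hpq : p = q
        · rw [hpq]; exact h4
        · exact congrFun (h3 p hpq) e
      simp only [run_ite, run_store, cell, Expr.eval_add', Expr.eval, hpτ, hqτ, h1,
        Function.update_self, h2 aOff (by decide), h2 aSet (by decide), hσ.off, hrow]
      split_ifs <;> rfl)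
  set P₀ : LProg := .rep cE vM (.ite (lit 1) (cell aSol (rd vP) (rd cE))
      (.store aSol (aOff ⟦⟧ rd vQ + rd cE) (lit 1))
      (.store aSol (aOff ⟦⟧ rd vQ + rd cE) (aSet ⟦⟧ rd cE))) with hP₀
  have hf := frame_run P₀ σ
  generalize P₀.run σ = σ₁ at hr hf ⊢
  simp only [Expr.eval_add', Expr.eval, hf.var vP rfl, hf.var vQ rfl, hf.var vC rfl,
    hf.arr aDist rfl, hp, hq, hC]
  rw [hC] at hdq
  set τ := σ₁.setArr aDist (q : ℕ) (σ.arr aDist (p : ℕ) + ∑ e ∈ stored m σ, N.c e) with hτ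
  have hd : ∀ x : Fin n, τ.arr aDist (x : ℕ) = if x = q then
      σ.arr aDist (p : ℕ) + ∑ e ∈ stored m σ, N.c e else σ.arr aDist (x : ℕ) := by
    intro x
    by_cases hx : x = q
    · subst hx; simp [hτ]
    · have : ((x : ℕ) : ℤ) ≠ (q : ℕ) := by exact_mod_cast fun hh => hx (Fin.ext hh)
      simp [hτ, hx, this, hf.arr aDist rfl]
  have hsol : ∀ x : Fin n, solution n m τ x = if x = q then solution n m σ p ∪ stored m σ else
      solution n m σ x := by
    intro x
    have h1 : rows n m aSol τ = rows n m aSol σ₁ := by ext; simp [rows, hτ]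
    rw [solution, h1, hr]
    by_cases hx : x = q
    · subst hx
      ext e
      simp only [Function.update_self, if_true, Finset.mem_filter, Finset.mem_univ, true_and,
        Finset.mem_union, solution, stored]
      split_ifs with h <;> simp [h]
    · rw [Function.update_of_ne hx, if_neg hx, solution]
  refine ⟨⟨fun hV x hx => ?_, fun x C hx => ?_⟩, fun C hx => ?_⟩
  · rw [hd] at hx ⊢
    rw [hsol]
    by_cases hxq : x = q
    · subst hxq
      obtain ⟨h1, h2⟩ := hV p hdp
      simp only [if_true]
      refine ⟨(h1.mono Finset.subset_union_left).trans (hZ.mono Finset.subset_union_right), ?_⟩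
      have h3 := Finset.sum_union_inter (s₁ := solution n m σ p) (s₂ := stored m σ) (f := N.c)
      have h4 : 0 ≤ ∑ e ∈ solution n m σ p ∩ stored m σ, N.c e :=
        Finset.sum_nonneg fun e _ => hc e
      linarith
    · simp only [hxq, if_false] at hx ⊢
      exact hV x hx
  · rw [Reaches, hd]
    by_cases hxq : x = q
    · subst hxq
      simp only [if_true]
      have := hx.1
      have := hx.2
      omega
    · simp only [hxq, if_false]
      exact hx
  · rw [Reaches, hd]
    simp only [if_true]
    have := hx.2
    omega

theorem relax_spec {N : Network (Fin n) (Fin m)} {s p q : Fin n} {σ : State} (hσ : Ctx N σ)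
    (hc : ∀ e, 0 ≤ N.c e) (hp : σ.var vP = (p : ℕ)) (hq : σ.var vQ = (q : ℕ))
    (hZ : N.Robust (stored m σ) p q) :
    Progress N s σ (relax.run σ) ∧
      ∀ C, Reaches σ p C → Reaches (relax.run σ) q (C + ∑ e ∈ stored m σ, N.c e) := by
  rw [relax, run_seq, run_seq]
  have hf₁ := frame_run (.assign vC (lit 0)) σ
  have h0 : ((LProg.assign vC (lit 0)).run σ).var vC = 0 := by simp
  generalize (LProg.assign vC (lit 0)).run σ = σ₁ at hf₁ h0 ⊢
  have hσ₁ := hσ.frame hf₁ (by decide)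
  have key := rep_induction (x := cE)
    (P := .ite (lit 1) (aSet ⟦⟧ rd cE) (.assign vC (rd vC + aCost ⟦⟧ rd cE)) .skip)
    hσ₁.numArcs (by decide) (fun i τ => τ.var vC =
      ∑ e : Fin m, if (e : ℕ) < i then (if 1 ≤ σ.arr aSet (e : ℕ) then N.c e else 0) else 0) ?_ ?_
  · set P₀ : LProg := .rep cE vM
      (.ite (lit 1) (aSet ⟦⟧ rd cE) (.assign vC (rd vC + aCost ⟦⟧ rd cE)) .skip) with hP₀
    have hf₂ := frame_run P₀ σ₁
    generalize P₀.run σ₁ = σ₂ at key hf₂ ⊢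
    have hσ₂ := hσ₁.frame hf₂ (by decide)
    have harr : σ₂.arr = σ.arr := funext fun b => by rw [hf₂.arr b rfl, hf₁.arr b rfl]
    have hst : stored m σ₂ = stored m σ := by simp only [stored, harr]
    have hC : σ₂.var vC = ∑ e ∈ stored m σ₂, N.c e := by
      rw [key, hst, stored, Finset.sum_filter]
      exact Finset.sum_congr rfl fun e _ => if_pos e.2
    have hp₂ : σ₂.var vP = (p : ℕ) := by rw [hf₂.var _ rfl, hf₁.var _ rfl, hp]
    have hq₂ : σ₂.var vQ = (q : ℕ) := by rw [hf₂.var _ rfl, hf₁.var _ rfl, hq]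
    have hstart : Progress N s σ σ₂ := .of_eq (by rw [harr]) (by rw [harr])
    -- If the test for improvement fails, the stored distance of `q` is already at most that of `p`
    -- plus the cost of the set.
    have hno : (σ.arr aDist (p : ℕ) < 1 ∨ ¬ σ.arr aDist (q : ℕ) ≤ 0 ∧
        ¬ σ.arr aDist (p : ℕ) + ∑ e ∈ stored m σ, N.c e + 1 ≤ σ.arr aDist (q : ℕ)) →
        Progress N s σ σ₂ ∧
        ∀ C, Reaches σ p C → Reaches σ₂ q (C + ∑ e ∈ stored m σ, N.c e) := by
      refine fun h => ⟨hstart, fun C hC => ?_⟩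
      have h1 := hC.1
      have h2 := hC.2
      rw [Reaches, harr]
      omega
    have hyes : 1 ≤ σ.arr aDist (p : ℕ) → (σ.arr aDist (q : ℕ) ≤ 0 ∨
        σ.arr aDist (p : ℕ) + ∑ e ∈ stored m σ, N.c e + 1 ≤ σ.arr aDist (q : ℕ)) →
        Progress N s σ (improve.run σ₂) ∧
        ∀ C, Reaches σ p C → Reaches (improve.run σ₂) q (C + ∑ e ∈ stored m σ, N.c e) := by
      intro h1 h2
      rw [← hst] at hZ h2 ⊢
      rw [← harr, ← hC] at h2
      obtain ⟨h3, h4⟩ := improve_spec (s := s) hσ₂ hc hp₂ hq₂ hZ hC (by rwa [harr]) h2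
      exact ⟨hstart.trans h3, fun C hC => h4 C (hstart.reaches p C hC)⟩
    simp only [run_ite, run_skip, Expr.eval_add', Expr.eval, hp₂, hq₂, harr, hC, hst]
    split_ifs with h1 h2 h3
    · exact hyes h1 (Or.inl h2)
    · exact hyes h1 (Or.inr h3)
    · exact hno (Or.inr ⟨h2, h3⟩)
    · exact hno (Or.inl (not_le.1 h1))
  · simp [h0]
  · intro i τ hi hx hf hinv
    have hτ := hσ₁.frame hf (by decide)
    have h1 : τ.arr aSet i = σ.arr aSet i := by rw [hf.arr _ rfl, hf₁.arr _ rfl]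
    have h2 : τ.arr aCost i = N.c ⟨i, hi⟩ := hτ.cost ⟨i, hi⟩
    rw [sum_lt_succ _ hi, ← hinv]
    simp only [run_ite, run_assign, run_skip, Expr.eval_add', Expr.eval, hx, h1, h2]
    split_ifs <;> simp

theorem Progress.setVar {N : Network (Fin n) (Fin m)} {s : Fin n} {σ τ : State}
    (h : Progress N s σ τ) (x : ℕ) (v : ℤ) : Progress N s σ (τ.setVar x v) :=
  h.trans (.of_eq rfl rfl)

/-- The algorithm does not know the wide set `T`; it enters only through weak duality, as an upper
bound for the cost of the computed flow. -/
theorem relaxPair_spec {N : Network (Fin n) (Fin m)} {s u t : Fin n} {σ : State} (hσ : Ctx N σ)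
    (hc : ∀ e, 0 ≤ N.c e) (hu : σ.var cU = (u : ℕ)) (ht : σ.var cV = (t : ℕ)) :
    Progress N s σ (relaxPair.run σ) ∧
      ∀ C C' T, N.Wide T u t → ∑ e ∈ T, N.c e * N.cap e ≤ C' → Reaches σ u C →
        Reaches (relaxPair.run σ) t (C + C') := by
  have hF := flow_spec hσ hu ht hc
  have hf₁ := frame_run flow σ
  rw [relaxPair, run_seq, run_ite]
  generalize flow.run σ = σ₁ at hF hf₁ ⊢
  have hσ₁ := hσ.frame hf₁ (by decide)
  have h₁ : Progress N s σ σ₁ := .of_eq (hf₁.arr _ (by decide)) (hf₁.arr _ (by decide))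
  have hu₁ : σ₁.var cU = (u : ℕ) := by rw [hf₁.var _ (by decide), hu]
  have ht₁ : σ₁.var cV = (t : ℕ) := by rw [hf₁.var _ (by decide), ht]
  rcases hF with ⟨h0, X, huX, htX, hX⟩ | ⟨h0, p, hT, hex⟩
  · simp only [Expr.eval, h0, run_skip]
    -- A narrow cut of the whole network is narrow for every subset of the arcs, so failure
    -- contradicts wideness.
    refine ⟨h₁, fun C C' T hW => absurd (hW X huX htX) (not_le.2 (hX.trans_le' ?_))⟩
    refine Finset.sum_le_sum_of_subset_of_nonneg (Network.cut_mono (Finset.subset_univ T) X)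
      fun e _ _ => ?_
    unfold Network.cap
    split_ifs <;> omega
  · simp only [Expr.eval, h0, le_refl, if_true, run_seq]
    have hfill := rep_fill hσ₁.numArcs (P := .ite (lit 1) (cell aFlow (rd cU) (rd cE))
      (.store aSet (rd cE) (lit 1)) (.store aSet (rd cE) (lit 0))) (x := cE) rfl aSet 0
      (fun i => if 1 ≤ σ₁.arr aFlow ((u : ℕ) * (m : ℤ) + i) then 1 else 0)
      (fun i τ _ h1 h2 _ => by
        have huτ : τ.var cU = (u : ℕ) := by rw [h1, Function.update_of_ne (by decide), hu₁]
        simp only [run_ite, run_store, cell, Expr.eval_add', Expr.eval, huτ, h1,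
          Function.update_self, h2 aOff (by decide), h2 aFlow (by decide), hσ₁.off, zero_add]
        split_ifs <;> rfl)
    set P₀ : LProg := .rep cE vM (.ite (lit 1) (cell aFlow (rd cU) (rd cE))
      (.store aSet (rd cE) (lit 1)) (.store aSet (rd cE) (lit 0))) with hP₀
    have hf₂ := frame_run P₀ σ₁
    have hst : stored m (P₀.run σ₁) = Finset.univ.filter fun e => 0 < rows n m aFlow σ₁ u e := by
      ext e
      have : ((e : ℕ) : ℤ) < m := by exact_mod_cast e.2
      simp only [stored, hfill, Finset.mem_filter, Finset.mem_univ, true_and, Function.update_self,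
        zero_add, sub_zero, Int.toNat_natCast]
      rw [if_pos (by omega)]
      simp only [rows]
      split_ifs <;> omega
    generalize P₀.run σ₁ = σ₂ at hf₂ hst ⊢
    have hf₃ := frame_run (.seq (.assign vP (rd cU)) (.assign vQ (rd cV))) σ₂
    have hpq : ((LProg.seq (.assign vP (rd cU)) (.assign vQ (rd cV))).run σ₂).var vP = (u : ℕ) ∧
        ((LProg.seq (.assign vP (rd cU)) (.assign vQ (rd cV))).run σ₂).var vQ = (t : ℕ) := by
      simp [hf₂.var cU rfl, hf₂.var cV rfl, hu₁, ht₁]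
    rw [run_seq] at hf₃ hpq
    generalize (LProg.assign vQ (rd cV)).run ((LProg.assign vP (rd cU)).run σ₂) = σ₃
      at hf₃ hpq ⊢
    have hσ₃ := (hσ₁.frame hf₂ (by decide)).frame hf₃ (by decide)
    have h₃ : Progress N s σ σ₃ := h₁.trans
      ((Progress.of_eq (hf₂.arr _ rfl) (hf₂.arr _ rfl)).trans
        (.of_eq (hf₃.arr _ rfl) (hf₃.arr _ rfl)))
    have hst₃ : stored m σ₃ = Finset.univ.filter fun e => 0 < rows n m aFlow σ₁ u e := by
      rw [← hst]; simp only [stored, hf₃.arr aSet rfl]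
    obtain ⟨h4, h5⟩ := relax_spec (s := s) hσ₃ hc hpq.1 hpq.2
      (by rw [hst₃]; exact hT.robust_support hex)
    refine ⟨h₃.trans h4, fun C C' T hW hC' hr => ?_⟩
    have h6 := h5 C (h₃.reaches u C hr)
    -- The flow is integral, hence at least one on its support.
    have h7 : ∑ e ∈ stored m σ₃, N.c e ≤ ∑ e, N.c e * rows n m aFlow σ₁ u e := by
      rw [hst₃, Finset.sum_filter]
      refine Finset.sum_le_sum fun e _ => ?_
      have := hc e
      have := hT.nonneg e
      split_ifs
      · nlinarith
      · positivity
    have h8 := hT.cost_le hc (K := N.k + 1) (by positivity) hex hW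
    refine ⟨h6.1, h6.2.trans ?_⟩
    linarith

theorem relaxArc_spec {N : Network (Fin n) (Fin m)} {s : Fin n} {j : Fin m} {σ : State}
    (hσ : Ctx N σ) (hc : ∀ e, 0 ≤ N.c e) (hj : σ.var cJ = (j : ℕ)) :
    Progress N s σ (relaxArc.run σ) ∧
      (j ∉ N.vul → ∀ C, Reaches σ (N.tail j) C →
        Reaches (relaxArc.run σ) (N.head j) (C + N.c j)) := by
  rw [relaxArc, run_ite]
  simp only [Expr.eval, hj, hσ.vul]
  by_cases hv : j ∈ N.vul
  · simp only [hv, if_true]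
    exact ⟨.of_eq rfl rfl, fun h => absurd trivial h⟩
  simp only [hv, if_false, le_refl, if_true, not_false_eq_true, true_implies, run_seq]
  have hfill := rep_fill hσ.numArcs (P := .store aSet (rd cE) (lit 0)) (x := cE) rfl aSet 0
    (fun _ => 0) (fun i τ _ h1 _ _ => by
      simp only [run_store, Expr.eval, h1, Function.update_self, zero_add])
  have hf := frame_run (.seq (.rep cE vM (.store aSet (rd cE) (lit 0)))
    (.seq (.store aSet (rd cJ) (lit 1)) (.seq (.assign vP (aTail ⟦⟧ rd cJ))
      (.assign vQ (aHead ⟦⟧ rd cJ))))) σ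
  have hpq : ((LProg.seq (.rep cE vM (.store aSet (rd cE) (lit 0)))
    (.seq (.store aSet (rd cJ) (lit 1)) (.seq (.assign vP (aTail ⟦⟧ rd cJ))
      (.assign vQ (aHead ⟦⟧ rd cJ))))).run σ).var vP = (N.tail j : ℕ) ∧
      ((LProg.seq (.rep cE vM (.store aSet (rd cE) (lit 0)))
    (.seq (.store aSet (rd cJ) (lit 1)) (.seq (.assign vP (aTail ⟦⟧ rd cJ))
      (.assign vQ (aHead ⟦⟧ rd cJ))))).run σ).var vQ = (N.head j : ℕ) := by
    simp only [run_seq, hfill]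
    simp [hj, hσ.tail, hσ.head]
  have hst : stored m ((LProg.seq (.rep cE vM (.store aSet (rd cE) (lit 0)))
    (.seq (.store aSet (rd cJ) (lit 1)) (.seq (.assign vP (aTail ⟦⟧ rd cJ))
      (.assign vQ (aHead ⟦⟧ rd cJ))))).run σ) = {j} := by
    simp only [run_seq, hfill]
    ext e
    have : ((e : ℕ) : ℤ) < m := by exact_mod_cast e.2
    have hej : ((e : ℕ) : ℤ) = (j : ℕ) ↔ e = j := by rw [Nat.cast_inj, Fin.ext_iff]
    simp only [stored, run_assign, run_store, State.setVar_arr, State.setArr_arr, if_true,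
      Function.update_self, Expr.eval, Function.update_of_ne (show cJ ≠ cE by decide), hj,
      Finset.mem_filter, Finset.mem_univ, true_and, Finset.mem_singleton, Function.update_apply,
      hej]
    by_cases h : e = j
    · simp [h]
    · simp [h]
  simp only [run_seq] at hf hpq hst
  generalize (LProg.assign vQ (aHead ⟦⟧ rd cJ)).run ((LProg.assign vP (aTail ⟦⟧ rd cJ)).run
    ((LProg.store aSet (rd cJ) (lit 1)).run
      ((LProg.rep cE vM (.store aSet (rd cE) (lit 0))).run σ))) = τ at hf hpq hst ⊢
  have hτ := hσ.frame hf (by decide)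
  have h₁ : Progress N s σ τ := .of_eq (hf.arr _ rfl) (hf.arr _ rfl)
  obtain ⟨h2, h3⟩ := relax_spec (s := s) hτ hc hpq.1 hpq.2
    (by rw [hst]; exact Network.robust_of_safe (Finset.mem_singleton_self j) hv)
  refine ⟨h₁.trans h2, fun C hC => ?_⟩
  have := h3 C (h₁.reaches _ C hC)
  rwa [hst, Finset.sum_singleton] at this

/-- Distances already lowered earlier in the same round may be used. This is harmless, since
`Progress` says that bounds on distances persist. -/
theorem round_spec {N : Network (Fin n) (Fin m)} {s : Fin n} {σ : State} (hσ : Ctx N σ)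
    (hc : ∀ e, 0 ≤ N.c e) :
    Progress N s σ (round.run σ) ∧
      ∀ u v C C', N.Hop u v C' → Reaches σ u C → Reaches (round.run σ) v (C + C') := by
  rw [round, run_seq]
  have h1 := rep_induction (x := cU) (P := .rep cV vN relaxPair) hσ.numVerts (by decide)
    (fun i τ => Progress N s σ τ ∧ ∀ (u t : Fin n) C C' T, (u : ℕ) < i → N.Wide T u t →
      ∑ e ∈ T, N.c e * N.cap e ≤ C' → Reaches σ u C → Reaches τ t (C + C')) ?_ ?_
  · have hf := frame_run (.rep cU vN (.rep cV vN relaxPair)) σ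
    generalize (LProg.rep cU vN (.rep cV vN relaxPair)).run σ = σ₁ at h1 hf ⊢
    have hσ₁ := hσ.frame hf (by decide)
    obtain ⟨hP, h1⟩ := h1
    have h2 := rep_induction (x := cJ) (P := relaxArc) hσ₁.numArcs (by decide)
      (fun i τ => Progress N s σ₁ τ ∧ ∀ (j : Fin m) C, (j : ℕ) < i → j ∉ N.vul →
        Reaches σ₁ (N.tail j) C → Reaches τ (N.head j) (C + N.c j)) ?_ ?_
    · obtain ⟨hP', h2⟩ := h2
      refine ⟨hP.trans hP', ?_⟩
      rintro u v C C' (⟨T, hT, hC'⟩ | ⟨e, he, rfl, rfl, hC'⟩) hu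
      · exact hP'.reaches _ _ (h1 u v C C' T u.2 hT hC' hu)
      · have h3 := h2 e C e.2 he (hP.reaches _ _ hu)
        exact ⟨h3.1, h3.2.trans (by linarith)⟩
    · exact ⟨.of_eq rfl rfl, fun j C h => absurd h (Nat.not_lt_zero _)⟩
    · rintro i τ hi hx hfτ ⟨hQ, hq⟩
      have hτ := hσ₁.frame hfτ (by decide)
      obtain ⟨h3, h4⟩ := relaxArc_spec (s := s) (j := ⟨i, hi⟩) hτ hc hx
      refine ⟨(hQ.trans h3).setVar _ _, fun j C hj hv hr => ?_⟩
      rcases Nat.lt_succ_iff_lt_or_eq.1 hj with hj | hj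
      · exact h3.reaches _ _ (hq j C hj hv hr)
      · obtain rfl : j = ⟨i, hi⟩ := Fin.ext hj
        exact h4 hv C (hQ.reaches _ _ hr)
  · exact ⟨.of_eq rfl rfl, fun u t C C' T h => absurd h (Nat.not_lt_zero _)⟩
  · rintro i τ hi hx hfτ ⟨hQ, hq⟩
    have hτ := hσ.frame hfτ (by decide)
    have h2 := rep_induction (x := cV) (P := relaxPair) hτ.numVerts (by decide)
      (fun l υ => Progress N s τ υ ∧ ∀ (t : Fin n) C C' T, (t : ℕ) < l → N.Wide T ⟨i, hi⟩ t →
        ∑ e ∈ T, N.c e * N.cap e ≤ C' → Reaches τ ⟨i, hi⟩ C → Reaches υ t (C + C')) ?_ ?_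
    · obtain ⟨hP', h2⟩ := h2
      refine ⟨(hQ.trans hP').setVar _ _, fun u t C C' T hui hT hC' hr => ?_⟩
      rcases Nat.lt_succ_iff_lt_or_eq.1 hui with hui | hui
      · exact hP'.reaches _ _ (hq u t C C' T hui hT hC' hr)
      · obtain rfl : u = ⟨i, hi⟩ := Fin.ext hui
        exact h2 t C C' T t.2 hT hC' (hQ.reaches _ _ hr)
    · exact ⟨.of_eq rfl rfl, fun t C C' T h => absurd h (Nat.not_lt_zero _)⟩
    · rintro l υ hl hxl hfυ ⟨hQ', hq'⟩
      have hυ := hτ.frame hfυ (by decide)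
      have huυ : υ.var cU = ((⟨i, hi⟩ : Fin n) : ℕ) := by rw [hfυ.var _ (by decide), hx]
      obtain ⟨h3, h4⟩ := relaxPair_spec (s := s) (t := ⟨l, hl⟩) hυ hc huυ hxl
      refine ⟨(hQ'.trans h3).setVar _ _, fun t C C' T htl hT hC' hr => ?_⟩
      rcases Nat.lt_succ_iff_lt_or_eq.1 htl with htl | htl
      · exact h3.reaches _ _ (hq' t C C' T htl hT hC' hr)
      · obtain rfl : t = ⟨l, hl⟩ := Fin.ext htl
        exact h4 C C' T hT hC' (hQ'.reaches _ _ hr)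

/-- Bellman–Ford: after `i` rounds every chain of at most `i` hops has been accounted for. -/
theorem rounds_spec {N : Network (Fin n) (Fin m)} {s : Fin n} {σ : State} (hσ : Ctx N σ)
    (hc : ∀ e, 0 ≤ N.c e) {r : ℕ} (hr : σ.var vRounds = r) (hV : Valid N s σ)
    (hs : Reaches σ s 0) :
    Valid N s (rounds.run σ) ∧ ∀ v C, N.Chain s r v C → Reaches (rounds.run σ) v C := by
  refine rep_induction (x := cRound) (P := round) hr (by decide)
    (fun i τ => Valid N s τ ∧ ∀ v C, N.Chain s i v C → Reaches τ v C) ?_ ?_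
  · refine ⟨hV, fun v C h => ?_⟩
    cases h
    exact hs
  · rintro i τ hi - hf ⟨h1, h2⟩
    have hτ := hσ.frame hf (by decide)
    obtain ⟨h3, h4⟩ := round_spec (s := s) hτ hc
    refine ⟨h3.valid h1, fun v C h => ?_⟩
    cases h with
    | hop h h' => exact h4 _ _ _ _ h' (h2 _ _ h)
    | stay h => exact h3.reaches _ _ (h2 _ _ h)

/-! ### Reading the input -/

/-- Read the numbers that precede the arcs. -/
def readHeader : LProg :=
  .seq (.assign vN (0 ⟦⟧ lit 0)) <| .seq (.assign vM (0 ⟦⟧ lit 1)) <|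
    .seq (.assign vS (0 ⟦⟧ lit 2)) <| .seq (.assign vT (0 ⟦⟧ lit 3)) <|
      .seq (.ite (0 ⟦⟧ lit 4) (rd vM + lit 1) (.assign vCap (0 ⟦⟧ lit 4))
        (.assign vCap (rd vM + lit 1))) <|
        -- The number `2m + 1` of rounds is the hop bound of `Chain.append_robust`.
        .seq (.assign vVal (rd vCap + lit 1)) (.assign vRounds (rd vM + rd vM + lit 1))

def readArc : LProg :=
  .seq (.store aTail (rd cE) (0 ⟦⟧ rd vPtr)) <|
    .seq (.store aHead (rd cE) (0 ⟦⟧ (rd vPtr + lit 1))) <|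
      .seq (.store aNum (rd cE) (0 ⟦⟧ (rd vPtr + lit 2))) <|
        .seq (.store aDen (rd cE) (0 ⟦⟧ (rd vPtr + lit 3))) <|
          .seq (.store aVul (rd cE) (0 ⟦⟧ (rd vPtr + lit 4))) <|
            .seq (.ite (0 ⟦⟧ (rd vPtr + lit 4)) (lit 0) (.store aCap (rd cE) (rd vCap))
              (.store aCap (rd cE) (lit 1))) (.assign vPtr (rd vPtr + lit 5))

/-- Read the arcs. -/
def readArcs : LProg := .seq (.assign vPtr (lit 5)) (.rep cE vM readArc)

/-- Compute the beginnings of the rows. -/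
def offsets : LProg :=
  .seq (.assign vPtr (lit 0)) <|
    .rep cX vN (.seq (.store aOff (rd cX) (rd vPtr)) (.assign vPtr (rd vPtr + rd vM)))

/-- Add up the lengths of the denominators. -/
def bitsLoop : Prog :=
  .loop (rd cE) (rd vM)
    (.ite (lit 1) (rd vB)
      (.seq (.assign vB (.half (rd vB))) (.assign vBits (rd vBits + lit 1)))
      (.seq (.assign cE (rd cE + lit 1)) (.assign vB (aDen ⟦⟧ rd cE))))

def initBits : LProg := .seq (.assign cE (lit 0)) (.assign vB (aDen ⟦⟧ lit 0))

/-- Multiply `vAcc` by a number of at most `vBits` bits. -/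
def multiply (e : Expr) : LProg :=
  .seq (.assign vB e) <| .seq (.assign vR (lit 0)) <|
    .seq (.rep cX vBits
      (.seq (.assign vH (.half (rd vB))) <|
        .seq (.ite (rd vH + rd vH + lit 1) (rd vB) (.assign vR (rd vR + rd vAcc)) .skip) <|
          .seq (.assign vAcc (rd vAcc + rd vAcc)) (.assign vB (rd vH))))
      (.assign vAcc (rd vR))

/-- Multiply all weights by the product of the denominators. -/
def costs : LProg :=
  .rep cE vM <|
    .seq (.assign vAcc (aNum ⟦⟧ rd cE)) <|
      -- The two opposite comparisons both succeed only for `cJ = cE`, where the factor is omitted.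
      .seq (.rep cJ vM (.ite (rd cJ) (rd cE)
          (.ite (rd cE) (rd cJ) .skip (multiply (aDen ⟦⟧ rd cJ))) (multiply (aDen ⟦⟧ rd cJ))))
        (.store aCost (rd cE) (rd vAcc))

/-- The network of an instance, with all weights multiplied by the product of the denominators. -/
def network (I : FTPInstance) : Network (Fin I.numVerts) (Fin I.numArcs) where
  tail := I.tail
  head := I.head
  vul := I.M
  -- At most `m` arcs can fail, so the truncation does not change feasibility and makes the number
  -- of augmentations polynomial. The bound `m + 1`, unlike `m`, keeps `k` positive when there are
  -- no arcs.
  k := min I.k (I.numArcs + 1)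
  c e := (I.weight e).num * ∏ f, if f ≠ e then ((I.weight f).den : ℤ) else 1

theorem getD_flatMap {α : Type*} {c : ℕ} (f : α → List ℤ) (hf : ∀ a, (f a).length = c) (l : List α)
    (j i : ℕ) (hi : i < c) (hj : j < l.length) :
    (l.flatMap f).getD (c * j + i) 0 = (f l[j]).getD i 0 := by
  induction l generalizing j with
  | nil => simp at hj
  | cons a l ih =>
    rw [List.flatMap_cons]
    cases j with
    | zero => rw [List.getD_append _ _ _ _ (by rw [hf]; omega)]; simp
    | succ j =>
      rw [List.getD_append_right _ _ _ _ (by rw [hf]; nlinarith), hf]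
      have : c * (j + 1) + i - c = c * j + i := by rw [Nat.mul_succ]; omega
      rw [this, ih j (by simpa using hj)]
      simp

theorem initial_arr (l : List ℤ) (i : ℕ) : (initial l).arr 0 i = l.getD i 0 := by
  simp [initial]

theorem initial_arr_arc (I : FTPInstance) (e : Fin I.numArcs) (i : ℕ) (hi : i < 5) :
    (initial I.encode).arr 0 (5 + 5 * (e : ℕ) + (i : ℕ)) =
      [((I.tail e).val : ℤ), ((I.head e).val : ℤ), ((I.weight e).num : ℤ),
        ((I.weight e).den : ℤ), if e ∈ I.M then 1 else 0].getD i 0 := by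
  have h1 : (5 + 5 * ((e : ℕ) : ℤ) + (i : ℕ)) = ((5 + (5 * (e : ℕ) + i) : ℕ) : ℤ) := by
    push_cast; ring
  rw [h1, initial_arr, FTPInstance.encode, List.getD_append_right _ _ _ _ (by simp)]
  have h2 : 5 + (5 * (e : ℕ) + i) - [(I.numVerts : ℤ), (I.numArcs : ℤ), (I.s.val : ℤ),
      (I.t.val : ℤ), (I.k : ℤ)].length = 5 * e + i := by simp
  rw [h2, getD_flatMap _ (by simp) _ _ _ hi (by simp)]
  simp

/-- The header has been read. -/
structure Header (I : FTPInstance) (σ : State) : Prop where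
  numVerts : σ.var vN = I.numVerts
  numArcs : σ.var vM = I.numArcs
  s : σ.var vS = (I.s : ℕ)
  t : σ.var vT = (I.t : ℕ)
  cap : σ.var vCap = ((network I).k : ℕ)
  val : σ.var vVal = (network I).k + 1
  rounds : σ.var vRounds = (2 * I.numArcs + 1 : ℕ)

theorem header_readHeader (I : FTPInstance) : Header I (readHeader.run (initial I.encode)) := by
  have h0 : (initial I.encode).arr 0 0 = I.numVerts := initial_arr I.encode 0
  have h1 : (initial I.encode).arr 0 1 = I.numArcs := initial_arr I.encode 1
  have h2 : (initial I.encode).arr 0 2 = (I.s : ℕ) := initial_arr I.encode 2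
  have h3 : (initial I.encode).arr 0 3 = (I.t : ℕ) := initial_arr I.encode 3
  have h4 : (initial I.encode).arr 0 4 = I.k := initial_arr I.encode 4
  by_cases hk : (I.k : ℤ) ≤ I.numArcs + 1
  · have hk' : I.k ≤ I.numArcs + 1 := by exact_mod_cast hk
    constructor <;> simp [readHeader, h0, h1, h2, h3, h4, hk, network, hk']; ring
  · have hk' : I.numArcs + 1 ≤ I.k := by omega
    constructor <;> simp [readHeader, h0, h1, h2, h3, h4, hk, network, hk']; ring

theorem Header.frame {I : FTPInstance} {σ τ : State} (h : Header I σ) {P : LProg}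
    (hf : Frame P σ τ) (hP : keeps P [vN, vM, vS, vT, vCap, vVal, vRounds] []) : Header I τ := by
  simp only [keeps, Bool.and_eq_true, List.all_eq_true, Bool.not_eq_true'] at hP
  have hv := fun x hx => hf.var x (hP.1 x hx)
  simp only [List.forall_mem_cons] at hv
  obtain ⟨h1, h2, h3, h4, h5, h6, h7, -⟩ := hv
  exact ⟨h1 ▸ h.numVerts, h2 ▸ h.numArcs, h3 ▸ h.s, h4 ▸ h.t, h5 ▸ h.cap, h6 ▸ h.val,
    h7 ▸ h.rounds⟩

/-- The arcs before `i` have been read. -/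
structure Arcs (I : FTPInstance) (i : ℕ) (σ : State) : Prop where
  tail : ∀ e : Fin I.numArcs, (e : ℕ) < i → σ.arr aTail (e : ℕ) = (I.tail e : ℕ)
  head : ∀ e : Fin I.numArcs, (e : ℕ) < i → σ.arr aHead (e : ℕ) = (I.head e : ℕ)
  num : ∀ e : Fin I.numArcs, (e : ℕ) < i → σ.arr aNum (e : ℕ) = (I.weight e).num
  den : ∀ e : Fin I.numArcs, (e : ℕ) < i → σ.arr aDen (e : ℕ) = (I.weight e).den
  vul : ∀ e : Fin I.numArcs, (e : ℕ) < i → σ.arr aVul (e : ℕ) = if e ∈ I.M then 1 else 0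
  cap : ∀ e : Fin I.numArcs, (e : ℕ) < i → σ.arr aCap (e : ℕ) = (network I).cap e
  -- A sentinel: `bitsLoop` reads one cell beyond the last denominator.
  den_end : σ.arr aDen I.numArcs = 0

theorem arcs_readArcs {I : FTPInstance} {σ : State} (h : Header I σ)
    (h0 : σ.arr 0 = (initial I.encode).arr 0) (hden : σ.arr aDen I.numArcs = 0) :
    Arcs I I.numArcs (readArcs.run σ) := by
  rw [readArcs, run_seq]
  have hf₁ := frame_run (.assign vPtr (lit 5)) σ
  have hp₁ : ((LProg.assign vPtr (lit 5)).run σ).var vPtr = 5 := by simp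
  generalize (LProg.assign vPtr (lit 5)).run σ = σ₁ at hf₁ hp₁ ⊢
  have hσ₁ := h.frame hf₁ (by decide)
  refine (rep_induction (x := cE) (P := readArc) hσ₁.numArcs (by decide)
    (fun i τ => τ.var vPtr = 5 + 5 * (i : ℕ) ∧ Arcs I i τ) ?_ ?_).2
  · exact ⟨by simp [hp₁], fun e h => absurd h (Nat.not_lt_zero _),
      fun e h => absurd h (Nat.not_lt_zero _), fun e h => absurd h (Nat.not_lt_zero _),
      fun e h => absurd h (Nat.not_lt_zero _), fun e h => absurd h (Nat.not_lt_zero _),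
      fun e h => absurd h (Nat.not_lt_zero _), by simpa [hf₁.arr _ rfl] using hden⟩
  · rintro i τ hi hx hf ⟨hp, hA⟩
    have hτ := hσ₁.frame hf (by decide)
    have hin : ∀ j : ℕ, j < 5 → τ.arr 0 (5 + 5 * (i : ℕ) + (j : ℕ)) =
        [((I.tail ⟨i, hi⟩).val : ℤ), ((I.head ⟨i, hi⟩).val : ℤ), ((I.weight ⟨i, hi⟩).num : ℤ),
          ((I.weight ⟨i, hi⟩).den : ℤ), if ⟨i, hi⟩ ∈ I.M then 1 else 0].getD j 0 := fun j hj => by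
      rw [hf.arr _ (by decide), hf₁.arr _ (by decide), h0]
      exact initial_arr_arc I ⟨i, hi⟩ j hj
    have i0 := hin 0 (by norm_num)
    have i1 := hin 1 (by norm_num)
    have i2 := hin 2 (by norm_num)
    have i3 := hin 3 (by norm_num)
    have i4 := hin 4 (by norm_num)
    simp only [List.getD_cons_zero, List.getD_cons_succ, Nat.cast_zero, add_zero, Nat.cast_one,
      Nat.cast_ofNat] at i0 i1 i2 i3 i4
    have hcap : (network I).cap ⟨i, hi⟩ = if ⟨i, hi⟩ ∈ I.M then 1 else ((network I).k : ℤ) := rfl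
    have hne : (I.numArcs : ℤ) ≠ i := by omega
    have hcase : ∀ e : Fin I.numArcs, (e : ℕ) < i + 1 → e = ⟨i, hi⟩ ∨
        (e : ℕ) < i ∧ ((e : ℕ) : ℤ) ≠ i := fun e he => by
      rcases Nat.lt_succ_iff_lt_or_eq.1 he with he | he
      · exact Or.inr ⟨he, by omega⟩
      · exact Or.inl (Fin.ext he)
    by_cases hM : (⟨i, hi⟩ : Fin I.numArcs) ∈ I.M
    all_goals
      simp only [hM, if_true, if_false] at i4 hcap
      refine ⟨?_, fun e he => ?_, fun e he => ?_, fun e he => ?_, fun e he => ?_, fun e he => ?_,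
        fun e he => ?_, ?_⟩
      · simp [readArc, hx, hp, i4]
        ring
      · rcases hcase e he with rfl | ⟨he, hne⟩
        · simp [readArc, hx, hp, i0, i4]
        · simpa [readArc, hx, hp, i4, hne] using hA.tail e he
      · rcases hcase e he with rfl | ⟨he, hne⟩
        · simp [readArc, hx, hp, i1, i4]
        · simpa [readArc, hx, hp, i4, hne] using hA.head e he
      · rcases hcase e he with rfl | ⟨he, hne⟩
        · simp [readArc, hx, hp, i2, i4]
        · simpa [readArc, hx, hp, i4, hne] using hA.num e he
      · rcases hcase e he with rfl | ⟨he, hne⟩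
        · simp [readArc, hx, hp, i3, i4]
        · simpa [readArc, hx, hp, i4, hne] using hA.den e he
      · rcases hcase e he with rfl | ⟨he, hne⟩
        · simp [readArc, hx, hp, i4, hM]
        · simpa [readArc, hx, hp, i4, hne] using hA.vul e he
      · rcases hcase e he with rfl | ⟨he, hne⟩
        · simp [readArc, hx, hp, i4, hcap, hτ.cap]
        · simpa [readArc, hx, hp, i4, hne] using hA.cap e he
      · simpa [readArc, hx, hp, i4, hne] using hA.den_end

theorem arr_offsets {I : FTPInstance} {σ : State} (h : Header I σ) (x : Fin I.numVerts) :
    (offsets.run σ).arr aOff (x : ℕ) = (x : ℕ) * (I.numArcs : ℤ) := by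
  rw [offsets, run_seq]
  have hf₁ := frame_run (.assign vPtr (lit 0)) σ
  have hp₁ : ((LProg.assign vPtr (lit 0)).run σ).var vPtr = 0 := by simp
  generalize (LProg.assign vPtr (lit 0)).run σ = σ₁ at hf₁ hp₁ ⊢
  have hσ₁ := h.frame hf₁ (by decide)
  refine (rep_induction (x := cX)
    (P := .seq (.store aOff (rd cX) (rd vPtr)) (.assign vPtr (rd vPtr + rd vM)))
    hσ₁.numVerts (by decide) (fun i τ => τ.var vPtr = (i : ℕ) * (I.numArcs : ℤ) ∧
      ∀ x : Fin I.numVerts, (x : ℕ) < i → τ.arr aOff (x : ℕ) = (x : ℕ) * (I.numArcs : ℤ))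
    ?_ ?_).2 x x.2
  · exact ⟨by simp [hp₁], fun x h => absurd h (Nat.not_lt_zero _)⟩
  · rintro i τ hi hx hf ⟨hp, hA⟩
    have hτ := hσ₁.frame hf (by decide)
    refine ⟨?_, fun x hxi => ?_⟩
    · simp [hp, hτ.numArcs]
      ring
    · rcases Nat.lt_succ_iff_lt_or_eq.1 hxi with hxi | hxi
      · have : ((x : ℕ) : ℤ) ≠ i := by omega
        simpa [hx, this] using hA x hxi
      · simp [hx, hp, hxi]

/-! ### Binary lengths and multiplication without a multiplication instruction -/

theorem size_half {b : ℕ} (hb : 1 ≤ b) : Nat.size b = Nat.size (b / 2) + 1 := by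
  have h := Nat.bit_bodd_div2 b
  have h2 := Nat.size_bit (b := b.bodd) (n := b.div2) (by rw [h]; omega)
  rw [h, Nat.div2_val] at h2
  exact h2

/-- The first loop adds up the lengths of the denominators. -/
theorem exec_bitsLoop (D : ℕ → ℕ) (M : ℕ) (w : ℕ) : ∀ (i b : ℕ) (τ : State), i ≤ M →
    τ.var cE = i → τ.var vM = M → τ.var vB = b → (∀ j ≤ M, τ.arr aDen j = D j) →
    (i = M → b = 0) → D M = 0 →
    -- This measure drops by one per iteration: either a bit of the current denominator is removed,
    -- or the next denominator is loaded. An iteration takes 13 steps, so 20 is generous; the final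
    -- test takes 3.
    M - i + Nat.size b + ∑ j ∈ Finset.Ico (i + 1) (M + 1), Nat.size (D j) = w →
    ∃ n υ, Exec bitsLoop τ n υ ∧ n ≤ 3 + 20 * w ∧ υ.arr = τ.arr ∧
      (∀ y, y ≠ cE → y ≠ vB → y ≠ vBits → υ.var y = τ.var y) ∧
      υ.var vBits = τ.var vBits +
        (Nat.size b + ∑ j ∈ Finset.Ico (i + 1) (M + 1), Nat.size (D j) : ℕ) := by
  induction w with
  | zero =>
    intro i b τ hi hE hM hB hD h0 hDM hw
    have : i = M := by omega
    subst this
    refine ⟨_, τ, .loop_false ?_, by simp [Expr.time], rfl, fun _ _ _ _ => rfl, ?_⟩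
    · simp [hE, hM]
    · rw [h0 rfl]; simp
  | succ w ih =>
    intro i b τ hi hE hM hB hD h0 hDM hw
    rcases hi.eq_or_lt with rfl | hi
    · rw [h0 rfl] at hw
      simp at hw
    rcases Nat.eq_zero_or_pos b with rfl | hb
    · set τ' : State := (τ.setVar cE (i + 1 : ℕ)).setVar vB (D (i + 1)) with hτ'
      have hstep : Exec (.ite (lit 1) (rd vB)
          (.seq (.assign vB (.half (rd vB))) (.assign vBits (rd vBits + lit 1)))
          (.seq (.assign cE (rd cE + lit 1)) (.assign vB (aDen ⟦⟧ rd cE)))) τ 10 τ' := by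
        have h1 := Exec.assign cE (rd cE + lit 1) τ
        have h2 := Exec.assign vB (aDen ⟦⟧ rd cE) (τ.setVar cE ((rd cE + lit 1).eval τ))
        have h3 : ((aDen ⟦⟧ rd cE).eval (τ.setVar cE ((rd cE + lit 1).eval τ))) = D (i + 1) := by
          have := hD (i + 1) hi
          push_cast at this
          simpa [hE] using this
        have h4 : (rd cE + lit 1).eval τ = (i + 1 : ℕ) := by simp [hE]
        rw [h3, h4] at h2
        rw [h4] at h1
        exact Exec.ite_false (by simp [hB]) (h1.seq h2)
      rw [Finset.sum_eq_sum_Ico_succ_bot (by omega)] at hw ⊢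
      obtain ⟨n, υ, hυ, hn, h1, h2, h3⟩ := ih (i + 1) (D (i + 1)) τ' hi (by simp [hτ'])
        (by simp [hτ', hM]) (by simp [hτ']) (by simpa [hτ'] using hD)
        (fun h => by rw [h]; exact hDM) hDM (by simp at hw; omega)
      refine ⟨_, υ, .loop_true (by simp [hE, hM]; exact_mod_cast hi) hstep hυ, ?_, ?_, ?_, ?_⟩
      · simp only [Expr.time]; omega
      · rw [h1]; rfl
      · intro y hy1 hy2 hy3
        rw [h2 y hy1 hy2 hy3]
        simp [hτ', hy1, hy2]
      · rw [h3]
        simp [hτ']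
    · set τ' : State := (τ.setVar vB (b / 2 : ℕ)).setVar vBits (τ.var vBits + 1) with hτ'
      have hstep : Exec (.ite (lit 1) (rd vB)
          (.seq (.assign vB (.half (rd vB))) (.assign vBits (rd vBits + lit 1)))
          (.seq (.assign cE (rd cE + lit 1)) (.assign vB (aDen ⟦⟧ rd cE)))) τ 10 τ' := by
        have h1 := Exec.assign vB (.half (rd vB)) τ
        have h2 := Exec.assign vBits (rd vBits + lit 1)
          (τ.setVar vB ((Expr.half (rd vB)).eval τ))
        have h3 : (rd vBits + lit 1).eval (τ.setVar vB ((Expr.half (rd vB)).eval τ)) =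
          τ.var vBits + 1 := by simp
        have h4 : (Expr.half (rd vB)).eval τ = (b / 2 : ℕ) := by simp [hB]
        rw [h3, h4] at h2
        rw [h4] at h1
        exact Exec.ite_true (by simp [hB]; exact_mod_cast hb) (h1.seq h2)
      have hsz := size_half hb
      obtain ⟨n, υ, hυ, hn, h1, h2, h3⟩ := ih i (b / 2) τ' hi.le (by simp [hτ', hE])
        (by simp [hτ', hM]) (by simp [hτ']) (by simpa [hτ'] using hD)
        (fun h => by omega) hDM (by omega)
      refine ⟨_, υ, .loop_true (by simp [hE, hM]; exact_mod_cast hi) hstep hυ, ?_, ?_, ?_, ?_⟩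
      · simp only [Expr.time]; omega
      · rw [h1]; rfl
      · intro y hy1 hy2 hy3
        rw [h2 y hy1 hy2 hy3]
        simp [hτ', hy3, hy2]
      · rw [h3]
        simp only [hτ', State.setVar_var, if_true, hsz]
        push_cast
        ring

/-- Halving `vB` and doubling `vAcc`, with the odd bit moved into `vR`, preserves `vR + vAcc * vB`.
After at least `Nat.size b` rounds `vB` is zero and `vR` is the product. Surplus rounds do no harm,
so one common `L` serves all denominators. -/
theorem multiply_spec {σ : State} {e : Expr} {L b : ℕ} (hL : σ.var vBits = L)
    (he : e.eval σ = b) (hb : Nat.size b ≤ L) :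
    ((multiply e).run σ).var vAcc = σ.var vAcc * b := by
  rw [multiply, run_seq, run_seq, run_seq]
  have h1 : ((LProg.assign vR (lit 0)).run ((LProg.assign vB e).run σ)).var vBits = L := by
    simp [hL]
  have key := rep_induction (x := cX)
    (P := .seq (.assign vH (.half (rd vB))) <|
        .seq (.ite (rd vH + rd vH + lit 1) (rd vB) (.assign vR (rd vR + rd vAcc)) .skip) <|
          .seq (.assign vAcc (rd vAcc + rd vAcc)) (.assign vB (rd vH)))
    h1 (by decide) (fun i τ => τ.var vR + τ.var vAcc * τ.var vB = σ.var vAcc * b ∧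
      0 ≤ τ.var vB ∧ τ.var vB * 2 ^ i ≤ b) ?_ ?_
  · obtain ⟨h2, h3, h4⟩ := key
    generalize LProg.run _ ((LProg.assign vR (lit 0)).run ((LProg.assign vB e).run σ)) = τ
      at h2 h3 h4 ⊢
    have h5 : (b : ℤ) < 2 ^ L := by exact_mod_cast Nat.size_le.1 hb
    have h6 : τ.var vB = 0 := by
      by_contra hne
      have : (1 : ℤ) ≤ τ.var vB := by omega
      have : (0 : ℤ) < 2 ^ L := by positivity
      nlinarith
    rw [h6, mul_zero, add_zero] at h2
    simpa using h2
  · simp [he]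
  · rintro i τ hi - - ⟨h2, h3, h4⟩
    have h5 := Int.mul_ediv_add_emod (τ.var vB) 2
    have h6 : τ.var vB % 2 = 0 ∨ τ.var vB % 2 = 1 := Int.emod_two_eq_zero_or_one _
    have hpow : (0 : ℤ) < 2 ^ i := by positivity
    have h7 : τ.var vB / 2 * 2 ^ (i + 1) ≤ b := by
      have : τ.var vB / 2 * 2 ≤ τ.var vB := by omega
      calc τ.var vB / 2 * 2 ^ (i + 1) = τ.var vB / 2 * 2 * 2 ^ i := by ring
        _ ≤ τ.var vB * 2 ^ i := mul_le_mul_of_nonneg_right this hpow.le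
        _ ≤ b := h4
    have h8 : (if τ.var vB / 2 + τ.var vB / 2 + 1 ≤ τ.var vB then τ.var vR + τ.var vAcc
        else τ.var vR) + (τ.var vAcc + τ.var vAcc) * (τ.var vB / 2) = σ.var vAcc * b := by
      rw [← h2]
      conv_rhs => rw [← h5]
      rcases h6 with h6 | h6
      · rw [if_neg (by omega), h6]; ring
      · rw [if_pos (by omega), h6]; ring
    refine ⟨?_, ?_, ?_⟩
    · rw [← h8]
      by_cases hh : τ.var vB / 2 + τ.var vB / 2 + 1 ≤ τ.var vB <;> simp [hh]
    · by_cases hh : τ.var vB / 2 + τ.var vB / 2 + 1 ≤ τ.var vB <;> simp [hh] <;> omega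
    · by_cases hh : τ.var vB / 2 + τ.var vB / 2 + 1 ≤ τ.var vB <;> simpa [hh] using h7

theorem prod_lt_succ {m : ℕ} (g : Fin m → ℤ) {i : ℕ} (hi : i < m) :
    ∏ e : Fin m, (if (e : ℕ) < i + 1 then g e else 1) =
      (∏ e : Fin m, if (e : ℕ) < i then g e else 1) * g ⟨i, hi⟩ := by
  have : g ⟨i, hi⟩ = ∏ e : Fin m, if e = ⟨i, hi⟩ then g e else 1 := by simp
  rw [this, ← Finset.prod_mul_distrib]
  refine Finset.prod_congr rfl fun e _ => ?_
  simp only [Fin.ext_iff]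
  by_cases h1 : (e : ℕ) < i
  · rw [if_pos (by omega), if_pos h1, if_neg (by omega), mul_one]
  · by_cases h2 : (e : ℕ) = i
    · rw [if_pos (by omega), if_neg h1, if_pos h2, one_mul]
    · rw [if_neg (by omega), if_neg h1, if_neg h2, mul_one]

theorem arr_costs {I : FTPInstance} {σ : State} (h : Header I σ) (hA : Arcs I I.numArcs σ) {L : ℕ}
    (hL : σ.var vBits = L) (hs : ∀ e, Nat.size (I.weight e).den ≤ L) (e : Fin I.numArcs) :
    (costs.run σ).arr aCost (e : ℕ) = (network I).c e := by
  refine rep_induction (x := cE) h.numArcs (by decide) (fun i τ => ∀ e : Fin I.numArcs,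
    (e : ℕ) < i → τ.arr aCost (e : ℕ) = (network I).c e) ?_ ?_ e e.2
  · exact fun e h => absurd h (Nat.not_lt_zero _)
  · rintro i τ hi hx hf hc
    have hτ := h.frame hf (by decide)
    rw [run_seq, run_seq]
    have hf₁ := frame_run (.assign vAcc (aNum ⟦⟧ rd cE)) τ
    have ha₁ : ((LProg.assign vAcc (aNum ⟦⟧ rd cE)).run τ).var vAcc =
        (I.weight ⟨i, hi⟩).num := by
      simp only [run_assign, State.setVar_var, if_true, Expr.eval, hx, hf.arr aNum (by decide)]
      exact hA.num ⟨i, hi⟩ hi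
    generalize (LProg.assign vAcc (aNum ⟦⟧ rd cE)).run τ = τ₁ at hf₁ ha₁ ⊢
    have hτ₁ := hτ.frame hf₁ (by decide)
    have key := rep_induction (x := cJ) (P := .ite (rd cJ) (rd cE)
          (.ite (rd cE) (rd cJ) .skip (multiply (aDen ⟦⟧ rd cJ))) (multiply (aDen ⟦⟧ rd cJ)))
      hτ₁.numArcs (by decide) (fun j υ => υ.var vAcc = (I.weight ⟨i, hi⟩).num *
        ∏ f : Fin I.numArcs, if (f : ℕ) < j then
          (if f ≠ ⟨i, hi⟩ then ((I.weight f).den : ℤ) else 1) else 1) ?_ ?_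
    · set P₀ : LProg := .rep cJ vM (.ite (rd cJ) (rd cE)
          (.ite (rd cE) (rd cJ) .skip (multiply (aDen ⟦⟧ rd cJ))) (multiply (aDen ⟦⟧ rd cJ)))
        with hP₀
      have hf₂ := frame_run P₀ τ₁
      generalize P₀.run τ₁ = τ₂ at key hf₂ ⊢
      intro e he
      have hE : τ₂.var cE = i := by rw [hf₂.var _ (by decide), hf₁.var _ (by decide), hx]
      rcases Nat.lt_succ_iff_lt_or_eq.1 he with he | he
      · have hne : ((e : ℕ) : ℤ) ≠ i := by omega
        simpa [hE, hne, hf₂.arr aCost (by decide), hf₁.arr aCost (by decide)] using hc e he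
      · obtain rfl : e = ⟨i, hi⟩ := Fin.ext he
        have hprod : (∏ f : Fin I.numArcs, if (f : ℕ) < I.numArcs then
            (if f ≠ ⟨i, hi⟩ then ((I.weight f).den : ℤ) else 1) else 1) =
            ∏ f : Fin I.numArcs, if f ≠ ⟨i, hi⟩ then ((I.weight f).den : ℤ) else 1 :=
          Finset.prod_congr rfl fun f _ => if_pos f.2
        simp only [run_store, State.setVar_arr, State.setArr_arr, if_true, Expr.eval, hE,
          Function.update_self, key, hprod]
        rfl
    · simp [ha₁]
    · intro j υ hj hxj hfυ hinv
      have hE : υ.var cE = i := by rw [hfυ.var _ (by decide), hf₁.var _ (by decide), hx]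
      have hbits : υ.var vBits = L := by
        rw [hfυ.var _ (by decide), hf₁.var _ (by decide), hf.var _ (by decide), hL]
      have hden : (aDen ⟦⟧ rd cJ).eval υ = (I.weight ⟨j, hj⟩).den := by
        simp only [Expr.eval, hxj]
        rw [hfυ.arr _ (by decide), hf₁.arr _ (by decide), hf.arr _ (by decide)]
        exact hA.den ⟨j, hj⟩ hj
      rw [prod_lt_succ _ hj, ← mul_assoc, ← hinv]
      by_cases hji : j = i
      · subst hji
        simp [hxj, hE]
      · have hmul := multiply_spec hbits hden (hs _)
        have hne : (⟨j, hj⟩ : Fin I.numArcs) ≠ ⟨i, hi⟩ := fun hh => hji (Fin.ext_iff.1 hh)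
        have hji' : (j : ℤ) ≠ i := by exact_mod_cast hji
        simp only [if_pos hne]
        rw [← hmul]
        simp only [run_ite, run_skip, Expr.eval, hxj, hE]
        split_ifs
        · omega
        · simp
        · simp

/-- Write the answer. -/
def output : LProg :=
  .ite (lit 1) (aDist ⟦⟧ rd vT)
    (.seq (.store 1 (lit 0) (lit 1)) <|
      .seq (.rep cE vM (.ite (lit 1) (cell aSol (rd vT) (rd cE)) (.store 1 (lit 1 + rd cE) (lit 1))
        (.store 1 (lit 1 + rd cE) (lit 0)))) <|
        .assign 1 (rd vM + lit 1))
    (.seq (.store 1 (lit 0) (lit 0)) (.assign 1 (lit 1)))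

def readInput : LProg := .seq readArcs (.seq offsets initBits)

def solve : LProg :=
  .seq costs <| .seq (.store aDist (rd vS) (lit 1)) <| .seq rounds output

def program : Prog :=
  .seq readHeader.compile <| .seq readInput.compile <| .seq bitsLoop solve.compile

theorem output_spec {I : FTPInstance} {σ : State} (h : Header I σ) (hσ : Ctx (network I) σ) :
    (output.run σ).HasOutput (I.encodeAnswer (if 1 ≤ σ.arr aDist (I.t : ℕ) then
      some (solution I.numVerts I.numArcs σ I.t) else none)) := by
  rw [output, run_ite]
  simp only [Expr.eval, h.t]
  split_ifs with hd
  · simp only [run_seq, run_store, Expr.eval]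
    have hfill := rep_fill (σ := σ.setArr 1 0 1) (n := I.numArcs) (x := cE) (N := vM)
      (P := .ite (lit 1) (cell aSol (rd vT) (rd cE)) (.store 1 (lit 1 + rd cE) (lit 1))
        (.store 1 (lit 1 + rd cE) (lit 0))) h.numArcs rfl 1 1
      (fun i => if 1 ≤ σ.arr aSol ((I.t : ℕ) * (I.numArcs : ℤ) + i) then 1 else 0)
      (fun i τ _ h1 h2 _ => by
        have htτ : τ.var vT = (I.t : ℕ) := by
          rw [h1, Function.update_of_ne (by decide), State.setArr_var, h.t]
        simp only [run_ite, run_store, cell, Expr.eval_add', Expr.eval, htτ, h1,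
          Function.update_self, h2 aOff (by decide), h2 aSol (by decide)]
        simp only [State.setArr_arr, show aOff ≠ 1 by decide, show aSol ≠ 1 by decide, if_false,
          hσ.off]
        split_ifs <;> rfl)
    rw [hfill]
    refine ⟨?_, ?_⟩
    · simp [FTPInstance.encodeAnswer, h.numArcs]
    · rintro ⟨i, hi⟩
      cases i with
      | zero => simp [FTPInstance.encodeAnswer]
      | succ i =>
        have hi' : i < I.numArcs := by simpa [FTPInstance.encodeAnswer] using hi
        have h1 : (1 : ℤ) ≤ ((i + 1 : ℕ) : ℤ) ∧ ((i + 1 : ℕ) : ℤ) < 1 + I.numArcs := by omega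
        have h2 : (((i + 1 : ℕ) : ℤ) - 1).toNat = i := by omega
        have h3 : ⟨i, hi'⟩ ∈ solution I.numVerts I.numArcs σ I.t ↔
            1 ≤ σ.arr aSol ((I.t : ℕ) * (I.numArcs : ℤ) + i) := by
          rw [solution, Finset.mem_filter]
          simp [rows]
        simp only [FTPInstance.encodeAnswer, run_assign, State.setVar_arr, Function.update_self,
          if_pos h1, h2, List.get_eq_getElem, List.getElem_cons_succ, List.getElem_map,
          List.getElem_finRange]
        exact if_congr h3.symm rfl rfl
  · refine ⟨by simp [FTPInstance.encodeAnswer], ?_⟩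
    rintro ⟨i, hi⟩
    obtain rfl : i = 0 := by simpa [FTPInstance.encodeAnswer] using hi
    simp [FTPInstance.encodeAnswer]

/-! ### Feasibility and robustness -/

theorem exists_isPath_of_mem {I : FTPInstance} {v : Fin I.numVerts} {x : Fin I.numVerts}
    (p : List (Fin I.numArcs)) : ∀ u, I.IsPath u p v → x ∈ u :: p.map I.head →
      ∃ q, I.IsPath x q v ∧ ∀ e ∈ q, e ∈ p := by
  induction p with
  | nil =>
    intro u hp hx
    obtain rfl : x = u := by simpa using hx
    exact ⟨[], hp, by simp⟩
  | cons f p ih =>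
    intro u hp hx
    rcases List.mem_cons.1 hx with rfl | hx
    · exact ⟨_, hp, fun _ h => h⟩
    · obtain ⟨q, hq, hqp⟩ := ih (I.head f) ⟨hp.1.2, (List.nodup_cons.1 hp.2).2⟩ hx
      exact ⟨q, hq, fun e he => List.mem_cons_of_mem _ (hqp e he)⟩

/-- If the first vertex recurs on the path obtained for the rest, the suffix starting at that
recurrence is used instead. -/
theorem exists_isPath_of_isWalk {I : FTPInstance} {v : Fin I.numVerts}
    (p : List (Fin I.numArcs)) : ∀ u, I.IsWalk u p v → ∃ q, I.IsPath u q v ∧ ∀ e ∈ q, e ∈ p := by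
  induction p with
  | nil => exact fun u hp => ⟨[], ⟨hp, by simp⟩, by simp⟩
  | cons f p ih =>
    rintro u ⟨hf, hp⟩
    obtain ⟨q, hq, hqp⟩ := ih _ hp
    by_cases hu : u ∈ I.head f :: q.map I.head
    · obtain ⟨q', hq', hqq⟩ := exists_isPath_of_mem q _ hq hu
      exact ⟨q', hq', fun e he => List.mem_cons_of_mem _ (hqp e (hqq e he))⟩
    · refine ⟨f :: q, ⟨⟨hf, hq.1⟩, List.nodup_cons.2 ⟨hu, hq.2⟩⟩, fun e he => ?_⟩
      rcases List.mem_cons.1 he with rfl | he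
      · exact List.mem_cons_self
      · exact List.mem_cons_of_mem _ (hqp e he)

theorem isWalk_append {I : FTPInstance} {v : Fin I.numVerts} {e : Fin I.numArcs}
    (p : List (Fin I.numArcs)) (he : I.tail e = v) :
    ∀ u, I.IsWalk u p v → I.IsWalk u (p ++ [e]) (I.head e) := by
  induction p with
  | nil => exact fun u hp => ⟨he.trans hp.symm, rfl⟩
  | cons f p ih => exact fun u hp => ⟨hp.1, ih _ hp.2⟩

theorem exists_crossing {I : FTPInstance} {X : Finset (Fin I.numVerts)} {v : Fin I.numVerts}
    (hv : v ∉ X) (p : List (Fin I.numArcs)) : ∀ u ∈ X, I.IsWalk u p v →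
      ∃ e ∈ p, I.tail e ∈ X ∧ I.head e ∉ X := by
  induction p with
  | nil => exact fun u hu hp => absurd (hp ▸ hu) hv
  | cons f p ih =>
    rintro u hu ⟨hf, hp⟩
    by_cases h : I.head f ∈ X
    · obtain ⟨e, he, h'⟩ := ih _ h hp
      exact ⟨e, List.mem_cons_of_mem _ he, h'⟩
    · exact ⟨f, List.mem_cons_self, hf ▸ hu, h⟩

/-- A cut without safe arcs and with at most `k` arcs is itself an admissible failure set, but any
path avoiding it would have to cross it. -/
theorem robust_of_feasible {I : FTPInstance} {T : Finset (Fin I.numArcs)} (h : I.Feasible T) :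
    (network I).Robust T I.s I.t := by
  intro X hs ht
  by_contra hcon
  simp only [not_or, not_exists, not_and, not_not, not_lt] at hcon
  obtain ⟨h1, h2⟩ := hcon
  obtain ⟨p, hp, hpT⟩ := h ((network I).cut T X) h1 (h2.trans (min_le_left _ _))
  obtain ⟨e, he, h3⟩ := exists_crossing ht p _ hs hp.1
  obtain ⟨h4, h5⟩ := Finset.mem_sdiff.1 (hpT e he)
  exact h5 (Network.mem_cut.2 ⟨h4, h3⟩)

-- For a failure set `F`, the set of vertices reachable in `S \ F` has all its outgoing arcs of `S`
-- in `F`. If it missed `t`, this cut would violate robustness.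
open Classical in
theorem feasible_of_robust {I : FTPInstance} {S : Finset (Fin I.numArcs)}
    (h : (network I).Robust S I.s I.t) : I.Feasible S := by
  intro F hFM hFk
  let X : Finset (Fin I.numVerts) :=
    Finset.univ.filter fun x => ∃ p, I.IsWalk I.s p x ∧ ∀ e ∈ p, e ∈ S \ F
  have hX : ∀ x, x ∈ X ↔ ∃ p, I.IsWalk I.s p x ∧ ∀ e ∈ p, e ∈ S \ F := fun x => by simp [X]
  by_cases ht : I.t ∈ X
  · obtain ⟨p, hp, hpS⟩ := (hX _).1 ht
    obtain ⟨q, hq, hqp⟩ := exists_isPath_of_isWalk p _ hp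
    exact ⟨q, hq, fun e he => hpS e (hqp e he)⟩
  · exfalso
    have hcut : (network I).cut S X ⊆ F := by
      intro e he
      obtain ⟨h1, h2, h3⟩ := Network.mem_cut.1 he
      by_contra hF
      obtain ⟨p, hp, hpS⟩ := (hX _).1 h2
      refine h3 ((hX _).2 ⟨p ++ [e], isWalk_append p rfl _ hp, fun f hf => ?_⟩)
      rcases List.mem_append.1 hf with hf | hf
      · exact hpS f hf
      · rw [List.mem_singleton.1 hf]
        exact Finset.mem_sdiff.2 ⟨h1, hF⟩
    rcases h X ((hX _).2 ⟨[], rfl, by simp⟩) ht with ⟨e, he, hs⟩ | hc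
    · exact hs (hFM (hcut he))
    -- `F` has at most `I.k` and at most `I.numArcs` elements, so the truncated `k` suffices.
    · have h1 := Finset.card_le_card hcut
      have h2 := Finset.card_le_univ F
      rw [Fintype.card_fin] at h2
      have h3 : (network I).k = min I.k (I.numArcs + 1) := rfl
      omega

/-! ### Costs and sizes -/

theorem network_c (I : FTPInstance) (e : Fin I.numArcs) :
    ((network I).c e : ℚ) = (I.weight e : ℚ) * ∏ f, ((I.weight f).den : ℚ) := by
  have h1 : ∏ f, ((I.weight f).den : ℚ) = (I.weight e).den *
      ∏ f, if f ≠ e then ((I.weight f).den : ℚ) else 1 := by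
    rw [← Finset.mul_prod_erase _ _ (Finset.mem_univ e)]
    congr 1
    rw [← Finset.prod_subset (Finset.subset_univ (Finset.univ.erase e))]
    · exact Finset.prod_congr rfl fun f hf => by rw [if_pos (Finset.ne_of_mem_erase hf)]
    · intro f _ hf
      rw [if_neg]
      simpa using hf
  have h2 : ((I.weight e : ℚ≥0) : ℚ) * (I.weight e).den = (I.weight e).num := by
    exact_mod_cast congrArg (fun q : ℚ≥0 => (q : ℚ)) (NNRat.mul_den_eq_num (I.weight e))
  rw [h1, ← mul_assoc, h2]
  simp only [network]
  push_cast
  rfl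

theorem network_c_nonneg (I : FTPInstance) (e : Fin I.numArcs) : 0 ≤ (network I).c e :=
  mul_nonneg (by positivity) (Finset.prod_nonneg fun f _ => by split_ifs <;> positivity)

/-- All integer costs carry the same positive factor, the product of the denominators, which
cancels. The truncated `k` is at most the original one. -/
theorem cost_le_of_sum_le {I : FTPInstance} {S T : Finset (Fin I.numArcs)}
    (h : ∑ e ∈ S, (network I).c e ≤ (network I).k * ∑ e ∈ T, (network I).c e) :
    I.cost S ≤ I.k * I.cost T := by
  have hD : (0 : ℚ) < ∏ f, ((I.weight f).den : ℚ) :=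
    Finset.prod_pos fun f _ => by exact_mod_cast (I.weight f).den_pos
  have hsum : ∀ R : Finset (Fin I.numArcs), ((∑ e ∈ R, (network I).c e : ℤ) : ℚ) =
      (I.cost R : ℚ) * ∏ f, ((I.weight f).den : ℚ) := fun R => by
    rw [FTPInstance.cost]
    push_cast
    rw [Finset.sum_mul]
    exact Finset.sum_congr rfl fun e _ => network_c I e
  have h1 : ((∑ e ∈ S, (network I).c e : ℤ) : ℚ) ≤
      (network I).k * ((∑ e ∈ T, (network I).c e : ℤ) : ℚ) := by exact_mod_cast h
  rw [hsum, hsum, ← mul_assoc] at h1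
  have h2 : ((I.cost S : ℚ≥0) : ℚ) ≤ (network I).k * (I.cost T : ℚ) := le_of_mul_le_mul_right h1 hD
  have h3 : ((network I).k : ℚ) ≤ I.k := by exact_mod_cast min_le_left _ _
  have h4 : ((I.cost S : ℚ≥0) : ℚ) ≤ I.k * (I.cost T : ℚ) :=
    h2.trans (mul_le_mul_of_nonneg_right h3 (NNRat.cast_nonneg _))
  exact_mod_cast h4

/-- The sign bit counted with each denominator makes the encoding length bound the number of arcs as
well. -/
theorem sum_size_le (I : FTPInstance) :
    ∑ e, (Nat.size (I.weight e).den + 1) ≤ bitLength I.encode := by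
  rw [bitLength, FTPInstance.encode, List.map_append, List.sum_append, List.map_flatMap,
    List.flatMap_def, List.sum_flatten, List.map_map, Fin.sum_univ_def]
  refine le_add_left (List.sum_le_sum fun e _ => ?_)
  simp only [Function.comp, List.map_cons, List.sum_cons, Int.natAbs_natCast]
  omega

theorem ctx_costs {I : FTPInstance} {σ : State} (h : Header I σ) (hA : Arcs I I.numArcs σ)
    (hoff : ∀ x : Fin I.numVerts, σ.arr aOff (x : ℕ) = (x : ℕ) * (I.numArcs : ℤ)) {L : ℕ}
    (hL : σ.var vBits = L) (hs : ∀ e, Nat.size (I.weight e).den ≤ L) :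
    Ctx (network I) (costs.run σ) := by
  have hf := frame_run costs σ
  have h' := h.frame hf (by decide)
  exact ⟨h'.numVerts, h'.numArcs, h'.val,
    fun e => by rw [hf.arr _ (by decide)]; exact hA.tail e e.2,
    fun e => by rw [hf.arr _ (by decide)]; exact hA.head e e.2, arr_costs h hA hL hs,
    fun e => by rw [hf.arr _ (by decide)]; exact hA.vul e e.2,
    fun e => by rw [hf.arr _ (by decide)]; exact hA.cap e e.2,
    fun x => by rw [hf.arr _ (by decide)]; exact hoff x⟩

/-- The main part of the program computes an approximate solution. -/
theorem solve_spec {I : FTPInstance} {σ : State} (hk : 1 ≤ I.k) (h : Header I σ)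
    (hA : Arcs I I.numArcs σ)
    (hoff : ∀ x : Fin I.numVerts, σ.arr aOff (x : ℕ) = (x : ℕ) * (I.numArcs : ℤ)) {L : ℕ}
    (hL : σ.var vBits = L) (hs : ∀ e, Nat.size (I.weight e).den ≤ L)
    (hD : ∀ i, σ.arr aDist i = 0) (hS : ∀ i, σ.arr aSol i = 0) :
    ∃ answer : Option (Finset (Fin I.numArcs)),
      (solve.run σ).HasOutput (I.encodeAnswer answer) ∧
      (answer = none → ∀ S : Finset (Fin I.numArcs), ¬ I.Feasible S) ∧
      ∀ S : Finset (Fin I.numArcs), answer = some S → I.IsApproxSolution (I.k : ℚ≥0) S := by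
  have hc := network_c_nonneg I
  have hk' : 1 ≤ (network I).k := le_min hk (by omega)
  rw [solve, run_seq, run_seq, run_seq]
  have hf₁ := frame_run costs σ
  have hctx₁ := ctx_costs h hA hoff hL hs
  generalize costs.run σ = σ₁ at hf₁ hctx₁ ⊢
  have h₁ := h.frame hf₁ (by decide)
  have hf₂ := frame_run (.store aDist (rd vS) (lit 1)) σ₁
  have hd₂ : ((LProg.store aDist (rd vS) (lit 1)).run σ₁).arr aDist =
      Function.update (fun _ => 0) ((I.s : ℕ) : ℤ) 1 := by
    have : σ₁.arr aDist = fun _ => 0 := funext fun i => by rw [hf₁.arr _ (by decide), hD]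
    simp [this, h₁.s]
  generalize (LProg.store aDist (rd vS) (lit 1)).run σ₁ = σ₂ at hf₂ hd₂ ⊢
  have h₂ := h₁.frame hf₂ (by decide)
  have hctx₂ := hctx₁.frame hf₂ (by decide)
  have hsol : ∀ x, solution I.numVerts I.numArcs σ₂ x = ∅ := fun x => by
    refine Finset.filter_eq_empty_iff.2 fun e _ => ?_
    rw [rows, hf₂.arr _ (by decide), hf₁.arr _ (by decide), hS]
    norm_num
  have hV : Valid (network I) I.s σ₂ := by
    intro x hx
    rw [hd₂] at hx ⊢
    rw [hsol]
    by_cases hxs : x = I.s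
    · subst hxs
      exact ⟨Network.robust_self _ _, by simp⟩
    · have : ((x : ℕ) : ℤ) ≠ (I.s : ℕ) := by exact_mod_cast fun hh => hxs (Fin.ext hh)
      rw [Function.update_of_ne this] at hx
      norm_num at hx
  obtain ⟨h3, h4⟩ := rounds_spec hctx₂ hc h₂.rounds hV (by simp [Reaches, hd₂])
  have hf₃ := frame_run rounds σ₂
  generalize rounds.run σ₂ = σ₃ at h3 h4 hf₃ ⊢
  have h₃ := h₂.frame hf₃ (by decide)
  have hctx₃ := hctx₂.frame hf₃ (by decide)
  -- The decomposition of `T` gives a chain from the source of cost at most `k * c(T)` with few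
  -- enough hops to be seen by the computed rounds.
  have hreach : ∀ T : Finset (Fin I.numArcs), I.Feasible T →
      Reaches σ₃ I.t ((network I).k * ∑ e ∈ T, (network I).c e) := by
    intro T hT
    have h5 := Network.Chain.append_robust hk' hc T.card le_rfl (robust_of_feasible hT)
      (Network.Chain.nil (N := network I) (s := I.s))
    have h6 := Finset.card_le_univ T
    rw [Fintype.card_fin] at h6
    have h7 := h4 _ _ (h5.mono (r' := 2 * I.numArcs + 1) (by omega))
    rwa [zero_add] at h7
  refine ⟨_, output_spec h₃ hctx₃, fun hn T hT => ?_, fun S hS => ?_⟩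
  · split_ifs at hn with hd
    exact hd (hreach T hT).1
  · split_ifs at hS with hd
    obtain rfl := Option.some.inj hS
    obtain ⟨h5, h6⟩ := h3 I.t hd
    refine ⟨feasible_of_robust h5, fun T hT => cost_le_of_sum_le ?_⟩
    -- The stored distance exceeds the cost of the solution by at least one and exceeds `k * c(T)`
    -- by at most one, so the shifts cancel.
    have := (hreach T hT).2
    omega

/-- The lengths of the denominators. -/
def denSize (I : FTPInstance) (j : ℕ) : ℕ :=
  if h : j < I.numArcs then (I.weight ⟨j, h⟩).den else 0

theorem sum_denSize (I : FTPInstance) :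
    ∑ j ∈ Finset.range (I.numArcs + 1), Nat.size (denSize I j) =
      ∑ e, Nat.size (I.weight e).den := by
  rw [Finset.sum_range_succ, Finset.sum_range]
  simp [denSize]

theorem program_spec {I : FTPInstance} (hk : 1 ≤ I.k) :
    ∃ (answer : Option (Finset (Fin I.numArcs))) (n : ℕ),
      n ≤ readHeader.cost (2 * I.size + 2) + (readInput.cost (2 * I.size + 2) +
        (3 + 20 * I.size + solve.cost (2 * I.size + 2))) ∧
      program.Computes I.encode n (I.encodeAnswer answer) ∧
      (answer = none → ∀ S : Finset (Fin I.numArcs), ¬ I.Feasible S) ∧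
      ∀ S : Finset (Fin I.numArcs), answer = some S → I.IsApproxSolution (I.k : ℚ≥0) S := by
  have hsize := sum_size_le I
  rw [Finset.sum_add_distrib] at hsize
  simp only [Finset.sum_const, Finset.card_univ, Fintype.card_fin, smul_eq_mul, mul_one] at hsize
  set L := ∑ e, Nat.size (I.weight e).den with hL
  have hL' : L + I.numArcs + I.numVerts ≤ I.size := by
    rw [FTPInstance.size]; omega
  -- A common bound for all loop bounds: the vertices, the arcs, the total denominator length `L`,
  -- the `2m + 1` rounds, and the flow value, which after truncation is at most `m + 2`.
  set B := 2 * I.size + 2 with hB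
  set σ₀ := initial I.encode with hσ₀
  obtain ⟨n₁, hn₁, hx₁⟩ := exists_exec (P := readHeader) (ps := []) (by decide) (B := B) (σ := σ₀)
    (by simp)
  have hf₁ := frame_run readHeader σ₀
  have h₁ := header_readHeader I
  rw [← hσ₀] at h₁
  generalize readHeader.run σ₀ = σ₁ at hx₁ hf₁ h₁
  have hn : (I.numVerts : ℤ) ≤ B := by omega
  have hm : (I.numArcs : ℤ) ≤ B := by omega
  obtain ⟨n₂, hn₂, hx₂⟩ := exists_exec (P := readInput) (ps := [vN, vM]) (by decide) (B := B)
    (σ := σ₁) (by simp [h₁.numVerts, h₁.numArcs, hn, hm])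
  have hf₂ := frame_run readInput σ₁
  have harr₀ : ∀ a, a ≠ 0 → ∀ i, σ₀.arr a i = 0 := fun a ha i => by simp [hσ₀, initial, ha]
  have harcs := arcs_readArcs h₁ (by rw [hf₁.arr _ (by decide)])
    (by rw [hf₁.arr _ (by decide), harr₀ _ (by decide)])
  have hoffs := arr_offsets (h₁.frame (frame_run readArcs σ₁) (by decide))
  have hoff₂ : ∀ x : Fin I.numVerts, (readInput.run σ₁).arr aOff (x : ℕ) =
      (x : ℕ) * (I.numArcs : ℤ) := fun x => by
    rw [readInput, run_seq, run_seq, run_arr _ initBits (by decide)]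
    exact hoffs x
  have harcs_frame : ∀ {σ τ : State}, (∀ a, a ≠ aOff → τ.arr a = σ.arr a) →
      Arcs I I.numArcs σ → Arcs I I.numArcs τ := fun {σ τ} hh hA =>
    ⟨by rw [hh _ (by decide)]; exact hA.tail, by rw [hh _ (by decide)]; exact hA.head,
      by rw [hh _ (by decide)]; exact hA.num, by rw [hh _ (by decide)]; exact hA.den,
      by rw [hh _ (by decide)]; exact hA.vul, by rw [hh _ (by decide)]; exact hA.cap,
      by rw [hh _ (by decide)]; exact hA.den_end⟩
  have hA₂ : Arcs I I.numArcs (readInput.run σ₁) := by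
    refine harcs_frame (fun a ha => ?_) harcs
    rw [readInput, run_seq, run_seq, run_arr _ initBits rfl,
      run_arr _ offsets (by simpa [offsets, writesArr] using ha.symm)]
  have hE₂ : (readInput.run σ₁).var cE = 0 := by simp [readInput, initBits]
  have hB₂ : (readInput.run σ₁).var vB = (readInput.run σ₁).arr aDen 0 := by
    simp [readInput, initBits]
  generalize readInput.run σ₁ = σ₂ at hx₂ hf₂ hoff₂ hA₂ hE₂ hB₂
  have h₂ := h₁.frame hf₂ (by decide)
  have hden : ∀ j ≤ I.numArcs, σ₂.arr aDen j = denSize I j := by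
    intro j hj
    rcases hj.eq_or_lt with rfl | hj
    · simp [denSize, hA₂.den_end]
    · simpa [denSize, hj] using hA₂.den ⟨j, hj⟩ hj
  have hbits₀ : σ₂.var vBits = 0 := by
    rw [hf₂.var _ (by decide), hf₁.var _ (by decide)]
    simp [hσ₀, initial]
  have hsum : Nat.size (denSize I 0) + ∑ j ∈ Finset.Ico (0 + 1) (I.numArcs + 1),
      Nat.size (denSize I j) = L := by
    rw [hL, ← sum_denSize, Finset.range_eq_Ico]
    exact (Finset.sum_eq_sum_Ico_succ_bot (Nat.succ_pos _) fun j => Nat.size (denSize I j)).symm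
  obtain ⟨n₃, σ₃, hx₃, hn₃, harr₃, hvar₃, hbits₃⟩ := exec_bitsLoop (denSize I) I.numArcs
    (I.numArcs + L) 0 (denSize I 0) σ₂ (Nat.zero_le _) hE₂ h₂.numArcs
    (by rw [hB₂]; exact hden 0 (Nat.zero_le _)) hden (fun h => by simp [denSize, ← h])
    (by simp [denSize]) (by omega)
  rw [hsum, hbits₀, zero_add] at hbits₃
  have h₃ : Header I σ₃ := by
    have hv : ∀ y, y ≠ cE → y ≠ vB → y ≠ vBits → σ₃.var y = σ₂.var y := hvar₃
    exact ⟨by rw [hv _ (by decide) (by decide) (by decide)]; exact h₂.numVerts,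
      by rw [hv _ (by decide) (by decide) (by decide)]; exact h₂.numArcs,
      by rw [hv _ (by decide) (by decide) (by decide)]; exact h₂.s,
      by rw [hv _ (by decide) (by decide) (by decide)]; exact h₂.t,
      by rw [hv _ (by decide) (by decide) (by decide)]; exact h₂.cap,
      by rw [hv _ (by decide) (by decide) (by decide)]; exact h₂.val,
      by rw [hv _ (by decide) (by decide) (by decide)]; exact h₂.rounds⟩
  have hsz : ∀ e, Nat.size (I.weight e).den ≤ L := fun e =>
    Finset.single_le_sum (f := fun e => Nat.size (I.weight e).den) (fun _ _ => Nat.zero_le _)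
      (Finset.mem_univ e)
  have hzero : ∀ a, a = aDist ∨ a = aSol → ∀ i, σ₃.arr a i = 0 := by
    rintro a (rfl | rfl) i <;>
      rw [harr₃, hf₂.arr _ (by decide), hf₁.arr _ (by decide), harr₀ _ (by decide)]
  obtain ⟨answer, hout, hans⟩ := solve_spec hk h₃
    (harcs_frame (fun a _ => by rw [harr₃]) hA₂) (by rw [harr₃]; exact hoff₂) hbits₃ hsz
    (hzero _ (Or.inl rfl)) (hzero _ (Or.inr rfl))
  have hval : (((network I).k : ℕ) : ℤ) + 1 ≤ B := by
    have : (network I).k ≤ I.numArcs + 1 := min_le_right _ _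
    omega
  have hrounds : ((2 * I.numArcs + 1 : ℕ) : ℤ) ≤ B := by omega
  have hLB : (L : ℤ) ≤ B := by omega
  obtain ⟨n₄, hn₄, hx₄⟩ := exists_exec (P := solve) (ps := [vN, vM, vVal, vBits, vRounds])
    (by decide) (B := B) (σ := σ₃) (by
      simp only [List.forall_mem_cons]
      exact ⟨h₃.numVerts.trans_le hn, h₃.numArcs.trans_le hm, h₃.val.trans_le hval,
        hbits₃.trans_le hLB, h₃.rounds.trans_le hrounds, by simp⟩)
  exact ⟨answer, n₁ + (n₂ + (n₃ + n₄)), by omega, ⟨_, hx₁.seq (hx₂.seq (hx₃.seq hx₄)), hout⟩, hans⟩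

end FaultTolerant

theorem mainTheorem2 :
    ∃ (P : RAM.Prog) (p : Polynomial ℕ), ∀ I : FTPInstance, 1 ≤ I.k →
      ∃ (answer : Option (Finset (Fin I.numArcs))) (n : ℕ),
        n ≤ p.eval I.size ∧
        P.Computes I.encode n (I.encodeAnswer answer) ∧
        (answer = none → ∀ S : Finset (Fin I.numArcs), ¬ I.Feasible S) ∧
        (∀ S : Finset (Fin I.numArcs), answer = some S → I.IsApproxSolution (I.k : ℚ≥0) S) := by
  obtain ⟨p₁, hp₁⟩ := FaultTolerant.readHeader.exists_cost_eq
  obtain ⟨p₂, hp₂⟩ := FaultTolerant.readInput.exists_cost_eq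
  obtain ⟨p₃, hp₃⟩ := FaultTolerant.solve.exists_cost_eq
  refine ⟨FaultTolerant.program, p₁.comp (.C 2 * .X + .C 2) + (p₂.comp (.C 2 * .X + .C 2) +
    (.C 3 + .C 20 * .X + p₃.comp (.C 2 * .X + .C 2))), fun I hk => ?_⟩
  obtain ⟨answer, n, hn, h⟩ := FaultTolerant.program_spec hk
  refine ⟨answer, n, ?_, h⟩
  simpa only [Polynomial.eval_add, Polynomial.eval_comp, Polynomial.eval_mul, Polynomial.eval_C,
    Polynomial.eval_X, hp₁, hp₂, hp₃] using hn
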